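/- Fix $\beta>0$. Consider long-range percolation on $\mathbb Z$: edges are present independently, $\langle i,j\rangle$ with $|i-j|=1$ with probability $1$, and $\langle i,j\rangle$ with $|i-j|>1$ with probability $1-\exp\{-\beta\int_i^{i+1}\int_j^{j+1}|u-v|^{-2}\,du\,dv\}$; write $u\sim v$ if $\langle u,v\rangle$ is present. A flow is a function $f:\mathbb Z^2\to\mathbb R$ with $f_{uv}=-f_{vu}$ if $u\sim v$ and $f_{uv}=0$ otherwise, and $\sum_v|f_{uv}|<\infty$ for all $u$; put $f_{(u)}=\sum_v f_{uv}$. It is a unit flow from a finite set $J_1$ to a finite set $J_2$ disjoint from it if $\sum_{u\in J_1}f_{(u)}=1$, $\sum_{u\in J_2}f_{(u)}=-1$ and $f_{(u)}=0$ for $u\notin J_1\cup J_2$. For $n\ge1$ let $$\widehat R_n=\inf_f\ \tfrac12\sum_{(u,v):\,u\sim v}f_{uv}^2,$$ where the infimum is over all unit flows $f$ from a finite subset of $(-\infty,0]$ to a finite subset of $(2^n,\infty)$ such that $f_{uv}=0$ whenever $u\le 0$ and $v>2^n$. For $\alpha\in(0,1)$ let $$a_{\alpha,n}=\sup\{r\ge0:\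 \mathbb P[\widehat R_n\ge r]\ge 1-\alpha\}.$$ For $L,M>0$ and $n\ge 1$ define $d_0=0$, $d_k=d_{k-1}+M+L\log(M+d_{k-1})$ for $k\ge1$, $b_k=n-d_k$, and $K_n=\sup\{k\ge0: b_k\ge0\}$. Then there exist constants $c>0$ and $L>0$ depending only on $\beta$ such that for every $\alpha\in(0,1/2]$ there exist $M'=M'(\alpha)>0$ and $n_0'=n_0'(\alpha)>0$, depending only on $\beta$ and $\alpha$, such that for all $M\ge M'$ and all integers $n>n_0'$, $$a_{\alpha,n}\ \ge\ c\sum_{k=2}^{K_n}\frac{\min\{a_{\alpha,j}:\ j\in\mathbb Z,\ b_k<j\le b_{k-1}\}}{d_k}.$$ -/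

import Mathlib

open MeasureTheory
open scoped ENNReal

namespace LRP

/-! ### Critical long-range percolation on the integers -/

/-- Index set of the potential edges: unordered pairs of distinct integers, listed as `(i, j)`
with `i < j`. -/
abbrev Edge : Type := {e : ℤ × ℤ // e.1 < e.2}

/-- A percolation configuration: `ω e = true` means that the edge `e` is present. -/
abbrev Config : Type := Edge → Bool

/-- The probability that the edge `⟨i, j⟩` is present: `1` for nearest neighbours, and
`1 - exp (-β ∫_i^{i+1} ∫_j^{j+1} |u - v|⁻² du dv)` for long edges. -/
noncomputable def edgeProb (β : ℝ) (e : Edge) : ℝ :=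
  if e.1.2 = e.1.1 + 1 then 1
  else 1 - Real.exp (-β * ∫ u in (e.1.1 : ℝ)..(e.1.1 + 1), ∫ v in (e.1.2 : ℝ)..(e.1.2 + 1),
    1 / |u - v| ^ 2)

/-- For `β ≥ 0` the edge probabilities lie in `[0, 1]`, so that the projection onto `[0, 1]` in the
definition of `lrpMeasure` changes nothing. -/
theorem edgeProb_mem {β : ℝ} (hβ : 0 ≤ β) (e : Edge) : edgeProb β e ∈ Set.Icc (0 : ℝ) 1 := by
  unfold edgeProb
  split_ifs with h
  · simp
  · have h0 : 0 ≤ ∫ u in (e.1.1 : ℝ)..(e.1.1 + 1), ∫ v in (e.1.2 : ℝ)..(e.1.2 + 1),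
        1 / |u - v| ^ 2 := by
      apply intervalIntegral.integral_nonneg (by linarith)
      intro u _
      apply intervalIntegral.integral_nonneg (by linarith)
      intro v _
      positivity
    have h1 : Real.exp (-β * ∫ u in (e.1.1 : ℝ)..(e.1.1 + 1),
        ∫ v in (e.1.2 : ℝ)..(e.1.2 + 1), 1 / |u - v| ^ 2) ≤ 1 := by
      apply Real.exp_le_one_iff.mpr
      have := mul_nonneg hβ h0
      linarith
    constructor
    · linarith
    · linarith [Real.exp_pos (-β * ∫ u in (e.1.1 : ℝ)..(e.1.1 + 1),
        ∫ v in (e.1.2 : ℝ)..(e.1.2 + 1), 1 / |u - v| ^ 2)]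

/-- The law of the `β`-LRP model: the edges are present independently, the edge `e` with
probability `edgeProb β e`. -/
noncomputable def lrpMeasure (β : ℝ) : Measure Config :=
  Measure.infinitePi fun e : Edge =>
    ProbabilityTheory.bernoulliMeasure true false
      (Set.projIcc (0 : ℝ) 1 zero_le_one (edgeProb β e))

/-- The random graph on `ℤ` determined by a configuration. -/
def graph (ω : Config) : SimpleGraph ℤ where
  Adj i j := (∃ h : i < j, ω ⟨(i, j), h⟩ = true) ∨ (∃ h : j < i, ω ⟨(j, i), h⟩ = true)
  symm := ⟨fun _ _ h => h.symm⟩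
  loopless := ⟨fun i h => by
    rcases h with ⟨h, -⟩ | ⟨h, -⟩ <;> exact lt_irrefl i h⟩

/-! ### Flows and effective resistance -/

/-- A flow on a graph: an antisymmetric function supported on the (oriented) edges. -/
structure IsFlow (G : SimpleGraph ℤ) (f : ℤ → ℤ → ℝ) : Prop where
  antisymm : ∀ i j, G.Adj i j → f i j = -f j i
  off_edges : ∀ i j, ¬ G.Adj i j → f i j = 0

/-- The net flow out of the vertex `i`. -/
noncomputable def netFlow (f : ℤ → ℤ → ℝ) (i : ℤ) : ℝ := ∑' j, f i j

/-- `f` is a unit flow from the finite set `J₁` to the finite set `J₂`. Summability is automatic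
when all degrees are finite, which holds almost surely in the model. -/
structure IsUnitFlow (G : SimpleGraph ℤ) (J₁ J₂ : Finset ℤ) (f : ℤ → ℤ → ℝ) : Prop
    extends IsFlow G f where
  summable : ∀ i, Summable (f i)
  source : ∑ i ∈ J₁, netFlow f i = 1
  sink : ∑ i ∈ J₂, netFlow f i = -1
  conserved : ∀ i, i ∉ J₁ → i ∉ J₂ → netFlow f i = 0

/-- The energy `½ ∑_{u ∼ v} f_{uv}²`, the sum running over ordered pairs. -/
noncomputable def energy (f : ℤ → ℤ → ℝ) : ℝ≥0∞ :=
  (∑' u : ℤ, ∑' v : ℤ, ENNReal.ofReal (f u v ^ 2)) / 2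

/-- The admissible flows in the definition of the effective resistance through `(0, 2 ^ n]`:
unit flows from a finite subset of `(-∞, 0]` to a finite subset of `(2 ^ n, ∞)` that vanish on all
edges joining `(-∞, 0]` directly to `(2 ^ n, ∞)`. -/
def Admissible (G : SimpleGraph ℤ) (n : ℕ) (f : ℤ → ℤ → ℝ) : Prop :=
  (∃ J₁ J₂ : Finset ℤ, (∀ i ∈ J₁, i ≤ 0) ∧ (∀ j ∈ J₂, (2 : ℤ) ^ n < j) ∧ IsUnitFlow G J₁ J₂ f) ∧
    ∀ u v : ℤ, u ≤ 0 → (2 : ℤ) ^ n < v → f u v = 0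

/-- The effective resistance generated by unit flows from `(-∞, 0]` to `(2 ^ n, ∞)` passing
through `(0, 2 ^ n]`. -/
noncomputable def resistance (n : ℕ) (ω : Config) : ℝ≥0∞ :=
  ⨅ (f : ℤ → ℤ → ℝ) (_ : Admissible (graph ω) n f), energy f

/-- The `(1 - α)`-quantile of the effective resistance. -/
noncomputable def quantile (β α : ℝ) (n : ℕ) : ℝ :=
  sSup {r : ℝ | 0 ≤ r ∧
    1 - α ≤ (lrpMeasure β).real {ω | ENNReal.ofReal r ≤ resistance n ω}}

/-! ### The scales -/

/-- `d 0 = 0` and `d (k + 1) = d k + M + L log (M + d k)`. -/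
noncomputable def d (L M : ℝ) : ℕ → ℝ
  | 0 => 0
  | k + 1 => d L M k + M + L * Real.log (M + d L M k)

/-- `b k = n - d k`. -/
noncomputable def b (L M : ℝ) (n k : ℕ) : ℝ := n - d L M k

/-- The last index `k` with `b k ≥ 0`. -/
noncomputable def K (L M : ℝ) (n : ℕ) : ℕ := sSup {k : ℕ | 0 ≤ b L M n k}

/-- The minimum of the quantiles `a_j` over the integers `j ∈ (b k, b (k - 1)]`, for `k ≥ 1`. -/
noncomputable def minQuantile (β α L M : ℝ) (n k : ℕ) : ℝ :=
  sInf (quantile β α '' {j : ℕ | b L M n k < j ∧ (j : ℝ) ≤ b L M n (k - 1)})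

end LRP

/-! Cut the scales into the windows `(b k, b (k - 1)]`. It is shown that, off an event of
probability at most `α`, every admissible flow of finite energy dissipates in each window an energy
of order `min a_j / d k`, in regions that are disjoint for different windows. Summing over `k` gives
the bound.

Deterministic part. Suppose that the window contains a scale `j` that is good around `0`: the blocks
at distance `2 ^ j` have resistance at least the quantile and no edge longer than `2 ^ j / 4`
touches the ball of radius `2 ^ (j + 3)`. Then the unit of flow leaving `(-∞, 0]` either crosses the
block `(2 ^ j, 2 ^ (j + 1)]` or jumps over the ball along an open edge (`flux_at_zero`). If the
endpoint of each such edge has its own good scale in the same window, the flow carried by the edge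
must cross one of two blocks around that endpoint (`landing_energy`). Each dyadic shell receives a
bounded expected number of edges from `(-∞, 0]`, so there are at most `N = O(d k)` edges to
consider, and Cauchy–Schwarz over `1 + N` channels yields an energy of order `min a_j / (1 + N)`.
Goodness also keeps the regions apart: two landing points too close to each other would put a
forbidden long edge into a ball (`disjoint_ring_ring`). This is assembled in `sum_le_sum_rowEnergy`.

Probabilistic part. At scales `t` apart, the local part of goodness depends on disjoint sets of
edges and has probability bounded below, uniformly in `α ≤ 1 / 2`. A very long edge can spoil
several scales at once, but the number of spoiled scales has a small exponential moment once `t` is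
large. So `m` scales are all bad with probability at most `2 exp (-κ m)`, also conditionally on the
landing edge being open (`exists_no_good_scale_le`). The logarithm in the length of the window makes
this smaller than the inverse fourth power of `M + d (k - 1)`, which beats the union bound over the
landing edges and is summable in `k`.

Two technical points. Admissible flows may have infinite support and could leak to `-∞`; a
recurrence argument based on the energy far to the left excludes this (`flux_eq_one`). And
`blockRes` uses only the short edges at a block: this can only raise the resistance, and it makes
block events depend on finitely many edges. -/

namespace LRP

/-! ### Edge probabilities -/

/-- The length of an edge. -/
def len (e : Edge) : ℤ := e.1.2 - e.1.1

theorem len_pos (e : Edge) : 0 < len e := by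
  have := e.2
  unfold len
  omega

/-- Constant such that the edge `e` is present with probability at most `decay β / len e ^ 2`. -/
noncomputable def decay (β : ℝ) : ℝ := max 1 (4 * β)

theorem one_le_decay (β : ℝ) : 1 ≤ decay β := le_max_left _ _

theorem decay_pos (β : ℝ) : 0 < decay β := lt_of_lt_of_le one_pos (one_le_decay β)

/-- The two unit cells are at distance at least `l - 1 ≥ l / 2`, where `l = j - i`, and the domain
of integration has area one. -/
theorem integral_kernel_le (i j : ℤ) (h : i + 2 ≤ j) :
    ∫ u in (i : ℝ)..(i + 1), ∫ v in (j : ℝ)..(j + 1), 1 / |u - v| ^ 2 ≤ 4 / ((j - i : ℤ) : ℝ) ^ 2 := by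
  have hl : (2 : ℝ) ≤ ((j - i : ℤ) : ℝ) := by exact_mod_cast (by omega : (2 : ℤ) ≤ j - i)
  set l : ℝ := ((j - i : ℤ) : ℝ) with hl'
  have hji : (j : ℝ) = i + l := by simp [hl']
  have key : ∀ u ∈ Set.uIoc (i : ℝ) (i + 1), ∀ v ∈ Set.uIoc (j : ℝ) (j + 1),
      ‖1 / |u - v| ^ 2‖ ≤ 4 / l ^ 2 := by
    intro u hu v hv
    rw [Set.uIoc_of_le (by linarith)] at hu hv
    have h1 : l / 2 ≤ |u - v| := by
      rw [abs_sub_comm]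
      refine le_trans ?_ (le_abs_self _)
      linarith [hu.1, hu.2, hv.1, hv.2]
    rw [Real.norm_of_nonneg (by positivity)]
    have : (l / 2) ^ 2 ≤ |u - v| ^ 2 := by gcongr
    calc 1 / |u - v| ^ 2 ≤ 1 / (l / 2) ^ 2 := by
          apply one_div_le_one_div_of_le (by positivity) this
      _ = 4 / l ^ 2 := by field_simp; norm_num
  have h2 : ∀ u ∈ Set.uIoc (i : ℝ) (i + 1),
      ‖∫ v in (j : ℝ)..(j + 1), 1 / |u - v| ^ 2‖ ≤ 4 / l ^ 2 := by
    intro u hu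
    have := intervalIntegral.norm_integral_le_of_norm_le_const (key u hu)
    simpa using this
  have h3 := intervalIntegral.norm_integral_le_of_norm_le_const h2
  have h4 : |(i : ℝ) + 1 - i| = 1 := by simp
  rw [h4, mul_one] at h3
  exact (le_abs_self _).trans h3

theorem edgeProb_le {β : ℝ} (hβ : 0 ≤ β) (e : Edge) : edgeProb β e ≤ decay β / (len e : ℝ) ^ 2 := by
  have he := e.2
  unfold edgeProb
  split_ifs with h
  · have : len e = 1 := by unfold len; omega
    rw [this]
    simpa using one_le_decay β
  · have h1 := integral_kernel_le e.1.1 e.1.2 (by omega)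
    set I := ∫ u in (e.1.1 : ℝ)..(e.1.1 + 1), ∫ v in (e.1.2 : ℝ)..(e.1.2 + 1), 1 / |u - v| ^ 2
    have h2 := Real.add_one_le_exp (-β * I)
    have h3 : β * I ≤ β * (4 / (len e : ℝ) ^ 2) := mul_le_mul_of_nonneg_left h1 hβ
    have h4 : β * (4 / (len e : ℝ) ^ 2) ≤ decay β / (len e : ℝ) ^ 2 := by
      rw [← mul_div_assoc]
      gcongr
      rw [mul_comm]
      exact le_max_right _ _
    linarith

theorem le_one_sub_edgeProb {β : ℝ} (hβ : 0 ≤ β) (e : Edge) (h : 2 ≤ len e) :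
    Real.exp (-(4 * β / (len e : ℝ) ^ 2)) ≤ 1 - edgeProb β e := by
  unfold len at h
  unfold edgeProb
  rw [if_neg (by omega)]
  have h1 := integral_kernel_le e.1.1 e.1.2 (by omega)
  have h3 := mul_le_mul_of_nonneg_left h1 hβ
  rw [sub_sub_cancel]
  apply Real.exp_le_exp.mpr
  have : 4 * β / (len e : ℝ) ^ 2 = β * (4 / ((e.1.2 - e.1.1 : ℤ) : ℝ) ^ 2) := by
    unfold len; ring
  rw [this]
  linarith

/-- Translation of an edge. -/
def shiftEdge (y : ℤ) (e : Edge) : Edge := ⟨(e.1.1 + y, e.1.2 + y), by have := e.2; simpa using this⟩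

theorem shiftEdge_injective (y : ℤ) : Function.Injective (shiftEdge y) := by
  rintro ⟨⟨a, b⟩, h⟩ ⟨⟨a', b'⟩, h'⟩ he
  simpa [shiftEdge] using he

theorem edgeProb_shiftEdge (β : ℝ) (y : ℤ) (e : Edge) : edgeProb β (shiftEdge y e) = edgeProb β e := by
  unfold edgeProb shiftEdge
  simp only
  have h : (e.1.2 + y = e.1.1 + y + 1) ↔ (e.1.2 = e.1.1 + 1) := by omega
  simp only [h]
  have : ∫ u in ((e.1.1 + y : ℤ) : ℝ)..((e.1.1 + y : ℤ) + 1),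
      ∫ v in ((e.1.2 + y : ℤ) : ℝ)..((e.1.2 + y : ℤ) + 1), 1 / |u - v| ^ 2 =
      ∫ u in (e.1.1 : ℝ)..(e.1.1 + 1), ∫ v in (e.1.2 : ℝ)..(e.1.2 + 1), 1 / |u - v| ^ 2 := by
    have h1 : ((e.1.1 + y : ℤ) : ℝ) + 1 = (e.1.1 + 1 : ℝ) + y := by push_cast; ring
    have h2 : ((e.1.2 + y : ℤ) : ℝ) + 1 = (e.1.2 + 1 : ℝ) + y := by push_cast; ring
    rw [h1, h2, Int.cast_add, Int.cast_add,
      ← intervalIntegral.integral_comp_add_right (fun u => ∫ v in (e.1.2 + y : ℝ)..(e.1.2 + 1 + y),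
        1 / |u - v| ^ 2)]
    congr 1
    ext u
    rw [← intervalIntegral.integral_comp_add_right (fun v => 1 / |u + y - v| ^ 2)]
    simp
  rw [this]

/-! ### The percolation measure -/

instance (β : ℝ) : IsProbabilityMeasure (lrpMeasure β) := by
  unfold lrpMeasure
  infer_instance

theorem lrpMeasure_coord (β : ℝ) (e : Edge) (s : Set Bool) : lrpMeasure β {ω | ω e ∈ s} =
    ProbabilityTheory.bernoulliMeasure true false
      (Set.projIcc (0 : ℝ) 1 zero_le_one (edgeProb β e)) s := by
  unfold lrpMeasure
  rw [← Measure.infinitePi_map_eval (fun e : Edge => ProbabilityTheory.bernoulliMeasure true false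
      (Set.projIcc (0 : ℝ) 1 zero_le_one (edgeProb β e))) e,
    Measure.map_apply (by fun_prop) (MeasurableSet.of_discrete)]
  rfl

theorem lrpMeasure_open {β : ℝ} (hβ : 0 ≤ β) (e : Edge) :
    lrpMeasure β {ω | ω e = true} = ENNReal.ofReal (edgeProb β e) := by
  have h := lrpMeasure_coord β e {true}
  simp only [Set.mem_singleton_iff] at h
  rw [h, ProbabilityTheory.bernoulliMeasure_apply _ (MeasurableSet.of_discrete),
    Set.projIcc_of_mem _ (edgeProb_mem hβ e)]
  simp [ENNReal.ofReal, unitInterval.toNNReal, Real.toNNReal_of_nonneg (edgeProb_mem hβ e).1]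
  rfl

theorem lrpMeasure_closed {β : ℝ} (hβ : 0 ≤ β) (e : Edge) :
    lrpMeasure β {ω | ω e = false} = ENNReal.ofReal (1 - edgeProb β e) := by
  have h1 : {ω : Config | ω e = false} = {ω | ω e = true}ᶜ := by ext; simp
  rw [h1, measure_compl (measurableSet_eq_fun (by fun_prop) (by fun_prop)) (measure_ne_top _ _),
    lrpMeasure_open hβ, measure_univ, ENNReal.ofReal_sub _ (edgeProb_mem hβ e).1, ENNReal.ofReal_one]

/-- Translation of a configuration. -/
def shift (y : ℤ) (ω : Config) : Config := fun e => ω (shiftEdge y e)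

theorem measurePreserving_shift (β : ℝ) (y : ℤ) :
    MeasurePreserving (shift y) (lrpMeasure β) (lrpMeasure β) := by
  refine ⟨by unfold shift; fun_prop, ?_⟩
  unfold lrpMeasure shift
  rw [Measure.map_infinitePi_infinitePi_of_inj (shiftEdge_injective y)]
  simp only [edgeProb_shiftEdge]

/-! ### Functions of finitely many edges -/

/-- The map factors through a finite space. This is the source of measurability for the block
events, which are defined by an infimum over flows. -/
theorem measurable_of_dependsOn {α : Type*} [MeasurableSpace α] [Nonempty α] {f : Config → α}
    {S : Finset Edge} (hf : DependsOn f S) : Measurable f := by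
  obtain ⟨g, rfl⟩ := dependsOn_iff_exists_comp.1 hf
  exact (measurable_of_finite g).comp (by fun_prop)

theorem measurableSet_of_dependsOn {A : Set Config} {S : Finset Edge}
    (hA : DependsOn (· ∈ A) (S : Set Edge)) : MeasurableSet A := by
  have := measurable_of_dependsOn hA
  exact measurableSet_setOfPred.2 this

theorem lintegral_mul_of_dependsOn (β : ℝ) {f g : Config → ℝ≥0∞} {S T : Finset Edge}
    (hf : DependsOn f S) (hg : DependsOn g T) (hST : Disjoint S T) :
    ∫⁻ ω, f ω * g ω ∂lrpMeasure β = (∫⁻ ω, f ω ∂lrpMeasure β) * ∫⁻ ω, g ω ∂lrpMeasure β := by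
  refine ProbabilityTheory.lintegral_mul_eq_lintegral_mul_lintegral_of_indepFun
    (measurable_of_dependsOn hf) (measurable_of_dependsOn hg) ?_
  obtain ⟨f', rfl⟩ := dependsOn_iff_exists_comp.1 hf
  obtain ⟨g', rfl⟩ := dependsOn_iff_exists_comp.1 hg
  have h := (ProbabilityTheory.iIndepFun_infinitePi
    (P := fun e : Edge => ProbabilityTheory.bernoulliMeasure true false
      (Set.projIcc (0 : ℝ) 1 zero_le_one (edgeProb β e)))
    (X := fun _ (b : Bool) => b) (fun _ => measurable_id)).indepFun_finset S T hST
      (fun e => by fun_prop)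
  exact h.comp (φ := f') (ψ := g') (measurable_of_finite _) (measurable_of_finite _)

theorem dependsOn_prod {ι : Type*} {s : Finset ι} {f : ι → Config → ℝ≥0∞} {S : ι → Finset Edge}
    (hf : ∀ i ∈ s, DependsOn (f i) (S i)) :
    DependsOn (fun ω => ∏ i ∈ s, f i ω) (s.biUnion S : Finset Edge) := by
  intro x y h
  refine Finset.prod_congr rfl fun i hi => hf i hi fun e he => h e ?_
  simp only [Finset.coe_biUnion, Set.mem_iUnion]
  exact ⟨i, hi, he⟩

theorem lintegral_prod_of_dependsOn (β : ℝ) {ι : Type*} {s : Finset ι}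
    {f : ι → Config → ℝ≥0∞} {S : ι → Finset Edge} (hf : ∀ i ∈ s, DependsOn (f i) (S i))
    (hS : ∀ i ∈ s, ∀ j ∈ s, i ≠ j → Disjoint (S i) (S j)) :
    ∫⁻ ω, ∏ i ∈ s, f i ω ∂lrpMeasure β = ∏ i ∈ s, ∫⁻ ω, f i ω ∂lrpMeasure β := by
  classical
  induction s using Finset.induction_on with
  | empty => simp
  | insert i s hi ih =>
    simp only [Finset.prod_insert hi]
    rw [lintegral_mul_of_dependsOn β (hf i (by simp))
      (dependsOn_prod fun j hj => hf j (by simp [hj])), ih]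
    · exact fun j hj => hf j (by simp [hj])
    · exact fun j hj k hk => hS j (by simp [hj]) k (by simp [hk])
    · rw [Finset.disjoint_biUnion_right]
      exact fun j hj => hS i (by simp) j (by simp [hj]) (by rintro rfl; exact hi hj)

theorem dependsOn_indicator {A : Set Config} {S : Set Edge} (hA : DependsOn (· ∈ A) S) (c : ℝ≥0∞) :
    DependsOn (A.indicator fun _ => c) S := by
  intro x y h
  have h' : (x ∈ A) = (y ∈ A) := hA h
  by_cases hx : x ∈ A
  · rw [Set.indicator_of_mem hx, Set.indicator_of_mem (h' ▸ hx)]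
  · rw [Set.indicator_of_notMem hx, Set.indicator_of_notMem (h' ▸ hx)]

theorem measure_inter_of_dependsOn (β : ℝ) {A B : Set Config} {S T : Finset Edge}
    (hA : DependsOn (· ∈ A) (S : Set Edge)) (hB : DependsOn (· ∈ B) (T : Set Edge))
    (hST : Disjoint S T) :
    lrpMeasure β (A ∩ B) = lrpMeasure β A * lrpMeasure β B := by
  have mA := measurableSet_of_dependsOn hA
  have mB := measurableSet_of_dependsOn hB
  have h := lintegral_mul_of_dependsOn β (f := A.indicator 1) (g := B.indicator 1)
    (S := S) (T := T) (dependsOn_indicator hA 1)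
    (dependsOn_indicator hB 1) hST
  rw [lintegral_indicator_one mA, lintegral_indicator_one mB] at h
  rw [← h, ← lintegral_indicator_one (mA.inter mB), Set.inter_indicator_one]
  rfl

/-! ### Exponential moments -/

/-- The exact value is `1 + p (exp w - 1)`, and `1 + x ≤ exp x`. -/
theorem lintegral_exp_open {β : ℝ} (hβ : 0 ≤ β) (e : Edge) {w : ℝ} (hw : 0 ≤ w) :
    ∫⁻ ω, ENNReal.ofReal (Real.exp (if ω e = true then w else 0)) ∂lrpMeasure β ≤
      ENNReal.ofReal (Real.exp (edgeProb β e * (Real.exp w - 1))) := by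
  have hm : MeasurableSet {ω : Config | ω e = true} :=
    measurableSet_eq_fun (by fun_prop) (by fun_prop)
  have h1 : ∀ ω : Config, ENNReal.ofReal (Real.exp (if ω e = true then w else 0)) =
      1 + {ω : Config | ω e = true}.indicator
        (fun _ => ENNReal.ofReal (Real.exp w - 1)) ω := by
    intro ω
    by_cases h : ω e = true
    · have : 1 ≤ Real.exp w := Real.one_le_exp hw
      simp only [h, if_true, Set.indicator, Set.mem_ofPred_eq]
      rw [← ENNReal.ofReal_one, ← ENNReal.ofReal_add zero_le_one (by linarith)]
      congr 1; ring
    · simp [h]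
  have h2 : 0 ≤ Real.exp w - 1 := by linarith [Real.one_le_exp hw]
  have h3 := (edgeProb_mem hβ e).1
  simp only [h1]
  rw [lintegral_add_left measurable_const, lintegral_indicator_const hm, lrpMeasure_open hβ,
    lintegral_const, measure_univ, one_mul, ← ENNReal.ofReal_mul h2, ← ENNReal.ofReal_one,
    ← ENNReal.ofReal_add zero_le_one (by positivity)]
  apply ENNReal.ofReal_le_ofReal
  have := Real.add_one_le_exp (edgeProb β e * (Real.exp w - 1))
  linarith

/-- Chernoff bound for a weighted number of open edges in a finite set. -/
theorem chernoff_finset {β : ℝ} (hβ : 0 ≤ β) {w : Edge → ℝ} (hw : ∀ e, 0 ≤ w e) (T : Finset Edge)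
    {A : ℝ} (hA : ∑ e ∈ T, edgeProb β e * (Real.exp (w e) - 1) ≤ A) (a : ℝ) :
    lrpMeasure β {ω | a ≤ ∑ e ∈ T, if ω e = true then w e else 0} ≤
      ENNReal.ofReal (Real.exp (A - a)) := by
  have hdep : ∀ e ∈ T, DependsOn
      (fun ω : Config => ENNReal.ofReal (Real.exp (if ω e = true then w e else 0)))
      (({e} : Finset Edge) : Set Edge) := by
    intro e _ x y h
    have : x e = y e := h e (by simp)
    simp only [this]
  have h1 := lintegral_prod_of_dependsOn β hdep
    (fun i _ j _ hij => by simpa using hij)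
  have h2 : ∫⁻ ω, ∏ e ∈ T, ENNReal.ofReal (Real.exp (if ω e = true then w e else 0)) ∂lrpMeasure β
      ≤ ENNReal.ofReal (Real.exp A) := by
    rw [h1]
    calc _ ≤ ∏ e ∈ T, ENNReal.ofReal (Real.exp (edgeProb β e * (Real.exp (w e) - 1))) :=
          Finset.prod_le_prod' fun e _ => lintegral_exp_open hβ e (hw e)
      _ = ENNReal.ofReal (Real.exp (∑ e ∈ T, edgeProb β e * (Real.exp (w e) - 1))) := by
          rw [← ENNReal.ofReal_prod_of_nonneg (fun _ _ => (Real.exp_pos _).le), Real.exp_sum]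
      _ ≤ _ := ENNReal.ofReal_le_ofReal (Real.exp_le_exp.2 hA)
  have h3 : {ω : Config | a ≤ ∑ e ∈ T, if ω e = true then w e else 0} ⊆
      {ω | ENNReal.ofReal (Real.exp a) ≤
        ∏ e ∈ T, ENNReal.ofReal (Real.exp (if ω e = true then w e else 0))} := by
    intro ω h
    simp only [Set.mem_ofPred_eq] at h ⊢
    rw [← ENNReal.ofReal_prod_of_nonneg (fun _ _ => (Real.exp_pos _).le), ← Real.exp_sum]
    exact ENNReal.ofReal_le_ofReal (Real.exp_le_exp.2 h)
  refine (measure_mono h3).trans ?_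
  refine (meas_ge_le_lintegral_div (measurable_of_dependsOn (dependsOn_prod hdep)).aemeasurable
    (by simpa using Real.exp_pos a) ENNReal.ofReal_ne_top).trans ?_
  rw [Real.exp_sub, ENNReal.ofReal_div_of_pos (Real.exp_pos a)]
  gcongr

theorem dependsOn_sum_open (T : Finset Edge) (w : Edge → ℝ) (a : ℝ) :
    DependsOn (· ∈ {ω : Config | a ≤ ∑ e ∈ T, if ω e = true then w e else 0})
      (T : Set Edge) := by
  intro x y h
  have : ∑ e ∈ T, (if x e = true then w e else 0) = ∑ e ∈ T, if y e = true then w e else 0 :=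
    Finset.sum_congr rfl fun e he => by rw [h e he]
  simp only [Set.mem_ofPred_eq, this]

/-- Chernoff bound for a weighted number of open edges, on the event that the edge `e` of weight
`0` is open. -/
theorem chernoff_of_open {β : ℝ} (hβ : 0 ≤ β) {w : Edge → ℝ} (hw : ∀ e, 0 ≤ w e)
    {A : ℝ} (hA : ∀ T : Finset Edge, ∑ e ∈ T, edgeProb β e * (Real.exp (w e) - 1) ≤ A) (a : ℝ)
    {B : Set Config} {S : Finset Edge} (hB : DependsOn (· ∈ B) (S : Set Edge))
    (hS : ∀ e ∈ S, w e = 0) :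
    lrpMeasure β (B ∩ {ω | ∃ T : Finset Edge, a ≤ ∑ e ∈ T, if ω e = true then w e else 0}) ≤
      lrpMeasure β B * ENNReal.ofReal (Real.exp (A - a)) := by
  have h1 : B ∩ {ω | ∃ T : Finset Edge, a ≤ ∑ e ∈ T, if ω e = true then w e else 0} =
      ⋃ T : Finset Edge, B ∩ {ω | a ≤ ∑ e ∈ T, if ω e = true then w e else 0} := by
    ext ω; simp
  -- Nonnegative weights make the union over finite `T` directed, so its measure is a supremum and
  -- the bound for fixed `T` suffices.
  have hmono : Monotone fun T : Finset Edge =>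
      B ∩ {ω : Config | a ≤ ∑ e ∈ T, if ω e = true then w e else 0} := by
    intro T T' hT
    refine Set.inter_subset_inter_right _ fun ω h => ?_
    simp only [Set.mem_ofPred_eq] at h ⊢
    refine h.trans ?_
    exact Finset.sum_le_sum_of_subset_of_nonneg hT fun e _ _ => by split_ifs <;> simp [hw]
  rw [h1, hmono.measure_iUnion]
  refine iSup_le fun T => ?_
  -- Removing the weightless edges of `S` makes the sum independent of `B`.
  have h2 : {ω : Config | a ≤ ∑ e ∈ T, if ω e = true then w e else 0} =
      {ω | a ≤ ∑ e ∈ T \ S, if ω e = true then w e else 0} := by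
    ext ω
    have : ∑ e ∈ T \ S, (if ω e = true then w e else 0) =
        ∑ e ∈ T, if ω e = true then w e else 0 := by
      refine Finset.sum_subset Finset.sdiff_subset fun e he hne => ?_
      have : e ∈ S := by simpa [he] using hne
      simp [hS e this]
    simp only [Set.mem_ofPred_eq, this]
  rw [h2, measure_inter_of_dependsOn β hB (dependsOn_sum_open _ _ _) Finset.disjoint_sdiff]
  gcongr
  exact chernoff_finset hβ hw _ (hA _) a

theorem chernoff {β : ℝ} (hβ : 0 ≤ β) {w : Edge → ℝ} (hw : ∀ e, 0 ≤ w e)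
    {A : ℝ} (hA : ∀ T : Finset Edge, ∑ e ∈ T, edgeProb β e * (Real.exp (w e) - 1) ≤ A) (a : ℝ) :
    lrpMeasure β {ω | ∃ T : Finset Edge, a ≤ ∑ e ∈ T, if ω e = true then w e else 0} ≤
      ENNReal.ofReal (Real.exp (A - a)) := by
  have := chernoff_of_open hβ hw hA a (B := Set.univ) (S := ∅) (fun _ _ _ => rfl) (by simp)
  simpa using this

/-! ### Sums of edge probabilities -/

theorem sum_inv_sq_le (s : Finset ℤ) (q : ℤ) (hq : 1 ≤ q) (hs : ∀ l ∈ s, q ≤ l) :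
    ∑ l ∈ s, 1 / (l : ℝ) ^ 2 ≤ 2 / (q : ℝ) := by
  obtain ⟨k, rfl⟩ : ∃ k : ℕ, q = k + 1 := ⟨(q - 1).toNat, by omega⟩
  have hinj : Set.InjOn Int.toNat (s : Set ℤ) := by
    intro a ha b hb h
    have := hs a ha
    have := hs b hb
    omega
  have h1 : ∑ l ∈ s, 1 / (l : ℝ) ^ 2 = ∑ i ∈ s.image Int.toNat, ((i : ℝ) ^ 2)⁻¹ := by
    rw [Finset.sum_image hinj]
    refine Finset.sum_congr rfl fun l hl => ?_
    have h2 : ((l.toNat : ℤ) : ℝ) = (l : ℝ) := by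
      have := hs l hl
      rw [Int.toNat_of_nonneg (by omega)]
    rw [← h2, Int.cast_natCast, one_div]
  rw [h1]
  set n := (s.image Int.toNat).sup id + 1
  have h3 : s.image Int.toNat ⊆ Finset.Ioo k n := by
    intro i hi
    have h4 : i ≤ (s.image Int.toNat).sup id := Finset.le_sup (f := id) hi
    simp only [Finset.mem_image] at hi
    obtain ⟨l, hl, rfl⟩ := hi
    have := hs l hl
    simp only [Finset.mem_Ioo]
    omega
  calc _ ≤ ∑ i ∈ Finset.Ioo k n, ((i : ℝ) ^ 2)⁻¹ :=
        Finset.sum_le_sum_of_subset_of_nonneg h3 fun _ _ _ => by positivity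
    _ ≤ 2 / (k + 1) := sum_Ioo_inv_sq_le k n
    _ = _ := by push_cast; rfl

/-- For a fixed value of `φ`, in practice an endpoint, an edge is determined by its length. The
lengths in a fiber are thus distinct integers, and `sum_inv_sq_le` applies to each fiber. -/
theorem sum_len_fiber_le {φ : Edge → ℤ} (hφ : ∀ e e', φ e = φ e' → len e = len e' → e = e')
    (T : Finset Edge) (B : Finset ℤ) (q : ℤ → ℤ) (hq : ∀ x ∈ B, 1 ≤ q x)
    (hT : ∀ e ∈ T, φ e ∈ B ∧ q (φ e) ≤ len e) :
    ∑ e ∈ T, 1 / (len e : ℝ) ^ 2 ≤ ∑ x ∈ B, 2 / (q x : ℝ) := by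
  classical
  rw [← Finset.sum_fiberwise_of_maps_to (fun e he => (hT e he).1)]
  refine Finset.sum_le_sum fun x hx => ?_
  have hinj : Set.InjOn len ((T.filter fun e => φ e = x : Finset Edge) : Set Edge) := by
    intro e he e' he' h
    simp only [Finset.coe_filter, Set.mem_ofPred_eq] at he he'
    exact hφ e e' (he.2.trans he'.2.symm) h
  rw [← Finset.sum_image (f := fun l : ℤ => 1 / (l : ℝ) ^ 2) hinj]
  refine sum_inv_sq_le _ _ (hq x hx) fun l hl => ?_
  simp only [Finset.mem_image, Finset.mem_filter] at hl
  obtain ⟨e, ⟨he, rfl⟩, rfl⟩ := hl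
  exact (hT e he).2

theorem sum_len_left_le (T : Finset Edge) (B : Finset ℤ) (q : ℤ → ℤ) (hq : ∀ x ∈ B, 1 ≤ q x)
    (hT : ∀ e ∈ T, e.1.1 ∈ B ∧ q e.1.1 ≤ len e) :
    ∑ e ∈ T, 1 / (len e : ℝ) ^ 2 ≤ ∑ x ∈ B, 2 / (q x : ℝ) := by
  refine sum_len_fiber_le (φ := fun e => e.1.1) ?_ T B q hq hT
  rintro ⟨⟨a, b⟩, h⟩ ⟨⟨a', b'⟩, h'⟩ h1 h2
  simp only [len] at h1 h2
  simp only [Subtype.mk.injEq, Prod.mk.injEq]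
  omega

theorem sum_len_right_le (T : Finset Edge) (B : Finset ℤ) (q : ℤ → ℤ) (hq : ∀ x ∈ B, 1 ≤ q x)
    (hT : ∀ e ∈ T, e.1.2 ∈ B ∧ q e.1.2 ≤ len e) :
    ∑ e ∈ T, 1 / (len e : ℝ) ^ 2 ≤ ∑ x ∈ B, 2 / (q x : ℝ) := by
  refine sum_len_fiber_le (φ := fun e => e.1.2) ?_ T B q hq hT
  rintro ⟨⟨a, b⟩, h⟩ ⟨⟨a', b'⟩, h'⟩ h1 h2
  simp only [len] at h1 h2
  simp only [Subtype.mk.injEq, Prod.mk.injEq]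
  omega

theorem sum_len_touch_le (T : Finset Edge) (B : Finset ℤ) (q : ℤ) (hq : 1 ≤ q)
    (hT : ∀ e ∈ T, (e.1.1 ∈ B ∨ e.1.2 ∈ B) ∧ q ≤ len e) :
    ∑ e ∈ T, 1 / (len e : ℝ) ^ 2 ≤ 4 * B.card / (q : ℝ) := by
  classical
  have h1 := sum_len_left_le (T.filter fun e => e.1.1 ∈ B) B (fun _ => q) (fun _ _ => hq)
    (fun e he => by
      simp only [Finset.mem_filter] at he
      exact ⟨he.2, (hT e he.1).2⟩)
  have h2 := sum_len_right_le (T.filter fun e => ¬ e.1.1 ∈ B) B (fun _ => q) (fun _ _ => hq)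
    (fun e he => by
      simp only [Finset.mem_filter] at he
      exact ⟨(hT e he.1).1.resolve_left he.2, (hT e he.1).2⟩)
  rw [← Finset.sum_filter_add_sum_filter_not T (fun e => e.1.1 ∈ B)]
  simp only [Finset.sum_const, nsmul_eq_mul] at h1 h2
  calc _ ≤ (B.card : ℝ) * (2 / q) + B.card * (2 / q) := add_le_add h1 h2
    _ = _ := by ring

theorem sum_edgeProb_le {β : ℝ} (hβ : 0 ≤ β) (T : Finset Edge) {x : ℝ}
    (h : ∑ e ∈ T, 1 / (len e : ℝ) ^ 2 ≤ x) : ∑ e ∈ T, edgeProb β e ≤ decay β * x := by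
  calc _ ≤ ∑ e ∈ T, decay β * (1 / (len e : ℝ) ^ 2) :=
        Finset.sum_le_sum fun e _ => by
          rw [mul_one_div]
          exact edgeProb_le hβ e
    _ = decay β * ∑ e ∈ T, 1 / (len e : ℝ) ^ 2 := by rw [Finset.mul_sum]
    _ ≤ _ := mul_le_mul_of_nonneg_left h (decay_pos β).le

/-- Edges from `(-∞, 0]` to `(a, b]`. -/
def Landing (a b : ℤ) (e : Edge) : Prop := e.1.1 ≤ 0 ∧ a < e.1.2 ∧ e.1.2 ≤ b

theorem sum_landing_le {β : ℝ} (hβ : 0 ≤ β) {a b : ℤ} (ha : 0 ≤ a) (T : Finset Edge)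
    (hT : ∀ e ∈ T, Landing a b e) :
    ∑ e ∈ T, edgeProb β e ≤ decay β * ∑ x ∈ Finset.Ioc a b, 2 / (x : ℝ) := by
  refine sum_edgeProb_le hβ T (sum_len_right_le T (Finset.Ioc a b) id ?_ ?_)
  · intro x hx
    simp only [Finset.mem_Ioc] at hx
    simp only [id]
    omega
  · intro e he
    obtain ⟨h1, h2, h3⟩ := hT e he
    simp only [Finset.mem_Ioc, id, len]
    omega

theorem sum_Ioc_inv_le {a b : ℤ} (ha : 0 < a) (hab : a ≤ b) :
    ∑ x ∈ Finset.Ioc a b, 2 / (x : ℝ) ≤ 2 * (b - a) / a := by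
  have ha' : (0 : ℝ) < a := by exact_mod_cast ha
  calc _ ≤ ∑ x ∈ Finset.Ioc a b, 2 / (a : ℝ) := by
        refine Finset.sum_le_sum fun x hx => ?_
        simp only [Finset.mem_Ioc] at hx
        have : (a : ℝ) ≤ x := by exact_mod_cast hx.1.le
        gcongr
    _ = _ := by
        have : ((b - a).toNat : ℝ) = b - a := by
          have : (((b - a).toNat : ℤ) : ℝ) = ((b - a : ℤ) : ℝ) := by
            rw [Int.toNat_of_nonneg (by omega)]
          rw [← Int.cast_sub, ← this, Int.cast_natCast]
        rw [Finset.sum_const, Int.card_Ioc, nsmul_eq_mul, this]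
        ring

/-- Each dyadic shell contributes at most `2`. Hence the number of landings above scale `p` is of
order `n - p`, which is where the denominator `d k` comes from. -/
theorem sum_Ioc_two_pow_inv_le {p n : ℕ} (h : p ≤ n) :
    ∑ x ∈ Finset.Ioc ((2 : ℤ) ^ p) (2 ^ n), 2 / (x : ℝ) ≤ 2 * (n - p) := by
  induction n, h using Nat.le_induction with
  | base => simp
  | succ n hpn ih =>
    have h1 : (2 : ℤ) ^ p ≤ 2 ^ n := pow_le_pow_right₀ (by norm_num) hpn
    have h2 : (2 : ℤ) ^ n ≤ 2 ^ (n + 1) := pow_le_pow_right₀ (by norm_num) (by omega)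
    rw [← Finset.Ioc_union_Ioc_eq_Ioc h1 h2,
      Finset.sum_union (Finset.disjoint_left.2 fun x hx hx' => by
        simp only [Finset.mem_Ioc] at hx hx'; omega)]
    have h3 := sum_Ioc_inv_le (a := 2 ^ n) (by positivity) h2
    have h4 : 2 * ((((2 : ℤ) ^ (n + 1) : ℤ) : ℝ) - ((2 ^ n : ℤ) : ℝ)) / ((2 ^ n : ℤ) : ℝ) = 2 := by
      push_cast
      field_simp
      ring
    push_cast at *
    linarith

/-! ### Resistance of a block -/

/-- The edge `e` has an endpoint in `B`. -/
def Touches (e : Edge) (B : Finset ℤ) : Prop := e.1.1 ∈ B ∨ e.1.2 ∈ B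

theorem finite_touches (B : Finset ℤ) (q : ℤ) : {e : Edge | Touches e B ∧ len e ≤ q}.Finite := by
  have h : {e : Edge | Touches e B ∧ len e ≤ q} ⊆ Subtype.val ⁻¹'
      (((B.biUnion fun x => Finset.Icc (x - q) (x + q)) ×ˢ
        (B.biUnion fun x => Finset.Icc (x - q) (x + q)) : Finset (ℤ × ℤ)) : Set (ℤ × ℤ)) := by
    rintro ⟨⟨a, b⟩, hab⟩ ⟨h1, h2⟩
    simp only [len] at h2
    simp only [Set.mem_preimage, Finset.mem_coe, Finset.mem_product, Finset.mem_biUnion,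
      Finset.mem_Icc]
    simp only at hab
    rcases h1 with h1 | h1 <;> simp only at h1 <;>
      exact ⟨⟨_, h1, by omega, by omega⟩, ⟨_, h1, by omega, by omega⟩⟩
  exact ((Finset.finite_toSet _).preimage Subtype.val_injective.injOn).subset h

/-- The edges touching the block `(y, y + 2 ^ j]` whose length is at most `2 ^ j / 4`. -/
noncomputable def blockEdges (y : ℤ) (j : ℕ) : Finset Edge :=
  (finite_touches (Finset.Ioc y (y + 2 ^ j)) (2 ^ j / 4)).toFinset

theorem mem_blockEdges {y : ℤ} {j : ℕ} {e : Edge} :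
    e ∈ blockEdges y j ↔ Touches e (Finset.Ioc y (y + 2 ^ j)) ∧ 4 * len e ≤ 2 ^ j := by
  unfold blockEdges
  rw [Set.Finite.mem_toFinset, Set.mem_ofPred_eq]
  refine and_congr_right fun _ => ?_
  omega

/-- Close all the edges outside `S`. -/
def restrict (S : Finset Edge) (ω : Config) : Config := fun e => decide (e ∈ S) && ω e

/-- The effective resistance through the block `(y, y + 2 ^ j]` in the graph formed by the edges in
`blockEdges y j`. -/
noncomputable def blockRes (y : ℤ) (j : ℕ) (ω : Config) : ℝ≥0∞ :=
  resistance j (restrict (blockEdges 0 j) (shift y ω))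

theorem graph_mono {ω ω' : Config} (h : ∀ e, ω e = true → ω' e = true) {u v : ℤ}
    (huv : (graph ω).Adj u v) : (graph ω').Adj u v := by
  rcases huv with ⟨h1, h2⟩ | ⟨h1, h2⟩
  · exact Or.inl ⟨h1, h _ h2⟩
  · exact Or.inr ⟨h1, h _ h2⟩

theorem IsFlow.neg_swap {G : SimpleGraph ℤ} {f : ℤ → ℤ → ℝ} (hf : IsFlow G f) (u v : ℤ) :
    f u v = -f v u := by
  by_cases h : G.Adj u v
  · exact hf.antisymm u v h
  · rw [hf.off_edges u v h, hf.off_edges v u fun h' => h h'.symm, neg_zero]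

theorem IsFlow.mono {G G' : SimpleGraph ℤ} {f : ℤ → ℤ → ℝ} (hf : IsFlow G f)
    (h : ∀ u v, G.Adj u v → G'.Adj u v) : IsFlow G' f :=
  ⟨fun u v _ => hf.neg_swap u v, fun u v huv => hf.off_edges u v fun h' => huv (h u v h')⟩

/-- A flow on the smaller graph is also a flow on the larger one. -/
theorem resistance_anti {ω ω' : Config} (h : ∀ e, ω e = true → ω' e = true) (n : ℕ) :
    resistance n ω' ≤ resistance n ω := by
  unfold resistance
  refine le_iInf₂ fun f hf => iInf₂_le_of_le f ?_ le_rfl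
  obtain ⟨⟨J₁, J₂, h1, h2, hfl⟩, h3⟩ := hf
  exact ⟨⟨J₁, J₂, h1, h2, { hfl with
    toIsFlow := hfl.toIsFlow.mono fun u v => graph_mono h }⟩, h3⟩

theorem dependsOn_blockRes (y : ℤ) (j : ℕ) : DependsOn (blockRes y j) (blockEdges y j) := by
  intro ω ω' h
  unfold blockRes
  congr 1
  ext e
  unfold restrict shift
  by_cases he : e ∈ blockEdges 0 j
  · rw [h (shiftEdge y e)]
    rw [mem_blockEdges] at he
    simp only [Finset.mem_coe, mem_blockEdges, Touches, shiftEdge, len, Finset.mem_Ioc] at he ⊢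
    omega
  · simp [he]

theorem dependsOn_le_blockRes (y : ℤ) (j : ℕ) (r : ℝ≥0∞) :
    DependsOn (· ∈ {ω | r ≤ blockRes y j ω}) (blockEdges y j : Set Edge) := by
  intro ω ω' h
  simp only [Set.mem_ofPred_eq, dependsOn_blockRes y j h]

theorem quantile_nonneg (β α : ℝ) (n : ℕ) : 0 ≤ quantile β α n :=
  Real.sSup_nonneg fun _ h => h.1

/-- The resistance of a block exceeds the quantile with probability at least `1 - α`. -/
theorem quantile_le_blockRes {β α : ℝ} (hα : 0 < α) (y : ℤ) (j : ℕ) :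
    ENNReal.ofReal (1 - α) ≤
      lrpMeasure β {ω | ENNReal.ofReal (quantile β α j) ≤ blockRes y j ω} := by
  have hy : ∀ r : ℝ≥0∞, lrpMeasure β {ω | r ≤ blockRes y j ω} =
      lrpMeasure β {ω | r ≤ blockRes 0 j ω} := by
    intro r
    have h1 : {ω | r ≤ blockRes y j ω} = shift y ⁻¹' {ω | r ≤ blockRes 0 j ω} := by
      ext ω
      have : shift 0 (shift y ω) = shift y ω := by
        ext e
        simp [shift, shiftEdge]
      simp only [Set.mem_ofPred_eq, Set.mem_preimage, blockRes, this]
    rw [h1, (measurePreserving_shift β y).measure_preimage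
      (measurableSet_of_dependsOn (dependsOn_le_blockRes 0 j r)).nullMeasurableSet]
  rw [hy]
  set S : Set ℝ := {r : ℝ | 0 ≤ r ∧
    1 - α ≤ (lrpMeasure β).real {ω | ENNReal.ofReal r ≤ resistance j ω}} with hS
  have hq : quantile β α j = sSup S := rfl
  have h0 : (0 : ℝ) ∈ S := by
    refine ⟨le_rfl, ?_⟩
    simp
    exact hα.le
  -- `blockRes` deletes edges, which can only raise the resistance.
  have hmem : ∀ r ∈ S, ENNReal.ofReal (1 - α) ≤
      lrpMeasure β {ω | ENNReal.ofReal r ≤ blockRes 0 j ω} := by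
    intro r hr
    refine (ENNReal.ofReal_le_ofReal hr.2).trans ?_
    rw [ofReal_measureReal]
    refine measure_mono fun ω hω => ?_
    simp only [Set.mem_ofPred_eq, blockRes] at hω ⊢
    refine hω.trans (resistance_anti (fun e he => ?_) j)
    simp only [restrict, Bool.and_eq_true] at he
    simpa [shift, shiftEdge] using he.2
  -- In the bounded case the level `quantile β α j` itself is reached by continuity of the measure
  -- from above. Otherwise `sSup` takes its default value `0`, and the level `0` is always attained.
  by_cases hbdd : BddAbove S
  · rcases eq_or_lt_of_le (quantile_nonneg β α j) with hz | hpos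
    · rw [← hz]
      exact hmem 0 h0
    have hlt : ∀ r < quantile β α j, ENNReal.ofReal (1 - α) ≤
        lrpMeasure β {ω | ENNReal.ofReal r ≤ blockRes 0 j ω} := by
      intro r hr
      obtain ⟨s, hs, hrs⟩ := exists_lt_of_lt_csSup ⟨0, h0⟩ (hq ▸ hr)
      refine (hmem s hs).trans (measure_mono fun ω hω => ?_)
      simp only [Set.mem_ofPred_eq] at hω ⊢
      exact (ENNReal.ofReal_le_ofReal hrs.le).trans hω
    have hInter : {ω | ENNReal.ofReal (quantile β α j) ≤ blockRes 0 j ω} =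
        ⋂ m : ℕ, {ω | ENNReal.ofReal (quantile β α j - 1 / (m + 1)) ≤ blockRes 0 j ω} := by
      ext ω
      simp only [Set.mem_ofPred_eq, Set.mem_iInter]
      constructor
      · intro h m
        refine le_trans (ENNReal.ofReal_le_ofReal ?_) h
        have : (0 : ℝ) ≤ 1 / ((m : ℝ) + 1) := by positivity
        linarith
      · intro h
        have ht : Filter.Tendsto (fun m : ℕ => ENNReal.ofReal (quantile β α j - 1 / ((m : ℝ) + 1)))
            Filter.atTop (nhds (ENNReal.ofReal (quantile β α j))) := by
          refine (ENNReal.continuous_ofReal.tendsto _).comp ?_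
          simpa using (tendsto_one_div_add_atTop_nhds_zero_nat (𝕜 := ℝ)).const_sub
            (quantile β α j)
        exact le_of_tendsto' ht h
    have hanti : Antitone fun m : ℕ =>
        {ω | ENNReal.ofReal (quantile β α j - 1 / (m + 1)) ≤ blockRes 0 j ω} := by
      intro m m' hm ω hω
      simp only [Set.mem_ofPred_eq] at hω ⊢
      refine le_trans (ENNReal.ofReal_le_ofReal ?_) hω
      have : 1 / ((m' : ℝ) + 1) ≤ 1 / (m + 1) := by gcongr
      linarith
    rw [hInter, hanti.measure_iInter
      (fun m => (measurableSet_of_dependsOn (dependsOn_le_blockRes 0 j _)).nullMeasurableSet)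
      ⟨0, measure_ne_top _ _⟩]
    refine le_iInf fun m => hlt _ ?_
    have : (0 : ℝ) < 1 / ((m : ℝ) + 1) := by positivity
    linarith
  · rw [hq, Real.sSup_of_not_bddAbove hbdd]
    exact hmem 0 h0

/-! ### Boundedness of the quantiles -/

/-- The unit flow along the path `0, 1, …, N + 1`. -/
noncomputable def pathFlow (N : ℤ) (u v : ℤ) : ℝ :=
  if 0 ≤ u ∧ u ≤ N ∧ v = u + 1 then 1 else if 0 ≤ v ∧ v ≤ N ∧ u = v + 1 then -1 else 0

theorem pathFlow_eq_zero {N u v : ℤ} (h : v ∉ ({u + 1, u - 1} : Finset ℤ)) :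
    pathFlow N u v = 0 := by
  simp only [Finset.mem_insert, Finset.mem_singleton, not_or] at h
  unfold pathFlow
  rw [if_neg (by omega), if_neg (by omega)]

theorem netFlow_pathFlow {N : ℤ} (hN : 0 ≤ N) (u : ℤ) :
    netFlow (pathFlow N) u = if u = 0 then 1 else if u = N + 1 then -1 else 0 := by
  unfold netFlow
  rw [tsum_eq_sum (s := ({u + 1, u - 1} : Finset ℤ)) fun v hv => pathFlow_eq_zero hv,
    Finset.sum_pair (by omega)]
  unfold pathFlow
  split_ifs <;> first | omega | norm_num

theorem energy_pathFlow_ne_top {N : ℤ} : energy (pathFlow N) ≠ ⊤ := by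
  unfold energy
  refine ENNReal.div_ne_top ?_ (by norm_num)
  rw [tsum_eq_sum (s := Finset.Icc 0 (N + 1))]
  · refine ENNReal.sum_ne_top.2 fun u _ => ?_
    rw [tsum_eq_sum (s := ({u + 1, u - 1} : Finset ℤ)) fun v hv => by
      rw [pathFlow_eq_zero hv]; simp]
    exact ENNReal.sum_ne_top.2 fun v _ => ENNReal.ofReal_ne_top
  · intro u hu
    simp only [Finset.mem_Icc] at hu
    refine ENNReal.tsum_eq_zero.2 fun v => ?_
    have : pathFlow N u v = 0 := by
      unfold pathFlow
      rw [if_neg (by omega), if_neg (by omega)]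
    rw [this]
    simp

theorem resistance_le_pathFlow {ω : Config} (hω : ∀ e, len e = 1 → ω e = true) (n : ℕ) :
    resistance n ω ≤ energy (pathFlow (2 ^ n)) := by
  have h2 : (1 : ℤ) ≤ 2 ^ n := one_le_pow₀ (by norm_num)
  have hadj : ∀ u v : ℤ, v = u + 1 → (graph ω).Adj u v := by
    rintro u v rfl
    exact Or.inl ⟨by omega, hω _ (by simp [len])⟩
  refine iInf₂_le_of_le _ ⟨⟨{0}, {2 ^ n + 1}, by simp, by simp, ?_⟩, ?_⟩ le_rfl
  · refine ⟨⟨?_, ?_⟩, ?_, ?_, ?_, ?_⟩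
    · intro u v _
      unfold pathFlow
      split_ifs <;> first | omega | norm_num
    · intro u v huv
      unfold pathFlow
      rw [if_neg fun h => huv (hadj u v h.2.2), if_neg fun h => huv (hadj v u h.2.2).symm]
    · exact fun u => summable_of_ne_finset_zero (s := {u + 1, u - 1}) fun v hv =>
        pathFlow_eq_zero hv
    · simp [netFlow_pathFlow (by omega : (0 : ℤ) ≤ 2 ^ n)]
    · rw [Finset.sum_singleton, netFlow_pathFlow (by omega), if_neg (by omega), if_pos rfl]
    · intro u hu hu'
      simp only [Finset.mem_singleton] at hu hu'
      rw [netFlow_pathFlow (by omega), if_neg hu, if_neg hu']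
  · intro u v hu hv
    unfold pathFlow
    rw [if_neg (by omega), if_neg (by omega)]

theorem ae_nearest_open {β : ℝ} (hβ : 0 ≤ β) :
    ∀ᵐ ω ∂lrpMeasure β, ∀ e : Edge, len e = 1 → ω e = true := by
  rw [ae_all_iff]
  intro e
  by_cases he : len e = 1
  · have h1 : edgeProb β e = 1 := by
      unfold edgeProb
      unfold len at he
      rw [if_pos (by omega)]
    have h2 := lrpMeasure_closed hβ e
    rw [h1, sub_self, ENNReal.ofReal_zero] at h2
    rw [ae_iff]
    simpa [he] using h2
  · exact Filter.Eventually.of_forall fun ω h => absurd h he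

/-- The nearest-neighbour path is almost surely open, so the resistance is bounded by the
deterministic energy of `pathFlow`. Without this bound the supremum defining `quantile` could be the
default `0`, and no element of the set would bound it from below. -/
theorem bddAbove_quantile {β : ℝ} (hβ : 0 ≤ β) {α : ℝ} (hα : α < 1) (n : ℕ) :
    BddAbove {r : ℝ | 0 ≤ r ∧
      1 - α ≤ (lrpMeasure β).real {ω | ENNReal.ofReal r ≤ resistance n ω}} := by
  refine ⟨(energy (pathFlow (2 ^ n))).toReal, fun r hr => ?_⟩
  by_contra! hlt
  have h0 : lrpMeasure β {ω | ENNReal.ofReal r ≤ resistance n ω} = 0 := by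
    have hnull := ae_iff.1 (ae_nearest_open hβ)
    refine measure_mono_null (fun ω hω => ?_) hnull
    rw [Set.mem_ofPred_eq] at hω ⊢
    intro hω'
    have h1 := le_trans hω (resistance_le_pathFlow hω' n)
    exact absurd h1 (not_le.2 ((ENNReal.lt_ofReal_iff_toReal_lt energy_pathFlow_ne_top).2 hlt))
  have h1 := hr.2
  rw [measureReal_def, h0, ENNReal.toReal_zero] at h1
  linarith

/-- Lower bound for the quantile from an almost sure lower bound off a set of measure at most
`α`. -/
theorem le_quantile {β : ℝ} (hβ : 0 ≤ β) {α : ℝ} (hα0 : 0 ≤ α) (hα : α < 1) {n : ℕ} {r : ℝ}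
    (hr : 0 ≤ r) {B : Set Config} (hB : lrpMeasure β B ≤ ENNReal.ofReal α)
    (h : ∀ ω ∉ B, ENNReal.ofReal r ≤ resistance n ω) : r ≤ quantile β α n := by
  refine le_csSup (bddAbove_quantile hβ hα n) ⟨hr, ?_⟩
  have h1 : (1 : ℝ≥0∞) ≤ lrpMeasure β {ω | ENNReal.ofReal r ≤ resistance n ω} +
      ENNReal.ofReal α := by
    -- Only subadditivity of the outer measure is used, so neither `B` nor the resistance event has
    -- to be measurable.
    rw [← measure_univ (μ := lrpMeasure β)]
    refine le_trans (measure_mono fun ω _ => ?_) ((measure_union_le _ B).trans (by gcongr))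
    by_cases hω : ω ∈ B
    · exact Or.inr hω
    · exact Or.inl (h ω hω)
  rw [← ofReal_measureReal, ← ENNReal.ofReal_add measureReal_nonneg hα0,
    ← ENNReal.ofReal_one, ENNReal.ofReal_le_ofReal_iff (by positivity)] at h1
  linarith

/-! ### Good scales -/

/-- The ball of radius `2 ^ (j + 3)` around `v`. -/
noncomputable def ball (v : ℤ) (j : ℕ) : Finset ℤ := Finset.Icc (v - 2 ^ (j + 3)) (v + 2 ^ (j + 3))

/-- The scale `j` is good around `v`: the two blocks at distance `2 ^ j` from `v` have resistance
at least the quantile, and the only long edges touching the ball around `v` belong to `X`. -/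
def Good (β α : ℝ) (v : ℤ) (X : Set Edge) (j : ℕ) (ω : Config) : Prop :=
  ENNReal.ofReal (quantile β α j) ≤ blockRes (v + 2 ^ j) j ω ∧
  ENNReal.ofReal (quantile β α j) ≤ blockRes (v - 2 ^ (j + 1) - 1) j ω ∧
  ∀ e, ω e = true → Touches e (ball v j) → 2 ^ j < 4 * len e → e ∈ X

/-- The moderately long edges touching the ball around `v`. -/
noncomputable def nearLong (v : ℤ) (j t : ℕ) : Finset Edge :=
  (finite_touches (ball v j) (2 ^ (j + t) / 4)).toFinset.filter fun e => 2 ^ j < 4 * len e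

theorem mem_nearLong {v : ℤ} {j t : ℕ} {e : Edge} : e ∈ nearLong v j t ↔
    Touches e (ball v j) ∧ 2 ^ j < 4 * len e ∧ 4 * len e ≤ 2 ^ (j + t) := by
  unfold nearLong
  rw [Finset.mem_filter, Set.Finite.mem_toFinset, Set.mem_ofPred_eq, and_assoc]
  refine and_congr_right fun _ => ?_
  rw [and_comm]
  refine and_congr_right fun _ => ?_
  omega

theorem card_ball_le (v : ℤ) (j : ℕ) : ((ball v j).card : ℝ) ≤ 2 ^ (j + 5) := by
  have h1 : ((ball v j).card : ℤ) = 2 * 2 ^ (j + 3) + 1 := by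
    unfold ball
    rw [Int.card_Icc, Int.toNat_of_nonneg]
    · ring
    · have : (0 : ℤ) < 2 ^ (j + 3) := by positivity
      omega
  have h2 : (1 : ℤ) ≤ 2 ^ (j + 3) := one_le_pow₀ (by norm_num)
  have h3 : ((ball v j).card : ℤ) ≤ 2 ^ (j + 5) := by
    rw [h1, show j + 5 = (j + 3) + 2 by ring, pow_add 2 (j + 3) 2]
    omega
  exact_mod_cast h3

/-- The ball has at most `2 ^ (j + 5)` points, and the inverse squares of the lengths above `2 ^ s /
4` at one point sum to `O(2 ^ (-s))`. For `s = j` the bound does not depend on the scale; for larger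
`s` it decays geometrically. -/
theorem sum_ball_le (v : ℤ) {j s : ℕ} (hs : 2 ≤ s) (T : Finset Edge)
    (hT : ∀ e ∈ T, Touches e (ball v j) ∧ 2 ^ s < 4 * len e) :
    ∑ e ∈ T, 1 / (len e : ℝ) ^ 2 ≤ 512 * (2 ^ j / 2 ^ s) := by
  obtain ⟨s, rfl⟩ := Nat.exists_eq_add_of_le' hs
  have h1 := sum_len_touch_le T (ball v j) (2 ^ s) (one_le_pow₀ (by norm_num)) fun e he => by
    have h2 := (hT e he).2
    rw [pow_add] at h2
    exact ⟨(hT e he).1, by omega⟩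
  refine h1.trans ?_
  have h2 := card_ball_le v j
  push_cast
  rw [div_le_iff₀ (by positivity)]
  calc 4 * ((ball v j).card : ℝ) ≤ 4 * 2 ^ (j + 5) := by gcongr
    _ = _ := by rw [pow_add, pow_add]; field_simp; norm_num

/-- The edges on which the local part of a good scale depends. -/
noncomputable def scaleEdges (v : ℤ) (j t : ℕ) : Finset Edge :=
  blockEdges (v + 2 ^ j) j ∪ blockEdges (v - 2 ^ (j + 1) - 1) j ∪ nearLong v j t

/-- The local part of the event that the scale `j` is good. -/
def nearGood (β α : ℝ) (v : ℤ) (j t : ℕ) : Set Config :=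
  {ω | ENNReal.ofReal (quantile β α j) ≤ blockRes (v + 2 ^ j) j ω} ∩
  {ω | ENNReal.ofReal (quantile β α j) ≤ blockRes (v - 2 ^ (j + 1) - 1) j ω} ∩
  {ω | ∀ e ∈ nearLong v j t, ω e = false}

theorem dependsOn_inter {A B : Set Config} {S T : Finset Edge}
    (hA : DependsOn (· ∈ A) (S : Set Edge)) (hB : DependsOn (· ∈ B) (T : Set Edge)) :
    DependsOn (· ∈ A ∩ B) ((S ∪ T : Finset Edge) : Set Edge) := by
  intro x y h
  have h1 : (x ∈ A) = (y ∈ A) := hA fun e he => h e (by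
    rw [Finset.coe_union]; exact Or.inl he)
  have h2 : (x ∈ B) = (y ∈ B) := hB fun e he => h e (by
    rw [Finset.coe_union]; exact Or.inr he)
  simp only [Set.mem_inter_iff, h1, h2]

theorem dependsOn_closed (T : Finset Edge) :
    DependsOn (· ∈ {ω : Config | ∀ e ∈ T, ω e = false}) (T : Set Edge) := by
  intro x y h
  simp only [Set.mem_ofPred_eq, eq_iff_iff]
  exact forall₂_congr fun e he => by rw [h e he]

theorem dependsOn_nearGood (β α : ℝ) (v : ℤ) (j t : ℕ) :
    DependsOn (· ∈ nearGood β α v j t) (scaleEdges v j t : Set Edge) :=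
  dependsOn_inter (dependsOn_inter (dependsOn_le_blockRes _ _ _) (dependsOn_le_blockRes _ _ _))
    (dependsOn_closed _)

theorem disjoint_blockEdges (v : ℤ) (j : ℕ) :
    Disjoint (blockEdges (v + 2 ^ j) j) (blockEdges (v - 2 ^ (j + 1) - 1) j) := by
  rw [Finset.disjoint_left]
  intro e h1 h2
  rw [mem_blockEdges] at h1 h2
  simp only [Touches, len, Finset.mem_Ioc, pow_succ] at h1 h2
  have he := e.2
  have : (0 : ℤ) < 2 ^ j := by positivity
  omega

theorem disjoint_nearLong (v : ℤ) (j t : ℕ) :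
    Disjoint (blockEdges (v + 2 ^ j) j ∪ blockEdges (v - 2 ^ (j + 1) - 1) j) (nearLong v j t) := by
  rw [Finset.disjoint_left]
  intro e h1 h2
  rw [Finset.mem_union, mem_blockEdges, mem_blockEdges] at h1
  rw [mem_nearLong] at h2
  omega

/-- The edges of scale `j` have length at most `2 ^ j' / 4` and an endpoint within `2 ^ (j + 3) ≤ 2
^ j' / 4` of `v`. The edges of scale `j'` are either longer than `2 ^ j' / 4`, or short and attached
to a block at distance `2 ^ j'` from `v`. -/
theorem disjoint_scaleEdges (v : ℤ) {j j' t : ℕ} (ht : 5 ≤ t) (h : j + t ≤ j') :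
    Disjoint (scaleEdges v j t) (scaleEdges v j' t) := by
  have h0 : (0 : ℤ) < 2 ^ j := by positivity
  have h1 : (2 : ℤ) ^ (j + t) ≤ 2 ^ j' := pow_le_pow_right₀ (by norm_num) h
  have h2 : (32 : ℤ) * 2 ^ j ≤ 2 ^ (j + t) := by
    have : (2 : ℤ) ^ 5 ≤ 2 ^ t := pow_le_pow_right₀ (by norm_num) ht
    rw [pow_add]
    nlinarith
  rw [Finset.disjoint_left]
  intro e he he'
  simp only [scaleEdges, Finset.mem_union, mem_blockEdges, mem_nearLong, Touches, ball, len,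
    Finset.mem_Ioc, Finset.mem_Icc, pow_succ] at he he'
  have hlt := e.2
  generalize (2 : ℤ) ^ j = P at *
  generalize (2 : ℤ) ^ j' = P' at *
  generalize (2 : ℤ) ^ (j + t) = Q at *
  generalize (2 : ℤ) ^ (j' + t) = Q' at *
  rcases he with (⟨he, hl⟩ | ⟨he, hl⟩) | ⟨he, hl⟩ <;>
  rcases he' with (⟨he', hl'⟩ | ⟨he', hl'⟩) | ⟨he', hl'⟩ <;>
  rcases he with he | he <;> rcases he' with he' | he' <;> omega

/-! ### Probability of local goodness and concentration over separated scales. -/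

theorem measure_closed {β : ℝ} (hβ : 0 ≤ β) (T : Finset Edge) {x : ℝ} (hT : ∀ e ∈ T, 2 ≤ len e)
    (hx : ∑ e ∈ T, 1 / (len e : ℝ) ^ 2 ≤ x) :
    ENNReal.ofReal (Real.exp (-(4 * β * x))) ≤ lrpMeasure β {ω | ∀ e ∈ T, ω e = false} := by
  have h1 : {ω : Config | ∀ e ∈ T, ω e = false} =
      Set.pi (T : Set Edge) fun _ => ({false} : Set Bool) := by
    ext ω
    simp
  have h2 : ∀ e, lrpMeasure β {ω | ω e = false} = ProbabilityTheory.bernoulliMeasure true false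
      (Set.projIcc (0 : ℝ) 1 zero_le_one (edgeProb β e)) {false} := by
    intro e
    rw [← lrpMeasure_coord]
    simp
  have h3 : lrpMeasure β {ω | ∀ e ∈ T, ω e = false} =
      ∏ e ∈ T, lrpMeasure β {ω | ω e = false} := by
    simp only [h2]
    rw [h1]
    unfold lrpMeasure
    rw [Measure.infinitePi_pi _ (fun _ _ => MeasurableSet.of_discrete)]
  rw [h3]
  calc _ ≤ ENNReal.ofReal (Real.exp (∑ e ∈ T, -(4 * β / (len e : ℝ) ^ 2))) := by
        apply ENNReal.ofReal_le_ofReal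
        apply Real.exp_le_exp.2
        rw [Finset.sum_neg_distrib]
        apply neg_le_neg
        calc ∑ e ∈ T, 4 * β / (len e : ℝ) ^ 2 = 4 * β * ∑ e ∈ T, 1 / (len e : ℝ) ^ 2 := by
              rw [Finset.mul_sum]
              exact Finset.sum_congr rfl fun _ _ => by ring
          _ ≤ _ := mul_le_mul_of_nonneg_left hx (by positivity)
    _ = ∏ e ∈ T, ENNReal.ofReal (Real.exp (-(4 * β / (len e : ℝ) ^ 2))) := by
        rw [Real.exp_sum, ENNReal.ofReal_prod_of_nonneg fun _ _ => (Real.exp_pos _).le]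
    _ ≤ _ := Finset.prod_le_prod' fun e he => by
        rw [lrpMeasure_closed hβ]
        exact ENNReal.ofReal_le_ofReal (le_one_sub_edgeProb hβ e (hT e he))

/-- Lower bound for the probability of `nearGood`. -/
noncomputable def nearProb (β : ℝ) : ℝ := Real.exp (-(4 * β * 512)) / 4

theorem nearProb_pos (β : ℝ) : 0 < nearProb β := by unfold nearProb; positivity

/-- The three events depend on disjoint sets of edges. Each block event has probability at least `1
- α ≥ 1 / 2`, which makes the bound uniform in `α`; this is why `c` and `L` depend on `β` only. The
condition `3 ≤ j` keeps the nearest-neighbour edges, which are never closed, out of `nearLong`. -/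
theorem nearProb_le {β α : ℝ} (hβ : 0 ≤ β) (hα : 0 < α) (hα' : α ≤ 1 / 2) (v : ℤ) {j : ℕ}
    (hj : 3 ≤ j) (t : ℕ) : ENNReal.ofReal (nearProb β) ≤ lrpMeasure β (nearGood β α v j t) := by
  unfold nearGood
  rw [measure_inter_of_dependsOn β
    (dependsOn_inter (dependsOn_le_blockRes _ _ _) (dependsOn_le_blockRes _ _ _))
    (dependsOn_closed _) (disjoint_nearLong v j t),
    measure_inter_of_dependsOn β (dependsOn_le_blockRes _ _ _) (dependsOn_le_blockRes _ _ _)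
    (disjoint_blockEdges v j)]
  have h1 := sum_ball_le v (j := j) (s := j) (by omega) (nearLong v j t) fun e he => by
    rw [mem_nearLong] at he
    exact ⟨he.1, he.2.1⟩
  rw [div_self (by positivity), mul_one] at h1
  have h2 := measure_closed hβ (nearLong v j t) (fun e he => by
    rw [mem_nearLong] at he
    have : (2 : ℤ) ^ 3 ≤ 2 ^ j := pow_le_pow_right₀ (by norm_num) hj
    omega) h1
  have h3 : ENNReal.ofReal (1 / 2) ≤ ENNReal.ofReal (1 - α) :=
    ENNReal.ofReal_le_ofReal (by linarith)
  calc ENNReal.ofReal (nearProb β) = ENNReal.ofReal (1 / 2) * ENNReal.ofReal (1 / 2) *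
        ENNReal.ofReal (Real.exp (-(4 * β * 512))) := by
        rw [← ENNReal.ofReal_mul (by norm_num), ← ENNReal.ofReal_mul (by norm_num)]
        unfold nearProb
        congr 1
        ring
    _ ≤ _ := by
        gcongr
        · exact h3.trans (quantile_le_blockRes hα _ _)
        · exact h3.trans (quantile_le_blockRes hα _ _)

open Classical in
/-- Number of locally good scales among `j + t * i`, `i < m`. -/
noncomputable def goodCount (β α : ℝ) (v : ℤ) (j t m : ℕ) (ω : Config) : ℕ :=
  ((Finset.range m).filter fun i => ω ∈ nearGood β α v (j + t * i) t).card

theorem dependsOn_goodCount (β α : ℝ) (v : ℤ) (j t m : ℕ) :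
    DependsOn (goodCount β α v j t m)
      ((Finset.range m).biUnion fun i => scaleEdges v (j + t * i) t : Finset Edge) := by
  intro x y h
  unfold goodCount
  congr 1
  ext i
  simp only [Finset.mem_filter]
  refine and_congr_right fun hi => ?_
  refine iff_of_eq (dependsOn_nearGood β α v (j + t * i) t fun e he => h e ?_)
  simp only [Finset.coe_biUnion, Set.mem_iUnion]
  exact ⟨i, hi, he⟩

/-- Exponential Markov inequality for minus the count. The factors are independent with mean at most
`1 - q / 2 ≤ exp (-q / 2)`, where `q = nearProb β`, and the threshold `q / 4 * m` leaves half of the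
exponent. -/
theorem measure_goodCount_le {β α : ℝ} (hβ : 0 ≤ β) (hα : 0 < α) (hα' : α ≤ 1 / 2) (v : ℤ)
    {j t : ℕ} (hj : 3 ≤ j) (ht : 5 ≤ t) (m : ℕ) :
    lrpMeasure β {ω | (goodCount β α v j t m ω : ℝ) ≤ nearProb β / 4 * m} ≤
      ENNReal.ofReal (Real.exp (-(nearProb β / 4 * m))) := by
  classical
  set q := nearProb β
  set G : ℕ → Set Config := fun i => nearGood β α v (j + t * i) t
  set f : ℕ → Config → ℝ≥0∞ := fun i ω =>
    (G i).indicator (fun _ => ENNReal.ofReal (Real.exp (-1))) ω + (G i)ᶜ.indicator (fun _ => 1) ω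
    with hf
  have hdepG : ∀ i, DependsOn (· ∈ G i) (scaleEdges v (j + t * i) t : Set Edge) := fun i =>
    dependsOn_nearGood β α v (j + t * i) t
  have hmeas : ∀ i, MeasurableSet (G i) := fun i => measurableSet_of_dependsOn (hdepG i)
  have hfval : ∀ i ω, f i ω = ENNReal.ofReal (Real.exp (if ω ∈ G i then -1 else 0)) := by
    intro i ω
    by_cases h : ω ∈ G i <;> simp [hf, h]
  have hdep : ∀ i ∈ Finset.range m, DependsOn (f i) (scaleEdges v (j + t * i) t : Set Edge) := by
    intro i _ x y h
    have h' : (x ∈ G i) = (y ∈ G i) := hdepG i h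
    simp only [hfval, h']
  have hint : ∀ i, ∫⁻ ω, f i ω ∂lrpMeasure β ≤ ENNReal.ofReal (Real.exp (-(q / 2))) := by
    intro i
    have h1 : ENNReal.ofReal q ≤ lrpMeasure β (G i) := nearProb_le hβ hα hα' v (by omega) t
    rw [← ofReal_measureReal, ENNReal.ofReal_le_ofReal_iff measureReal_nonneg] at h1
    have hle : (lrpMeasure β).real (G i) ≤ 1 := measureReal_le_one
    simp only [hf]
    rw [lintegral_add_left (measurable_const.indicator (hmeas i)),
      lintegral_indicator_const (hmeas i), lintegral_indicator_const (hmeas i).compl,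
      ← ofReal_measureReal, ← ofReal_measureReal, probReal_compl_eq_one_sub (hmeas i), one_mul,
      ← ENNReal.ofReal_mul (Real.exp_pos _).le,
      ← ENNReal.ofReal_add (by positivity) (by linarith)]
    apply ENNReal.ofReal_le_ofReal
    have h2 : Real.exp (-1) ≤ 1 / 2 := by
      rw [Real.exp_neg, one_div]
      apply inv_anti₀ (by norm_num)
      have := Real.add_one_le_exp (1 : ℝ)
      linarith
    have h3 := Real.add_one_le_exp (-(q / 2))
    have h4 := mul_le_mul_of_nonneg_right h2
      (measureReal_nonneg : 0 ≤ (lrpMeasure β).real (G i))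
    linarith
  have h1 := lintegral_prod_of_dependsOn β (s := Finset.range m) hdep (by
    intro i _ k _ hik
    rcases Nat.lt_or_gt_of_ne hik with h | h
    · exact disjoint_scaleEdges v ht (by nlinarith)
    · exact (disjoint_scaleEdges v ht (by nlinarith)).symm)
  have h2 : ∫⁻ ω, ∏ i ∈ Finset.range m, f i ω ∂lrpMeasure β ≤
      ENNReal.ofReal (Real.exp (-(q / 2) * m)) := by
    rw [h1]
    calc _ ≤ ∏ i ∈ Finset.range m, ENNReal.ofReal (Real.exp (-(q / 2))) :=
          Finset.prod_le_prod' fun i _ => hint i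
      _ = _ := by
          rw [Finset.prod_const, Finset.card_range, ← ENNReal.ofReal_pow (Real.exp_pos _).le,
            ← Real.exp_nat_mul, mul_comm]
  have h3 : {ω | (goodCount β α v j t m ω : ℝ) ≤ q / 4 * m} ⊆
      {ω | ENNReal.ofReal (Real.exp (-(q / 4 * m))) ≤ ∏ i ∈ Finset.range m, f i ω} := by
    intro ω h
    rw [Set.mem_ofPred_eq] at h ⊢
    simp only [hfval]
    rw [← ENNReal.ofReal_prod_of_nonneg (fun _ _ => (Real.exp_pos _).le), ← Real.exp_sum]
    refine ENNReal.ofReal_le_ofReal (Real.exp_le_exp.2 ?_)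
    have h4 : (goodCount β α v j t m ω : ℝ) =
        ∑ i ∈ Finset.range m, if ω ∈ G i then (1 : ℝ) else 0 := by
      unfold goodCount
      rw [Finset.sum_boole]
    have h5 : ∑ i ∈ Finset.range m, (if ω ∈ G i then (-1 : ℝ) else 0) =
        -(goodCount β α v j t m ω : ℝ) := by
      rw [h4, ← Finset.sum_neg_distrib]
      exact Finset.sum_congr rfl fun i _ => by split_ifs <;> simp
    rw [h5]
    linarith
  refine (measure_mono h3).trans ?_
  refine (meas_ge_le_lintegral_div (measurable_of_dependsOn (dependsOn_prod hdep)).aemeasurable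
    (by simpa using Real.exp_pos _) ENNReal.ofReal_ne_top).trans ?_
  refine (ENNReal.div_le_div_right h2 _).trans ?_
  rw [← ENNReal.ofReal_div_of_pos (Real.exp_pos _), ← Real.exp_sub]
  apply ENNReal.ofReal_le_ofReal
  apply Real.exp_le_exp.2
  linarith

/-! ### Far reaching edges -/

open Classical in
/-- The scales among `j + t * i`, `i < m`, that are spoiled by the edge `e`. -/
noncomputable def farScales (v : ℤ) (j t m : ℕ) (X : Set Edge) (e : Edge) : Finset ℕ :=
  (Finset.range m).filter fun i =>
    e ∉ X ∧ Touches e (ball v (j + t * i)) ∧ 2 ^ (j + t * (i + 1)) < 4 * len e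

theorem mem_farScales {v : ℤ} {j t m : ℕ} {X : Set Edge} {e : Edge} {i : ℕ} :
    i ∈ farScales v j t m X e ↔ i < m ∧
      e ∉ X ∧ Touches e (ball v (j + t * i)) ∧ 2 ^ (j + t * (i + 1)) < 4 * len e := by
  simp [farScales]

-- If the spoiled scales lie between `i0` and `i1 = i0 + r`, there are at most `r + 1` of them, the
-- edge touches the ball of scale `i0`, and its length is tied to scale `i1`. The single term `(i0,
-- r)` of the double sum already suffices.
open Classical in
theorem exp_farScales_le (v : ℤ) (j t m : ℕ) (X : Set Edge) (e : Edge) :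
    Real.exp ((farScales v j t m X e).card : ℝ) - 1 ≤
      ∑ i ∈ Finset.range m, ∑ r ∈ Finset.range m,
        if Touches e (ball v (j + t * i)) ∧ 2 ^ (j + t * (i + r + 1)) < 4 * len e then
          Real.exp ((r : ℝ) + 1) else 0 := by
  have hnn : ∀ i r : ℕ, (0 : ℝ) ≤ if Touches e (ball v (j + t * i)) ∧
      2 ^ (j + t * (i + r + 1)) < 4 * len e then Real.exp ((r : ℝ) + 1) else 0 := by
    intro i r
    split_ifs
    · exact (Real.exp_pos _).le
    · exact le_rfl
  rcases (farScales v j t m X e).eq_empty_or_nonempty with h | h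
  · rw [h]
    simp only [Finset.card_empty, Nat.cast_zero, Real.exp_zero, sub_self]
    exact Finset.sum_nonneg fun i _ => Finset.sum_nonneg fun r _ => hnn i r
  · set i0 := (farScales v j t m X e).min' h with hi0
    set i1 := (farScales v j t m X e).max' h with hi1
    have h0 := mem_farScales.1 ((farScales v j t m X e).min'_mem h)
    have h1 := mem_farScales.1 ((farScales v j t m X e).max'_mem h)
    rw [← hi0] at h0
    rw [← hi1] at h1
    have hle : i0 ≤ i1 := Finset.min'_le_max' _ h
    have hcard : (farScales v j t m X e).card ≤ (i1 - i0) + 1 := by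
      have hsub : farScales v j t m X e ⊆ Finset.Icc i0 i1 := fun i hi =>
        Finset.mem_Icc.2 ⟨Finset.min'_le _ _ hi, Finset.le_max' _ _ hi⟩
      have := Finset.card_le_card hsub
      rw [Nat.card_Icc] at this
      omega
    have hterm : Real.exp ((farScales v j t m X e).card : ℝ) ≤
        if Touches e (ball v (j + t * i0)) ∧ 2 ^ (j + t * (i0 + (i1 - i0) + 1)) < 4 * len e then
          Real.exp (((i1 - i0 : ℕ) : ℝ) + 1) else 0 := by
      rw [if_pos ⟨h0.2.2.1, by rw [Nat.add_sub_cancel' hle]; exact h1.2.2.2⟩]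
      apply Real.exp_le_exp.2
      exact_mod_cast hcard
    have hsum := Finset.single_le_sum (f := fun i => ∑ r ∈ Finset.range m,
        if Touches e (ball v (j + t * i)) ∧ 2 ^ (j + t * (i + r + 1)) < 4 * len e then
          Real.exp ((r : ℝ) + 1) else 0) (s := Finset.range m)
      (fun i _ => Finset.sum_nonneg fun r _ => hnn i r) (Finset.mem_range.2 h0.1)
    have hsum' := Finset.single_le_sum (f := fun r : ℕ =>
        if Touches e (ball v (j + t * i0)) ∧ 2 ^ (j + t * (i0 + r + 1)) < 4 * len e then
          Real.exp ((r : ℝ) + 1) else 0) (s := Finset.range m)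
      (fun r _ => hnn i0 r) (Finset.mem_range.2 (by omega : i1 - i0 < m))
    linarith

theorem geom_tail_le {x : ℝ} (hx : 0 ≤ x) (hx' : x ≤ 1 / 2) (m : ℕ) :
    ∑ r ∈ Finset.range m, x ^ (r + 1) ≤ 2 * x := by
  have h : ∑ r ∈ Finset.range m, x ^ (r + 1) ≤ 2 * x * (1 - x ^ m) := by
    induction m with
    | zero => simp
    | succ m ih =>
      rw [Finset.sum_range_succ]
      have : 0 ≤ x ^ m * x * (1 - 2 * x) := by
        have : 0 ≤ 1 - 2 * x := by linarith
        positivity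
      rw [pow_succ x m]
      nlinarith
  refine h.trans ?_
  have : 0 ≤ x ^ m := by positivity
  nlinarith

/-- By `sum_ball_le` the term `(i, r)` is at most `512 * decay β * (e / 2 ^ t) ^ (r + 1)`. The
series over `r` is geometric with ratio at most `1 / 2`, so the total is linear in `m`, with a
coefficient that is small for large `t`. -/
theorem sum_farScales_le {β : ℝ} (hβ : 0 ≤ β) (v : ℤ) {j t : ℕ} (hj : 2 ≤ j) (ht : 5 ≤ t) (m : ℕ)
    (X : Set Edge) (T : Finset Edge) :
    ∑ e ∈ T, edgeProb β e * (Real.exp ((farScales v j t m X e).card : ℝ) - 1) ≤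
      decay β * 3072 / 2 ^ t * m := by
  classical
  have h1 : ∀ i r : ℕ, ∑ e ∈ T, edgeProb β e *
      (if Touches e (ball v (j + t * i)) ∧ 2 ^ (j + t * (i + r + 1)) < 4 * len e then
          Real.exp ((r : ℝ) + 1) else 0) ≤
      decay β * 512 * (Real.exp 1 / 2 ^ t) ^ (r + 1) := by
    intro i r
    have h2 := sum_edgeProb_le hβ _ (sum_ball_le v (j := j + t * i) (s := j + t * (i + r + 1))
      (by omega) (T.filter fun e => Touches e (ball v (j + t * i)) ∧
        2 ^ (j + t * (i + r + 1)) < 4 * len e) fun e he => (Finset.mem_filter.1 he).2)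
    rw [Finset.sum_filter] at h2
    calc _ = (∑ e ∈ T, if Touches e (ball v (j + t * i)) ∧
          2 ^ (j + t * (i + r + 1)) < 4 * len e then edgeProb β e else 0) *
            Real.exp ((r : ℝ) + 1) := by
          rw [Finset.sum_mul]
          exact Finset.sum_congr rfl fun e _ => by split_ifs <;> simp
      _ ≤ (decay β * (512 * (2 ^ (j + t * i) / 2 ^ (j + t * (i + r + 1))))) *
            Real.exp ((r : ℝ) + 1) := mul_le_mul_of_nonneg_right h2 (Real.exp_pos _).le
      _ = _ := by
          have h3 : Real.exp ((r : ℝ) + 1) = Real.exp 1 ^ (r + 1) := by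
            rw [← Real.exp_nat_mul]
            push_cast
            ring_nf
          have h4 : (2 : ℝ) ^ (j + t * (i + r + 1)) = 2 ^ (j + t * i) * (2 ^ t) ^ (r + 1) := by
            rw [← pow_mul, ← pow_add]
            ring_nf
          rw [h3, h4, div_pow]
          field_simp
  have he3 : Real.exp 1 ≤ 3 := by
    have := Real.exp_one_lt_d9
    linarith
  have h32 : (32 : ℝ) ≤ 2 ^ t := by
    calc (32 : ℝ) = 2 ^ 5 := by norm_num
      _ ≤ 2 ^ t := pow_le_pow_right₀ (by norm_num) ht
  have hx : Real.exp 1 / 2 ^ t ≤ 1 / 2 := by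
    rw [div_le_div_iff₀ (by positivity) (by norm_num)]
    linarith
  calc _ ≤ ∑ e ∈ T, edgeProb β e * ∑ i ∈ Finset.range m, ∑ r ∈ Finset.range m,
        (if Touches e (ball v (j + t * i)) ∧ 2 ^ (j + t * (i + r + 1)) < 4 * len e then
          Real.exp ((r : ℝ) + 1) else 0) :=
        Finset.sum_le_sum fun e _ => mul_le_mul_of_nonneg_left (exp_farScales_le v j t m X e)
          (edgeProb_mem hβ e).1
    _ = ∑ i ∈ Finset.range m, ∑ r ∈ Finset.range m, ∑ e ∈ T, edgeProb β e *
        (if Touches e (ball v (j + t * i)) ∧ 2 ^ (j + t * (i + r + 1)) < 4 * len e then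
          Real.exp ((r : ℝ) + 1) else 0) := by
        simp only [Finset.mul_sum]
        rw [Finset.sum_comm]
        exact Finset.sum_congr rfl fun i _ => Finset.sum_comm
    _ ≤ ∑ i ∈ Finset.range m, ∑ r ∈ Finset.range m,
          decay β * 512 * (Real.exp 1 / 2 ^ t) ^ (r + 1) :=
        Finset.sum_le_sum fun i _ => Finset.sum_le_sum fun r _ => h1 i r
    _ = m * (decay β * 512 * ∑ r ∈ Finset.range m, (Real.exp 1 / 2 ^ t) ^ (r + 1)) := by
        rw [Finset.sum_const, Finset.card_range, nsmul_eq_mul, ← Finset.mul_sum]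
    _ ≤ m * (decay β * 512 * (2 * (3 / 2 ^ t))) := by
        have := decay_pos β
        have h5 := geom_tail_le (by positivity) hx m
        have h6 : Real.exp 1 / 2 ^ t ≤ 3 / 2 ^ t := by gcongr
        gcongr
        linarith
    _ = _ := by ring

/-- If no scale is good, then the locally good scales are all spoiled by far reaching edges. -/
theorem goodCount_le_far {β α : ℝ} {v : ℤ} {j t m : ℕ} {X : Set Edge} {ω : Config}
    (h : ∀ i < m, ¬ Good β α v X (j + t * i) ω) :
    ∃ T : Finset Edge, (goodCount β α v j t m ω : ℝ) ≤
      ∑ e ∈ T, if ω e = true then ((farScales v j t m X e).card : ℝ) else 0 := by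
  classical
  have h1 : ∀ i, i < m → ω ∈ nearGood β α v (j + t * i) t →
      ∃ e, ω e = true ∧ i ∈ farScales v j t m X e := by
    rintro i hi ⟨⟨hr, hl⟩, hn⟩
    rw [Set.mem_ofPred_eq] at hr hl hn
    have h2 := h i hi
    unfold Good at h2
    push Not at h2
    obtain ⟨e, he, htouch, hlong, hX⟩ := h2 hr hl
    refine ⟨e, he, mem_farScales.2 ⟨hi, hX, htouch, ?_⟩⟩
    by_contra! hlen
    have h3 : e ∈ nearLong v (j + t * i) t := by
      rw [mem_nearLong]
      refine ⟨htouch, hlong, ?_⟩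
      rwa [show j + t * i + t = j + t * (i + 1) by ring]
    rw [hn e h3] at he
    exact absurd he (by simp)
  have : Nonempty Edge := ⟨⟨(0, 1), by norm_num⟩⟩
  -- Charge every locally good scale to one open edge spoiling it; an edge is charged at most as
  -- many times as it spoils scales.
  choose! φ hφ hφ' using h1
  set I := (Finset.range m).filter fun i => ω ∈ nearGood β α v (j + t * i) t with hI
  have hmem : ∀ i ∈ I, i < m ∧ ω ∈ nearGood β α v (j + t * i) t := fun i hi => by
    simpa [hI] using hi
  refine ⟨I.image φ, ?_⟩
  have h2 : goodCount β α v j t m ω = I.card := by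
    unfold goodCount
    rw [hI]
  have h3 : I.card ≤ ∑ e ∈ I.image φ, (farScales v j t m X e).card := by
    rw [Finset.card_eq_sum_card_image φ I]
    refine Finset.sum_le_sum fun e _ => Finset.card_le_card fun i hi => ?_
    obtain ⟨hiI, rfl⟩ := Finset.mem_filter.1 hi
    exact hφ' i (hmem i hiI).1 (hmem i hiI).2
  rw [h2]
  calc (I.card : ℝ) ≤ ∑ e ∈ I.image φ, ((farScales v j t m X e).card : ℝ) := by exact_mod_cast h3
    _ = _ := Finset.sum_congr rfl fun e he => by
        obtain ⟨i, hi, rfl⟩ := Finset.mem_image.1 he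
        rw [if_pos (hφ i (hmem i hi).1 (hmem i hi).2)]

/-- The probability that no scale is good decays exponentially in the number of scales. -/
theorem exists_no_good_scale_le {β : ℝ} (hβ : 0 ≤ β) : ∃ κ : ℝ, 0 < κ ∧ ∃ t : ℕ, 5 ≤ t ∧
    ∀ α : ℝ, 0 < α → α ≤ 1 / 2 → ∀ (v : ℤ) (X : Set Edge) (j m : ℕ), 3 ≤ j →
      ∀ (B : Set Config) (S : Finset Edge), DependsOn (· ∈ B) (S : Set Edge) →
        (∀ e ∈ S, e ∈ X ∧ 2 ^ (j + t * m) < 4 * len e) →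
        lrpMeasure β (B ∩ {ω | ∀ i < m, ¬ Good β α v X (j + t * i) ω}) ≤
          lrpMeasure β B * ENNReal.ofReal (2 * Real.exp (-(κ * m))) := by
  have hq := nearProb_pos β
  have hd := decay_pos β
  -- This choice makes the exponential moment of the spoiled scales at most `exp (q / 8 * m)`, with
  -- `q = nearProb β`. Against the threshold `q / 4 * m` there remains `exp (-(q / 8) * m)`, hence
  -- `κ = q / 8`.
  obtain ⟨t0, ht0⟩ := pow_unbounded_of_one_lt (decay β * 3072 * (8 / nearProb β)) (one_lt_two)
  refine ⟨nearProb β / 8, by positivity, t0 + 5, by omega, ?_⟩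
  set t := t0 + 5 with ht
  have ht5 : 5 ≤ t := by omega
  have h2t : decay β * 3072 / 2 ^ t ≤ nearProb β / 8 := by
    have : decay β * 3072 * (8 / nearProb β) ≤ 2 ^ t :=
      ht0.le.trans (pow_le_pow_right₀ (by norm_num) (by omega))
    rw [div_le_iff₀ (by positivity)]
    calc decay β * 3072 = nearProb β / 8 * (decay β * 3072 * (8 / nearProb β)) := by field_simp
      _ ≤ _ := by gcongr
  intro α hα hα' v X j m hj B S hB hS
  -- The edges of `S` are tolerated by `X` and spoil nothing; being too long, they also do not enter
  -- any local event (`hdisj`). Hence `B` is independent of both sources of failure.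
  have hwS : ∀ e ∈ S, ((farScales v j t m X e).card : ℝ) = 0 := by
    intro e he
    rw [Nat.cast_eq_zero, Finset.card_eq_zero, Finset.eq_empty_iff_forall_notMem]
    intro i hi
    exact (mem_farScales.1 hi).2.1 (hS e he).1
  have h1 := chernoff_of_open hβ (w := fun e => ((farScales v j t m X e).card : ℝ))
    (fun e => by positivity) (A := nearProb β / 8 * m)
    (fun T => (sum_farScales_le hβ v (by omega) ht5 m X T).trans (by gcongr))
    (nearProb β / 4 * m) hB hwS
  have hdisj : Disjoint S ((Finset.range m).biUnion fun i => scaleEdges v (j + t * i) t) := by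
    rw [Finset.disjoint_left]
    intro e he he'
    obtain ⟨i, hi, he'⟩ := Finset.mem_biUnion.1 he'
    have hlong := (hS e he).2
    have hi := Finset.mem_range.1 hi
    have h2 : (2 : ℤ) ^ (j + t * i + t) ≤ 2 ^ (j + t * m) := by
      apply pow_le_pow_right₀ (by norm_num)
      calc j + t * i + t = j + t * (i + 1) := by ring
        _ ≤ _ := by gcongr; omega
    have h3 : (2 : ℤ) ^ (j + t * i) ≤ 2 ^ (j + t * i + t) :=
      pow_le_pow_right₀ (by norm_num) (by omega)
    simp only [scaleEdges, Finset.mem_union, mem_blockEdges, mem_nearLong] at he'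
    omega
  have h2 : lrpMeasure β (B ∩ {ω | (goodCount β α v j t m ω : ℝ) ≤ nearProb β / 4 * m}) ≤
      lrpMeasure β B * ENNReal.ofReal (Real.exp (-(nearProb β / 4 * m))) := by
    rw [measure_inter_of_dependsOn β hB (fun x y h => by
      simp only [Set.mem_ofPred_eq, dependsOn_goodCount β α v j t m h]) hdisj]
    gcongr
    exact measure_goodCount_le hβ hα hα' v hj ht5 m
  have hsub : B ∩ {ω | ∀ i < m, ¬ Good β α v X (j + t * i) ω} ⊆
      (B ∩ {ω | (goodCount β α v j t m ω : ℝ) ≤ nearProb β / 4 * m}) ∪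
      (B ∩ {ω | ∃ T : Finset Edge, nearProb β / 4 * m ≤
        ∑ e ∈ T, if ω e = true then ((farScales v j t m X e).card : ℝ) else 0}) := by
    rintro ω ⟨hωB, hω⟩
    rw [Set.mem_ofPred_eq] at hω
    obtain ⟨T, hT⟩ := goodCount_le_far hω
    by_cases hc : (goodCount β α v j t m ω : ℝ) ≤ nearProb β / 4 * m
    · exact Or.inl ⟨hωB, hc⟩
    · exact Or.inr ⟨hωB, T, by linarith⟩
  refine (measure_mono hsub).trans ((measure_union_le _ _).trans ((add_le_add h2 h1).trans ?_))
  rw [← mul_add, ← ENNReal.ofReal_add (Real.exp_pos _).le (Real.exp_pos _).le]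
  gcongr
  rw [two_mul]
  have hm : (0 : ℝ) ≤ m := by positivity
  gcongr <;> nlinarith

/-! ### Finitely supported flows -/

theorem sum_sum_antisymm {f : ℤ → ℤ → ℝ} (hf : ∀ u v, f u v = -f v u) (C : Finset ℤ) :
    ∑ u ∈ C, ∑ v ∈ C, f u v = 0 := by
  have h : ∑ u ∈ C, ∑ v ∈ C, f u v = -∑ u ∈ C, ∑ v ∈ C, f u v := by
    conv_lhs => rw [Finset.sum_comm]
    rw [← Finset.sum_neg_distrib]
    refine Finset.sum_congr rfl fun u _ => ?_
    rw [← Finset.sum_neg_distrib]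
    exact Finset.sum_congr rfl fun v _ => hf v u
  linarith

/-- A flow on `graph ω` supported on pairs of elements of the finite set `U`. -/
structure IsFinFlow (ω : Config) (U : Finset ℤ) (f : ℤ → ℤ → ℝ) : Prop where
  antisymm : ∀ u v, f u v = -f v u
  adj : ∀ u v, f u v ≠ 0 → (graph ω).Adj u v
  supp : ∀ u v, f u v ≠ 0 → u ∈ U

namespace IsFinFlow

variable {ω : Config} {U : Finset ℤ} {f : ℤ → ℤ → ℝ}

theorem eq_zero_left (hf : IsFinFlow ω U f) {u : ℤ} (hu : u ∉ U) (v : ℤ) : f u v = 0 := by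
  by_contra h
  exact hu (hf.supp u v h)

theorem eq_zero_right (hf : IsFinFlow ω U f) (u : ℤ) {v : ℤ} (hv : v ∉ U) : f u v = 0 := by
  rw [hf.antisymm, hf.eq_zero_left hv, neg_zero]

theorem sum_eq_sum_sdiff (hf : IsFinFlow ω U f) (C : Finset ℤ) :
    ∑ u ∈ C, ∑ v ∈ U, f u v = ∑ u ∈ C, ∑ v ∈ U \ C, f u v := by
  have h1 : ∀ u, ∑ v ∈ U, f u v = ∑ v ∈ U \ C, f u v + ∑ v ∈ C, f u v := by
    intro u
    rw [← Finset.sum_inter_add_sum_sdiff U C, add_comm]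
    congr 1
    refine Finset.sum_subset Finset.inter_subset_right fun v hv hv' => hf.eq_zero_right u ?_
    intro hvU
    exact hv' (Finset.mem_inter.2 ⟨hvU, hv⟩)
  simp only [h1, Finset.sum_add_distrib]
  rw [sum_sum_antisymm hf.antisymm, add_zero]

theorem exists_edge (hf : IsFinFlow ω U f) {u v : ℤ} (h : f u v ≠ 0) :
    ∃ e : Edge, ω e = true ∧ (e.1 = (u, v) ∨ e.1 = (v, u)) := by
  rcases hf.adj u v h with ⟨h1, h2⟩ | ⟨h1, h2⟩
  · exact ⟨_, h2, Or.inl rfl⟩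
  · exact ⟨_, h2, Or.inr rfl⟩

end IsFinFlow

/-- The energy of the edges at the vertex `u`. -/
def rowEnergy (U : Finset ℤ) (f : ℤ → ℤ → ℝ) (u : ℤ) : ℝ := ∑ v ∈ U, f u v ^ 2

theorem rowEnergy_nonneg (U : Finset ℤ) (f : ℤ → ℤ → ℝ) (u : ℤ) : 0 ≤ rowEnergy U f u :=
  Finset.sum_nonneg fun _ _ => sq_nonneg _

theorem energy_eq_of_supp {U : Finset ℤ} {g : ℤ → ℤ → ℝ} (h1 : ∀ u v, g u v ≠ 0 → u ∈ U)
    (h2 : ∀ u v, g u v ≠ 0 → v ∈ U) :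
    energy g = ENNReal.ofReal ((∑ u ∈ U, ∑ v ∈ U, g u v ^ 2) / 2) := by
  unfold energy
  rw [tsum_eq_sum (s := U), ENNReal.ofReal_div_of_pos (by norm_num),
    ENNReal.ofReal_sum_of_nonneg fun u _ => Finset.sum_nonneg fun v _ => sq_nonneg _,
    ENNReal.ofReal_ofNat]
  · congr 1
    refine Finset.sum_congr rfl fun u _ => ?_
    rw [ENNReal.ofReal_sum_of_nonneg fun v _ => sq_nonneg _]
    refine tsum_eq_sum fun v hv => ?_
    have : g u v = 0 := by
      by_contra h
      exact hv (h2 u v h)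
    simp [this]
  · intro u hu
    refine ENNReal.tsum_eq_zero.2 fun v => ?_
    have : g u v = 0 := by
      by_contra h
      exact hu (h1 u v h)
    simp [this]

/-- A flow through a block dissipates at least the resistance of the block. -/
theorem block_energy {ω : Config} {U : Finset ℤ} {f : ℤ → ℤ → ℝ} (hf : IsFinFlow ω U f) {y : ℤ}
    {j : ℕ} (hcons : ∀ u ∈ Finset.Ioc y (y + 2 ^ j), ∑ v ∈ U, f u v = 0)
    (hshort : ∀ u ∈ Finset.Ioc y (y + 2 ^ j), ∀ v, f u v ≠ 0 → 4 * |u - v| ≤ 2 ^ j)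
    {a : ℝ} (hres : ENNReal.ofReal a ≤ blockRes y j ω) :
    a * (∑ w ∈ Finset.Ioc y (y + 2 ^ j), ∑ u ∈ U.filter (· ≤ y), f u w) ^ 2 ≤
      ∑ u ∈ Finset.Ioc y (y + 2 ^ j), rowEnergy U f u := by
  classical
  set A := Finset.Ioc y (y + 2 ^ j) with hA
  set φ := ∑ w ∈ A, ∑ u ∈ U.filter (· ≤ y), f u w with hφ
  by_cases hφ0 : φ = 0
  · rw [hφ0]
    simpa using Finset.sum_nonneg fun u _ => rowEnergy_nonneg U f u
  have h2j : (0 : ℤ) < 2 ^ j := by positivity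
  -- The competitor: keep the edges touching the block, translate the block to `(0, 2 ^ j]` and
  -- normalise the flux to one. All these edges are short, so `g` lives on the restricted graph of
  -- `blockRes`.
  set g : ℤ → ℤ → ℝ := fun u v =>
    if u + y ∈ A ∨ v + y ∈ A then f (u + y) (v + y) / φ else 0 with hg
  have hgne : ∀ u v, g u v ≠ 0 → (u + y ∈ A ∨ v + y ∈ A) ∧ f (u + y) (v + y) ≠ 0 := by
    intro u v h
    simp only [hg] at h
    split_ifs at h with h1
    · exact ⟨h1, fun h2 => h (by rw [h2, zero_div])⟩
    · exact absurd rfl h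
  set U' := U.image (· - y) with hU'
  have hmemU' : ∀ u, u ∈ U' ↔ u + y ∈ U := by
    intro u
    simp only [hU', Finset.mem_image]
    constructor
    · rintro ⟨x, hx, rfl⟩
      simpa using hx
    · exact fun h => ⟨_, h, by ring⟩
  have hsum : ∀ h : ℤ → ℝ, ∑ u ∈ U', h (u + y) = ∑ u ∈ U, h u := by
    intro h
    rw [hU', Finset.sum_image fun a _ b _ hab => by simpa using hab]
    exact Finset.sum_congr rfl fun u _ => by rw [sub_add_cancel]
  have hs1 : ∀ u v, g u v ≠ 0 → u ∈ U' := fun u v h =>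
    (hmemU' u).2 (hf.supp _ _ (hgne u v h).2)
  have hanti : ∀ u v, g u v = -g v u := by
    intro u v
    simp only [hg]
    rw [hf.antisymm (u + y) (v + y), neg_div]
    by_cases h : u + y ∈ A ∨ v + y ∈ A
    · rw [if_pos h, if_pos h.symm]
    · rw [if_neg h, if_neg fun h' => h h'.symm, neg_zero]
  have hs2 : ∀ u v, g u v ≠ 0 → v ∈ U' := fun u v h => hs1 v u fun h' => h (by
    rw [hanti, h', neg_zero])
  have hnet : ∀ u, netFlow g u = ∑ v ∈ U', g u v := by
    intro u
    refine tsum_eq_sum fun v hv => ?_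
    by_contra h
    exact hv (hs2 u v h)
  have hzero : ∀ u, ¬ u ≤ 0 → ¬ 2 ^ j < u → ∑ v ∈ U', g u v = 0 := by
    intro u h1 h2
    have hu : u + y ∈ A := by
      rw [hA, Finset.mem_Ioc]
      omega
    have h3 : ∀ v, g u v = (fun x => f (u + y) x / φ) (v + y) := fun v => by
      simp only [hg]
      rw [if_pos (Or.inl hu)]
    simp only [h3]
    rw [hsum (fun x => f (u + y) x / φ), ← Finset.sum_div, hcons _ hu, zero_div]
  have hsource : ∑ u ∈ U'.filter (· ≤ 0), ∑ v ∈ U', g u v = 1 := by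
    have h1 : ∑ u ∈ U'.filter (· ≤ 0), ∑ v ∈ U', g u v =
        ∑ u ∈ U, ∑ v ∈ U, if u ≤ y then (if v ∈ A then f u v / φ else 0) else 0 := by
      rw [Finset.sum_filter, ← hsum (fun u => ∑ v ∈ U,
        if u ≤ y then (if v ∈ A then f u v / φ else 0) else 0)]
      refine Finset.sum_congr rfl fun u _ => ?_
      rw [← hsum (fun v => if u + y ≤ y then (if v ∈ A then f (u + y) v / φ else 0) else 0)]
      by_cases hu : u ≤ 0
      · rw [if_pos hu]
        refine Finset.sum_congr rfl fun v _ => ?_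
        rw [if_pos (by omega)]
        have hu' : u + y ∉ A := by
          rw [hA, Finset.mem_Ioc]
          omega
        simp only [hg, hu', false_or]
      · rw [if_neg hu]
        symm
        refine Finset.sum_eq_zero fun v _ => ?_
        rw [if_neg (by omega)]
    have h2 : φ = ∑ u ∈ U, ∑ v ∈ U, if u ≤ y then (if v ∈ A then f u v else 0) else 0 := by
      rw [hφ, Finset.sum_comm, Finset.sum_filter]
      refine Finset.sum_congr rfl fun u _ => ?_
      split_ifs with hu
      · rw [← Finset.sum_filter]
        symm
        refine Finset.sum_subset (fun v hv => (Finset.mem_filter.1 hv).2) fun v hv hv' => ?_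
        refine hf.eq_zero_right u fun hvU => hv' ?_
        exact Finset.mem_filter.2 ⟨hvU, hv⟩
      · simp
    rw [h1, ← div_self hφ0]
    conv_rhs => lhs; rw [h2]
    rw [Finset.sum_div]
    refine Finset.sum_congr rfl fun u _ => ?_
    rw [Finset.sum_div]
    exact Finset.sum_congr rfl fun v _ => by split_ifs <;> simp
  -- The divergences of a finitely supported antisymmetric function sum to zero, and those inside
  -- the block vanish.
  have hsink : ∑ u ∈ U'.filter (2 ^ j < ·), ∑ v ∈ U', g u v = -1 := by
    have htot : ∑ u ∈ U', ∑ v ∈ U', g u v = 0 := by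
      have h : ∑ u ∈ U', ∑ v ∈ U', g u v = -∑ u ∈ U', ∑ v ∈ U', g u v := by
        conv_lhs => rw [Finset.sum_comm]
        rw [← Finset.sum_neg_distrib]
        refine Finset.sum_congr rfl fun u _ => ?_
        rw [← Finset.sum_neg_distrib]
        exact Finset.sum_congr rfl fun v _ => hanti v u
      linarith
    rw [← Finset.sum_filter_add_sum_filter_not U' (· ≤ 0), hsource] at htot
    have h1 : ∑ u ∈ U'.filter (¬ · ≤ 0), ∑ v ∈ U', g u v =
        ∑ u ∈ U'.filter (2 ^ j < ·), ∑ v ∈ U', g u v := by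
      symm
      refine Finset.sum_subset (fun u hu => ?_) fun u hu hu' => ?_
      · simp only [Finset.mem_filter] at hu ⊢
        exact ⟨hu.1, by omega⟩
      · simp only [Finset.mem_filter] at hu hu'
        exact hzero u hu.2 fun h => hu' ⟨hu.1, h⟩
    linarith
  have hadm : Admissible (graph (restrict (blockEdges 0 j) (shift y ω))) j g := by
    refine ⟨⟨U'.filter (· ≤ 0), U'.filter (2 ^ j < ·), by simp, by simp,
      ⟨⟨fun u v _ => hanti u v, ?_⟩, ?_, ?_, ?_, ?_⟩⟩, ?_⟩
    · intro u v huv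
      by_contra h
      apply huv
      obtain ⟨h1, h2⟩ := hgne u v h
      have hl : 4 * |u - v| ≤ 2 ^ j := by
        rcases h1 with h1 | h1
        · have := hshort _ h1 _ h2
          rwa [add_sub_add_right_eq_sub] at this
        · have := hshort _ h1 (u + y) (fun h' => h2 (by rw [hf.antisymm, h', neg_zero]))
          rwa [add_sub_add_right_eq_sub, abs_sub_comm] at this
      rw [hA, Finset.mem_Ioc, Finset.mem_Ioc] at h1
      rcases hf.adj _ _ h2 with ⟨h3, h4⟩ | ⟨h3, h4⟩
      · refine Or.inl ⟨by omega, ?_⟩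
        simp only [restrict, Bool.and_eq_true, decide_eq_true_eq, mem_blockEdges, Touches, len,
          Finset.mem_Ioc]
        have := neg_le_abs (u - v)
        exact ⟨⟨by omega, by omega⟩, h4⟩
      · refine Or.inr ⟨by omega, ?_⟩
        simp only [restrict, Bool.and_eq_true, decide_eq_true_eq, mem_blockEdges, Touches, len,
          Finset.mem_Ioc]
        have := le_abs_self (u - v)
        exact ⟨⟨by omega, by omega⟩, h4⟩
    · exact fun u => summable_of_ne_finset_zero (s := U') fun v hv => by
        by_contra h
        exact hv (hs2 u v h)
    · simp only [hnet, hsource]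
    · simp only [hnet, hsink]
    · intro u h1 h2
      rw [hnet]
      by_cases huU : u ∈ U'
      · simp only [Finset.mem_filter, huU, true_and] at h1 h2
        exact hzero u h1 h2
      · refine Finset.sum_eq_zero fun v _ => ?_
        by_contra h
        exact huU (hs1 u v h)
    · intro u v hu hv
      by_contra h
      have h1 := (hgne u v h).1
      rw [hA, Finset.mem_Ioc, Finset.mem_Ioc] at h1
      omega
  have hen : ENNReal.ofReal a ≤ ENNReal.ofReal ((∑ u ∈ U', ∑ v ∈ U', g u v ^ 2) / 2) := by
    rw [← energy_eq_of_supp hs1 hs2]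
    exact hres.trans (iInf₂_le_of_le g hadm le_rfl)
  have hnn : 0 ≤ (∑ u ∈ U', ∑ v ∈ U', g u v ^ 2) / 2 :=
    div_nonneg (Finset.sum_nonneg fun u _ => Finset.sum_nonneg fun v _ => sq_nonneg _)
      (by norm_num)
  rw [ENNReal.ofReal_le_ofReal_iff hnn] at hen
  -- Each ordered pair is charged to an end lying in the block. The resulting factor `2` cancels the
  -- `1 / 2` in the energy.
  have hE : ∑ u ∈ U', ∑ v ∈ U', g u v ^ 2 ≤ 2 * (∑ u ∈ A, rowEnergy U f u) / φ ^ 2 := by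
    have h1 : ∑ u ∈ U', ∑ v ∈ U', g u v ^ 2 =
        ∑ u ∈ U, ∑ v ∈ U, if u ∈ A ∨ v ∈ A then f u v ^ 2 / φ ^ 2 else 0 := by
      rw [← hsum (fun u => ∑ v ∈ U, if u ∈ A ∨ v ∈ A then f u v ^ 2 / φ ^ 2 else 0)]
      refine Finset.sum_congr rfl fun u _ => ?_
      rw [← hsum (fun v => if u + y ∈ A ∨ v ∈ A then f (u + y) v ^ 2 / φ ^ 2 else 0)]
      refine Finset.sum_congr rfl fun v _ => ?_
      simp only [hg]
      split_ifs
      · rw [div_pow]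
      · simp
    have h2 : ∑ u ∈ U, ∑ v ∈ U, (if u ∈ A then f u v ^ 2 / φ ^ 2 else 0) =
        (∑ u ∈ A, rowEnergy U f u) / φ ^ 2 := by
      have h3 : ∀ u, ∑ v ∈ U, (if u ∈ A then f u v ^ 2 / φ ^ 2 else 0) =
          if u ∈ A then rowEnergy U f u / φ ^ 2 else 0 := by
        intro u
        split_ifs
        · rw [rowEnergy, Finset.sum_div]
        · simp
      simp only [h3]
      rw [← Finset.sum_filter, Finset.sum_div]
      refine Finset.sum_subset (fun v hv => (Finset.mem_filter.1 hv).2) fun u hu hu' => ?_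
      have huU : u ∉ U := fun h => hu' (Finset.mem_filter.2 ⟨h, hu⟩)
      rw [rowEnergy, Finset.sum_eq_zero fun v _ => by rw [hf.eq_zero_left huU]; norm_num, zero_div]
    have h3 : ∑ u ∈ U, ∑ v ∈ U, (if v ∈ A then f u v ^ 2 / φ ^ 2 else 0) =
        (∑ u ∈ A, rowEnergy U f u) / φ ^ 2 := by
      rw [← h2, Finset.sum_comm]
      refine Finset.sum_congr rfl fun u _ => Finset.sum_congr rfl fun v _ => ?_
      rw [hf.antisymm v u, neg_sq]
    rw [h1]
    calc _ ≤ ∑ u ∈ U, ∑ v ∈ U, ((if u ∈ A then f u v ^ 2 / φ ^ 2 else 0) +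
          (if v ∈ A then f u v ^ 2 / φ ^ 2 else 0)) := by
          refine Finset.sum_le_sum fun u _ => Finset.sum_le_sum fun v _ => ?_
          have : 0 ≤ f u v ^ 2 / φ ^ 2 := by positivity
          split_ifs <;> first | (exfalso; tauto) | linarith
      _ = _ := by
          simp only [Finset.sum_add_distrib]
          rw [h2, h3]
          ring
  have hφ2 : 0 < φ ^ 2 := by positivity
  calc a * φ ^ 2 ≤ (2 * (∑ u ∈ A, rowEnergy U f u) / φ ^ 2) / 2 * φ ^ 2 := by
        gcongr
        linarith
    _ = _ := by field_simp

/-- Version of `block_energy` for the flow entering the block from the right. -/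
theorem block_energy_right {ω : Config} {U : Finset ℤ} {f : ℤ → ℤ → ℝ} (hf : IsFinFlow ω U f)
    {y : ℤ} {j : ℕ} (hcons : ∀ u ∈ Finset.Ioc y (y + 2 ^ j), ∑ v ∈ U, f u v = 0)
    (hshort : ∀ u ∈ Finset.Ioc y (y + 2 ^ j), ∀ v, f u v ≠ 0 → 4 * |u - v| ≤ 2 ^ j)
    {a : ℝ} (hres : ENNReal.ofReal a ≤ blockRes y j ω) :
    a * (∑ w ∈ Finset.Ioc y (y + 2 ^ j), ∑ u ∈ U.filter (y + 2 ^ j < ·), f u w) ^ 2 ≤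
      ∑ u ∈ Finset.Ioc y (y + 2 ^ j), rowEnergy U f u := by
  refine le_of_eq_of_le ?_ (block_energy hf hcons hshort hres)
  have h2j : (0 : ℤ) < 2 ^ j := by positivity
  set A := Finset.Ioc y (y + 2 ^ j) with hA
  -- By conservation in the block, the flow entering from the right is minus the flow entering from
  -- the left; the squares agree.
  have h1 := hf.sum_eq_sum_sdiff A
  rw [Finset.sum_eq_zero hcons] at h1
  have h2 : ∀ w, ∑ v ∈ U \ A, f w v =
      -(∑ u ∈ U.filter (· ≤ y), f u w + ∑ u ∈ U.filter (y + 2 ^ j < ·), f u w) := by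
    intro w
    have h3 : U \ A = U.filter (· ≤ y) ∪ U.filter (y + 2 ^ j < ·) := by
      ext u
      simp only [hA, Finset.mem_sdiff, Finset.mem_Ioc, Finset.mem_union, Finset.mem_filter]
      by_cases hu : u ∈ U <;> simp only [hu, true_and, false_and, or_self]
      omega
    rw [h3, Finset.sum_union, neg_add, ← Finset.sum_neg_distrib, ← Finset.sum_neg_distrib]
    · congr 1 <;> exact Finset.sum_congr rfl fun u _ => hf.antisymm w u
    · rw [Finset.disjoint_left]
      intro u hu hu'
      simp only [Finset.mem_filter] at hu hu'
      omega
  simp only [h2, Finset.sum_neg_distrib, Finset.sum_add_distrib] at h1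
  have h3 : ∑ w ∈ A, ∑ u ∈ U.filter (y + 2 ^ j < ·), f u w =
      -∑ w ∈ A, ∑ u ∈ U.filter (· ≤ y), f u w := by linarith
  rw [h3, neg_sq]

/-! ### Dissipation at good scales -/

/-- The two blocks at distance `2 ^ j` from `v`. -/
noncomputable def ring (v : ℤ) (j : ℕ) : Finset ℤ :=
  Finset.Ioc (v + 2 ^ j) (v + 2 ^ j + 2 ^ j) ∪
    Finset.Ioc (v - 2 ^ (j + 1) - 1) (v - 2 ^ (j + 1) - 1 + 2 ^ j)

theorem Good.short {β α : ℝ} {v : ℤ} {X : Set Edge} {j : ℕ} {ω : Config} {U : Finset ℤ}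
    {f : ℤ → ℤ → ℝ} (hg : Good β α v X j ω) (hf : IsFinFlow ω U f) {u w : ℤ} (h : f u w ≠ 0)
    (hu : u ∈ ball v j) : 4 * |u - w| ≤ 2 ^ j ∨ ∃ e ∈ X, e.1 = (u, w) ∨ e.1 = (w, u) := by
  obtain ⟨e, he, huw⟩ := hf.exists_edge h
  by_cases hlen : 2 ^ j < 4 * len e
  · refine Or.inr ⟨e, hg.2.2 e he ?_ hlen, huw⟩
    rcases huw with h1 | h1
    · exact Or.inl (by rw [h1]; exact hu)
    · exact Or.inr (by rw [h1]; exact hu)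
  · refine Or.inl ?_
    have h2 := e.2
    rcases huw with h1 | h1 <;> simp only [len, h1] at hlen h2
    · rw [abs_of_neg (by omega)]
      omega
    · rw [abs_of_pos (by omega)]
      omega

/-- A long edge ending at the center of a good scale: its flow has to cross one of the two blocks. -/
theorem landing_energy {β α : ℝ} {ω : Config} {U : Finset ℤ} {f : ℤ → ℤ → ℝ}
    (hf : IsFinFlow ω U f) {n : ℕ}
    (hcons : ∀ u, 0 < u → u ≤ 2 ^ n → ∑ v ∈ U, f u v = 0) {e : Edge} {j : ℕ} (he : e.1.1 ≤ 0)
    (hlow : 2 ^ (j + 4) ≤ e.1.2) (hhigh : e.1.2 + 2 ^ (j + 1) ≤ 2 ^ n)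
    (hg : Good β α e.1.2 {e} j ω) :
    quantile β α j * f e.1.1 e.1.2 ^ 2 ≤ 2 * ∑ w ∈ ring e.1.2 j, rowEnergy U f w := by
  classical
  obtain ⟨⟨u0, v⟩, huv⟩ := e
  simp only at he hlow hhigh hg huv ⊢
  have hP : (0 : ℤ) < 2 ^ j := by positivity
  have hr := block_energy hf (y := v + 2 ^ j) (j := j)
    (fun u hu => by
      simp only [Finset.mem_Ioc, pow_succ] at hu hlow hhigh
      exact hcons u (by omega) (by omega))
    (fun u hu w h => by
      simp only [Finset.mem_Ioc, pow_succ] at hu hlow hhigh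
      rcases hg.short hf h (by simp only [ball, Finset.mem_Icc, pow_succ]; omega) with h1 | h1
      · exact h1
      · exfalso
        simp only [Set.mem_singleton_iff, exists_eq_left, Prod.mk.injEq] at h1
        omega) hg.1
  have hl := block_energy_right hf (y := v - 2 ^ (j + 1) - 1) (j := j)
    (fun u hu => by
      simp only [Finset.mem_Ioc, pow_succ] at hu hlow hhigh
      exact hcons u (by omega) (by omega))
    (fun u hu w h => by
      simp only [Finset.mem_Ioc, pow_succ] at hu hlow hhigh
      rcases hg.short hf h (by simp only [ball, Finset.mem_Icc, pow_succ]; omega) with h1 | h1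
      · exact h1
      · exfalso
        simp only [Set.mem_singleton_iff, exists_eq_left, Prod.mk.injEq] at h1
        omega) hg.2.1
  set A := Finset.Ioc (v + 2 ^ j) (v + 2 ^ j + 2 ^ j) with hA
  set A' := Finset.Ioc (v - 2 ^ (j + 1) - 1) (v - 2 ^ (j + 1) - 1 + 2 ^ j) with hA'
  set φ := ∑ w ∈ A, ∑ u ∈ U.filter (· ≤ v + 2 ^ j), f u w with hφ
  set φ' := ∑ w ∈ A', ∑ u ∈ U.filter (v - 2 ^ (j + 1) - 1 + 2 ^ j < ·), f u w with hφ'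
  -- `B` is the interval between the two blocks. Apart from the edge under consideration, every edge
  -- leaving `B` that carries flow is short and ends in `A` or `A'`; conservation on `B` then gives
  -- `f u0 v = φ + φ'`.
  set B := Finset.Icc (v - 2 ^ j) (v + 2 ^ j) with hB
  have hB0 : ∑ u ∈ B, ∑ w ∈ U \ B, f u w = 0 := by
    rw [← hf.sum_eq_sum_sdiff]
    refine Finset.sum_eq_zero fun u hu => ?_
    simp only [hB, Finset.mem_Icc, pow_succ] at hu hlow hhigh
    exact hcons u (by omega) (by omega)
  -- A short edge cannot jump over `B`, so all the flow entering `A` from the left comes from `B`.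
  have hφB : φ = ∑ w ∈ A, ∑ u ∈ B, f u w := by
    refine Finset.sum_congr rfl fun w hw => ?_
    simp only [hA, Finset.mem_Ioc, pow_succ] at hw hlow hhigh
    rw [← Finset.sum_filter_ne_zero (s := U.filter _), ← Finset.sum_filter_ne_zero (s := B)]
    refine Finset.sum_congr ?_ fun _ _ => rfl
    ext u
    simp only [Finset.mem_filter, hB, Finset.mem_Icc]
    constructor
    · rintro ⟨⟨hu, hu'⟩, hne⟩
      refine ⟨⟨?_, hu'⟩, hne⟩
      have hne' : f w u ≠ 0 := fun h => hne (by rw [hf.antisymm, h, neg_zero])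
      rcases hg.short hf hne' (by simp only [ball, Finset.mem_Icc, pow_succ]; omega) with h1 | h1
      · have := le_abs_self (w - u)
        omega
      · simp only [Set.mem_singleton_iff, exists_eq_left, Prod.mk.injEq] at h1
        omega
    · rintro ⟨⟨hu, hu'⟩, hne⟩
      exact ⟨⟨hf.supp _ _ hne, hu'⟩, hne⟩
  have hφB' : φ' = ∑ w ∈ A', ∑ u ∈ B, f u w := by
    refine Finset.sum_congr rfl fun w hw => ?_
    simp only [hA', Finset.mem_Ioc, pow_succ] at hw hlow hhigh
    rw [← Finset.sum_filter_ne_zero (s := U.filter _), ← Finset.sum_filter_ne_zero (s := B)]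
    refine Finset.sum_congr ?_ fun _ _ => rfl
    ext u
    simp only [Finset.mem_filter, hB, Finset.mem_Icc, pow_succ]
    constructor
    · rintro ⟨⟨hu, hu'⟩, hne⟩
      refine ⟨⟨by omega, ?_⟩, hne⟩
      have hne' : f w u ≠ 0 := fun h => hne (by rw [hf.antisymm, h, neg_zero])
      rcases hg.short hf hne' (by simp only [ball, Finset.mem_Icc, pow_succ]; omega) with h1 | h1
      · have := neg_le_abs (w - u)
        omega
      · simp only [Set.mem_singleton_iff, exists_eq_left, Prod.mk.injEq] at h1
        omega
    · rintro ⟨⟨hu, hu'⟩, hne⟩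
      exact ⟨⟨hf.supp _ _ hne, by omega⟩, hne⟩
  have hpt : ∀ u ∈ B, ∑ w ∈ U \ B, f u w =
      (if u = v then f v u0 else 0) + ∑ w ∈ A, f u w + ∑ w ∈ A', f u w := by
    intro u hu
    simp only [hB, Finset.mem_Icc, pow_succ] at hu hlow hhigh
    have hu0 : u0 ∉ A ∪ A' := by
      simp only [hA, hA', Finset.mem_union, Finset.mem_Ioc, pow_succ]
      omega
    have hdisj : Disjoint A A' := by
      rw [Finset.disjoint_left]
      intro w h1 h2
      simp only [hA, hA', Finset.mem_Ioc, pow_succ] at h1 h2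
      omega
    have h1 : (if u = v then f v u0 else 0) = if u = v then f u u0 else 0 := by
      split_ifs with h
      · rw [h]
      · rfl
    -- The three contributions are merged into one sum so that supports can be compared; the vertex
    -- `u0` may count only at `u = v`.
    have h2 : (if u = v then f v u0 else 0) + ∑ w ∈ A, f u w + ∑ w ∈ A', f u w =
        ∑ w ∈ insert u0 (A ∪ A'), if w = u0 ∧ u ≠ v then 0 else f u w := by
      rw [Finset.sum_insert hu0, add_assoc, ← Finset.sum_union hdisj, h1]
      congr 1
      · by_cases h : u = v <;> simp [h]
      · refine Finset.sum_congr rfl fun w hw => ?_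
        rw [if_neg]
        rintro ⟨rfl, -⟩
        exact hu0 hw
    rw [h2, ← Finset.sum_filter_ne_zero (s := U \ B),
      ← Finset.sum_filter_ne_zero (s := insert u0 (A ∪ A'))]
    refine Finset.sum_congr ?_ fun w hw => ?_
    · ext w
      simp only [Finset.mem_filter, Finset.mem_sdiff, Finset.mem_insert, Finset.mem_union]
      constructor
      · rintro ⟨⟨-, hwB⟩, hne⟩
        rcases hg.short hf hne (by simp only [ball, Finset.mem_Icc, pow_succ]; omega) with h3 | h3
        · simp only [hB, Finset.mem_Icc] at hwB
          have h4 := neg_le_abs (u - w)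
          have h5 := le_abs_self (u - w)
          refine ⟨Or.inr ?_, ?_⟩
          · simp only [hA, hA', Finset.mem_Ioc, pow_succ]
            omega
          · rw [if_neg (by omega)]
            exact hne
        · simp only [Set.mem_singleton_iff, exists_eq_left, Prod.mk.injEq] at h3
          refine ⟨Or.inl (by omega), ?_⟩
          rw [if_neg (by omega)]
          exact hne
      · rintro ⟨hw, hne⟩
        have hne' : f u w ≠ 0 := fun h => hne (by rw [h, ite_self])
        refine ⟨⟨?_, ?_⟩, hne'⟩
        · by_contra h
          exact hne' (hf.eq_zero_right u h)
        · simp only [hA, hA', hB, Finset.mem_Ioc, Finset.mem_Icc, pow_succ] at hw ⊢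
          omega
    · rw [Finset.mem_filter] at hw
      by_cases h : w = u0 ∧ u ≠ v
      · exact absurd (if_pos h) hw.2
      · rw [if_neg h]
  have hsum : f v u0 + φ + φ' = 0 := by
    rw [Finset.sum_congr rfl hpt, Finset.sum_add_distrib, Finset.sum_add_distrib,
      Finset.sum_ite_eq' B v, if_pos (by simp [hB, hP.le]), Finset.sum_comm (s := B) (t := A),
      Finset.sum_comm (s := B) (t := A'), ← hφB, ← hφB'] at hB0
    exact hB0
  have hθ : f u0 v = φ + φ' := by
    rw [hf.antisymm u0 v]
    linarith
  have hdisj : Disjoint A A' := by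
    rw [Finset.disjoint_left]
    intro w h1 h2
    simp only [hA, hA', Finset.mem_Ioc, pow_succ] at h1 h2
    omega
  rw [ring, Finset.sum_union hdisj, hθ]
  have ha := quantile_nonneg β α j
  have h1 : (φ + φ') ^ 2 ≤ 2 * (φ ^ 2 + φ' ^ 2) := by nlinarith [sq_nonneg (φ - φ')]
  calc quantile β α j * (φ + φ') ^ 2 ≤ quantile β α j * (2 * (φ ^ 2 + φ' ^ 2)) := by gcongr
    _ ≤ _ := by linarith

/-- The edges from `(-∞, 0]` to `(2 ^ s, ∞)` used by the flow. -/
noncomputable def landEdges (U : Finset ℤ) (f : ℤ → ℤ → ℝ) (s : ℕ) : Finset Edge :=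
  ((U ×ˢ U).filter fun p => p.1 ≤ 0 ∧ 2 ^ s < p.2 ∧ f p.1 p.2 ≠ 0).subtype fun p => p.1 < p.2

theorem mem_landEdges {U : Finset ℤ} {f : ℤ → ℤ → ℝ} {s : ℕ} {e : Edge} :
    e ∈ landEdges U f s ↔
      (e.1.1 ∈ U ∧ e.1.2 ∈ U) ∧ e.1.1 ≤ 0 ∧ 2 ^ s < e.1.2 ∧ f e.1.1 e.1.2 ≠ 0 := by
  simp [landEdges]

theorem sum_landEdges (U : Finset ℤ) (f : ℤ → ℤ → ℝ) (s : ℕ) :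
    ∑ e ∈ landEdges U f s, f e.1.1 e.1.2 =
      ∑ u ∈ U, ∑ w ∈ U, if u ≤ 0 ∧ 2 ^ s < w then f u w else 0 := by
  have h2 : (0 : ℤ) < 2 ^ s := by positivity
  unfold landEdges
  rw [Finset.sum_subtype_eq_sum_filter (f := fun p : ℤ × ℤ => f p.1 p.2), Finset.filter_filter,
    Finset.sum_filter, Finset.sum_product]
  refine Finset.sum_congr rfl fun u _ => Finset.sum_congr rfl fun w _ => ?_
  simp only
  by_cases h : u ≤ 0 ∧ 2 ^ s < w
  · rw [if_pos h]
    by_cases hf : f u w = 0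
    · simp [hf]
    · rw [if_pos ⟨⟨h.1, h.2, hf⟩, by omega⟩]
  · rw [if_neg h, if_neg fun h' => h ⟨h'.1.1, h'.1.2.1⟩]

/-- A unit of flow leaving `(-∞, 0]` either crosses the block `(2 ^ j, 2 ^ (j + 1)]`, or uses a
long edge, if the scale `j` is good around `0`. -/
theorem flux_at_zero {β α : ℝ} {ω : Config} {U : Finset ℤ} {f : ℤ → ℤ → ℝ}
    (hf : IsFinFlow ω U f) {n : ℕ}
    (hcons : ∀ u, 0 < u → u ≤ 2 ^ n → ∑ v ∈ U, f u v = 0)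
    (hflux : ∑ u ∈ U.filter (· ≤ 0), ∑ v ∈ U, f u v = 1) {j : ℕ} (hj : j ≤ n)
    (hg : Good β α 0 ∅ j ω) :
    (∑ w ∈ Finset.Ioc (2 ^ j : ℤ) (2 ^ j + 2 ^ j), ∑ u ∈ U.filter (· ≤ 2 ^ j), f u w) +
      ∑ e ∈ landEdges U f (j + 3), f e.1.1 e.1.2 = 1 := by
  classical
  have hP : (0 : ℤ) < 2 ^ j := by positivity
  have hPn : (2 : ℤ) ^ j ≤ 2 ^ n := pow_le_pow_right₀ (by norm_num) hj
  set C := U.filter (· ≤ (2 : ℤ) ^ j) with hC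
  have h1 : ∑ u ∈ C, ∑ v ∈ U, f u v = 1 := by
    rw [← hflux]
    symm
    refine Finset.sum_subset (fun u hu => ?_) fun u hu hu' => ?_
    · simp only [hC, Finset.mem_filter] at hu ⊢
      exact ⟨hu.1, by omega⟩
    · simp only [hC, Finset.mem_filter] at hu hu'
      have : ¬ u ≤ 0 := fun h => hu' ⟨hu.1, h⟩
      exact hcons u (by omega) (by omega)
  rw [hf.sum_eq_sum_sdiff] at h1
  rw [← h1, sum_landEdges]
  have h2 : ∑ w ∈ Finset.Ioc (2 ^ j : ℤ) (2 ^ j + 2 ^ j), ∑ u ∈ C, f u w =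
      ∑ u ∈ U, ∑ w ∈ U, if u ≤ 2 ^ j ∧ w ∈ Finset.Ioc (2 ^ j : ℤ) (2 ^ j + 2 ^ j)
        then f u w else 0 := by
    rw [Finset.sum_comm, hC, Finset.sum_filter]
    refine Finset.sum_congr rfl fun u _ => ?_
    by_cases hu : u ≤ 2 ^ j
    · simp only [hu, if_true, true_and]
      rw [← Finset.sum_filter]
      symm
      refine Finset.sum_subset (fun v hv => (Finset.mem_filter.1 hv).2) fun v hv hv' => ?_
      exact hf.eq_zero_right u fun hvU => hv' (Finset.mem_filter.2 ⟨hvU, hv⟩)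
    · simp [hu]
  have h3 : ∑ u ∈ C, ∑ w ∈ U \ C, f u w =
      ∑ u ∈ U, ∑ w ∈ U, if u ≤ 2 ^ j ∧ 2 ^ j < w then f u w else 0 := by
    have h4 : U \ C = U.filter ((2 : ℤ) ^ j < ·) := by
      ext w
      simp only [hC, Finset.mem_sdiff, Finset.mem_filter]
      by_cases hw : w ∈ U <;> simp [hw]
    rw [h4, hC, Finset.sum_filter]
    refine Finset.sum_congr rfl fun u _ => ?_
    by_cases hu : u ≤ 2 ^ j
    · simp only [hu, if_true, true_and]
      rw [Finset.sum_filter]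
    · simp [hu]
  rw [h2, h3, ← Finset.sum_add_distrib]
  refine Finset.sum_congr rfl fun u _ => ?_
  rw [← Finset.sum_add_distrib]
  refine Finset.sum_congr rfl fun w _ => ?_
  by_cases hne : f u w = 0
  · simp [hne]
  -- A pair crossing `2 ^ j` and landing beyond `2 ^ (j + 1)` is too long to touch the ball, hence
  -- `u ≤ 0` and `w > 2 ^ (j + 3)`. So the pairs crossing `2 ^ j` split into those ending in the
  -- block and the landing edges.
  have h5 : u ∈ ball 0 j → 4 * |u - w| ≤ 2 ^ j := fun hu => by
    simpa using hg.short hf hne hu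
  have h6 : w ∈ ball 0 j → 4 * |w - u| ≤ 2 ^ j := fun hw => by
    simpa using hg.short hf (fun h => hne (by rw [hf.antisymm, h, neg_zero]) : f w u ≠ 0) hw
  simp only [ball, Finset.mem_Icc, pow_succ] at h5 h6
  have h7 := neg_le_abs (u - w)
  have h8 := le_abs_self (w - u)
  simp only [Finset.mem_Ioc, pow_succ]
  by_cases hu : u ≤ 2 ^ j ∧ 2 ^ j < w
  · rw [if_pos hu]
    by_cases hw : w ≤ 2 ^ j + 2 ^ j
    · rw [if_pos ⟨hu.1, hu.2, hw⟩, if_neg (by omega), add_zero]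
    · have hu5 : u ≤ 0 := by
        by_contra h
        have := h5 (by omega)
        omega
      have hw6 : 2 ^ j * 2 * 2 * 2 < w := by
        by_contra h
        have := h6 (by omega)
        omega
      rw [if_neg (by omega), if_pos ⟨hu5, hw6⟩, zero_add]
  · rw [if_neg hu, if_neg (by omega), if_neg (by omega), add_zero]

/-! ### Combining the scales -/

theorem open_of_mem_landEdges {ω : Config} {U : Finset ℤ} {f : ℤ → ℤ → ℝ}
    (hf : IsFinFlow ω U f) {s : ℕ} {e : Edge} (he : e ∈ landEdges U f s) : ω e = true := by
  rw [mem_landEdges] at he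
  obtain ⟨e', he', h⟩ := hf.exists_edge he.2.2.2
  have h1 := e.2
  have h2 := e'.2
  rcases h with h | h
  · rwa [show e = e' from Subtype.ext h.symm]
  · rw [h] at h2
    simp only at h2
    omega

/-- If the rings met, the endpoint of `e'` would lie in the ball around the endpoint of `e`. Since
both endpoints are far from `0`, the edge `e'` would be a long edge touching this ball, which
goodness forbids for edges other than `e`. -/
theorem disjoint_ring_ring {β α : ℝ} {ω : Config} {e e' : Edge} (hne : e ≠ e')
    (he' : ω e' = true) (hu' : e'.1.1 ≤ 0) {j j' : ℕ} (hj : j' ≤ j)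
    (hlow : 2 ^ (j + 4) ≤ e.1.2) (hg : Good β α e.1.2 {e} j ω) :
    Disjoint (ring e.1.2 j) (ring e'.1.2 j') := by
  have h1 := hg.2.2 e' he'
  simp only [Set.mem_singleton_iff] at h1
  have h2 : ¬ (Touches e' (ball e.1.2 j) ∧ 2 ^ j < 4 * len e') := fun h => hne (h1 h.1 h.2).symm
  have hP : (0 : ℤ) < 2 ^ j := by positivity
  have hP' : (0 : ℤ) < 2 ^ j' := by positivity
  have hPP : (2 : ℤ) ^ j' ≤ 2 ^ j := pow_le_pow_right₀ (by norm_num) hj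
  simp only [Touches, ball, len, Finset.mem_Icc, pow_succ] at h2 hlow
  rw [Finset.disjoint_left]
  intro w hw hw'
  simp only [ring, Finset.mem_union, Finset.mem_Ioc, pow_succ] at hw hw'
  omega

theorem disjoint_ring_same (v : ℤ) {j j' : ℕ} (hj : j' < j) : Disjoint (ring v j) (ring v j') := by
  have hP' : (0 : ℤ) < 2 ^ j' := by positivity
  have hPP : (2 : ℤ) ^ (j' + 1) ≤ 2 ^ j := pow_le_pow_right₀ (by norm_num) hj
  rw [Finset.disjoint_left]
  intro w hw hw'
  simp only [ring, Finset.mem_union, Finset.mem_Ioc, pow_succ] at hw hw' hPP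
  omega

/-- If they met, the endpoint of `e` would be comparable to `2 ^ j`: inside the ball around `0` but
too far from `(-∞, 0]` for a short edge. -/
theorem disjoint_block_ring {β α : ℝ} {ω : Config} {e : Edge} (he : ω e = true) (hu : e.1.1 ≤ 0)
    {j j' : ℕ} (hlow : 2 ^ (j' + 4) ≤ e.1.2) (hg : Good β α 0 ∅ j ω) :
    Disjoint (Finset.Ioc (2 ^ j : ℤ) (2 ^ j + 2 ^ j)) (ring e.1.2 j') := by
  have h1 := hg.2.2 e he
  simp only [Set.mem_empty_iff_false] at h1
  have h2 : ¬ (Touches e (ball 0 j) ∧ 2 ^ j < 4 * len e) := fun h => h1 h.1 h.2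
  have hP : (0 : ℤ) < 2 ^ j := by positivity
  have hP' : (0 : ℤ) < 2 ^ j' := by positivity
  simp only [Touches, ball, len, Finset.mem_Icc, pow_succ] at h2 hlow
  rw [Finset.disjoint_left]
  intro w hw hw'
  simp only [ring, Finset.mem_union, Finset.mem_Ioc, pow_succ] at hw hw'
  omega

theorem disjoint_block_block {j j' : ℕ} (hj : j ≠ j') :
    Disjoint (Finset.Ioc (2 ^ j : ℤ) (2 ^ j + 2 ^ j)) (Finset.Ioc (2 ^ j') (2 ^ j' + 2 ^ j')) := by
  rw [Finset.disjoint_left]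
  intro w hw hw'
  simp only [Finset.mem_Ioc] at hw hw'
  rcases Nat.lt_or_gt_of_ne hj with h | h
  · have hPP : (2 : ℤ) ^ (j + 1) ≤ 2 ^ j' := pow_le_pow_right₀ (by norm_num) h
    rw [pow_succ] at hPP
    omega
  · have hPP : (2 : ℤ) ^ (j' + 1) ≤ 2 ^ j := pow_le_pow_right₀ (by norm_num) h
    rw [pow_succ] at hPP
    omega

/-- The block or the pair of blocks in which energy is dissipated. -/
noncomputable def region (j0 : ℕ → ℕ) (jl : ℕ → Edge → ℕ) : (Σ _ : ℕ, Option Edge) → Finset ℤ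
  | ⟨k, none⟩ => Finset.Ioc (2 ^ j0 k) (2 ^ j0 k + 2 ^ j0 k)
  | ⟨k, some e⟩ => ring e.1.2 (jl k e)

/-- Cauchy–Schwarz for the `1 + s.card` channels. -/
theorem sq_add_sum_le {ι : Type*} (s : Finset ι) (x : ℝ) (g : ι → ℝ) :
    (x + ∑ i ∈ s, g i) ^ 2 ≤ (1 + s.card) * (x ^ 2 + ∑ i ∈ s, g i ^ 2) := by
  have h := sq_sum_le_card_mul_sum_sq (s := Finset.insertNone s)
    (f := fun o : Option ι => o.elim x g)
  simp only [Finset.sum_insertNone, Finset.card_insertNone, Option.elim] at h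
  push_cast at h
  rw [add_comm (1 : ℝ)]
  exact h

/-- The deterministic core. At every `k` the unit flux splits into at most `1 + N k` channels, each
dissipating in its own region; since all regions are disjoint, the contributions of different `k`
add up. -/
theorem sum_le_sum_rowEnergy {β α : ℝ} {ω : Config} {U : Finset ℤ} {f : ℤ → ℤ → ℝ}
    (hf : IsFinFlow ω U f) {n : ℕ}
    (hcons : ∀ u, 0 < u → u ≤ 2 ^ n → ∑ v ∈ U, f u v = 0)
    (hflux : ∑ u ∈ U.filter (· ≤ 0), ∑ v ∈ U, f u v = 1)
    {ks : Finset ℕ} {j0 : ℕ → ℕ} {jl : ℕ → Edge → ℕ} {a N : ℕ → ℝ}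
    (hj0 : ∀ k ∈ ks, j0 k + 1 ≤ n)
    (hg0 : ∀ k ∈ ks, Good β α 0 ∅ (j0 k) ω)
    (hgl : ∀ k ∈ ks, ∀ e ∈ landEdges U f (j0 k + 3),
      Good β α e.1.2 {e} (jl k e) ω ∧ jl k e + 1 ≤ j0 k ∧ e.1.2 + 2 ^ (jl k e + 1) ≤ 2 ^ n)
    (hne0 : ∀ k ∈ ks, ∀ k' ∈ ks, k ≠ k' → j0 k ≠ j0 k')
    (hnel : ∀ k ∈ ks, ∀ k' ∈ ks, k ≠ k' → ∀ e ∈ landEdges U f (j0 k + 3),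
      e ∈ landEdges U f (j0 k' + 3) → jl k e ≠ jl k' e)
    (ha : ∀ k ∈ ks, 0 ≤ a k ∧ a k ≤ quantile β α (j0 k) ∧
      ∀ e ∈ landEdges U f (j0 k + 3), a k ≤ quantile β α (jl k e))
    (hN : ∀ k ∈ ks, ((landEdges U f (j0 k + 3)).card : ℝ) ≤ N k) :
    ∑ k ∈ ks, a k / (2 * (1 + N k)) ≤ ∑ u ∈ U, rowEnergy U f u := by
  classical
  set E : ℕ → Finset Edge := fun k => landEdges U f (j0 k + 3) with hE
  have hlow : ∀ k ∈ ks, ∀ e ∈ E k, 2 ^ (jl k e + 4) ≤ e.1.2 := by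
    intro k hk e he
    have h1 := (mem_landEdges.1 he).2.2.1
    have h2 := (hgl k hk e he).2.1
    have h3 : (2 : ℤ) ^ (jl k e + 4) ≤ 2 ^ (j0 k + 3) := pow_le_pow_right₀ (by norm_num) (by omega)
    omega
  have hscale : ∀ k ∈ ks, a k / (2 * (1 + N k)) ≤
      ∑ o ∈ Finset.insertNone (E k), ∑ w ∈ region j0 jl ⟨k, o⟩, rowEnergy U f w := by
    intro k hk
    obtain ⟨ha0, ha1, ha2⟩ := ha k hk
    have hflux0 := flux_at_zero hf hcons hflux (by have := hj0 k hk; omega) (hg0 k hk)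
    set φ := ∑ w ∈ Finset.Ioc (2 ^ j0 k : ℤ) (2 ^ j0 k + 2 ^ j0 k),
      ∑ u ∈ U.filter (· ≤ 2 ^ j0 k), f u w with hφ
    have hP : (0 : ℤ) < 2 ^ j0 k := by positivity
    have hPn : (2 : ℤ) ^ (j0 k + 1) ≤ 2 ^ n := pow_le_pow_right₀ (by norm_num) (hj0 k hk)
    have h0 := block_energy hf (y := 2 ^ j0 k) (j := j0 k)
      (fun u hu => by
        simp only [Finset.mem_Ioc, pow_succ] at hu hPn
        exact hcons u (by omega) (by omega))
      (fun u hu w h => by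
        simp only [Finset.mem_Ioc, pow_succ] at hu hPn
        simpa using (hg0 k hk).short hf h (by
          simp only [ball, Finset.mem_Icc, pow_succ]; omega))
      (by simpa using (hg0 k hk).1)
    have h1 : ∀ e ∈ E k, a k * f e.1.1 e.1.2 ^ 2 ≤
        2 * ∑ w ∈ ring e.1.2 (jl k e), rowEnergy U f w := by
      intro e he
      refine le_trans ?_ (landing_energy hf hcons (mem_landEdges.1 he).2.1 (hlow k hk e he)
        (hgl k hk e he).2.2 (hgl k hk e he).1)
      exact mul_le_mul_of_nonneg_right (ha2 e he) (sq_nonneg _)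
    have h2 := sq_add_sum_le (E k) φ (fun e => f e.1.1 e.1.2)
    rw [hflux0, one_pow] at h2
    have hN0 : (0 : ℝ) ≤ (E k).card := by positivity
    have hNk := hN k hk
    have h3 : a k * φ ^ 2 ≤ ∑ w ∈ Finset.Ioc (2 ^ j0 k : ℤ) (2 ^ j0 k + 2 ^ j0 k),
        rowEnergy U f w := le_trans (mul_le_mul_of_nonneg_right ha1 (sq_nonneg _)) h0
    have h30 : 0 ≤ ∑ w ∈ Finset.Ioc (2 ^ j0 k : ℤ) (2 ^ j0 k + 2 ^ j0 k), rowEnergy U f w :=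
      Finset.sum_nonneg fun w _ => rowEnergy_nonneg U f w
    rw [Finset.sum_insertNone]
    simp only [region]
    set S0 := ∑ w ∈ Finset.Ioc (2 ^ j0 k : ℤ) (2 ^ j0 k + 2 ^ j0 k), rowEnergy U f w
    have h4 : a k * ∑ e ∈ E k, f e.1.1 e.1.2 ^ 2 ≤
        2 * ∑ e ∈ E k, ∑ w ∈ ring e.1.2 (jl k e), rowEnergy U f w := by
      rw [Finset.mul_sum, Finset.mul_sum]
      exact Finset.sum_le_sum h1
    set S1 := ∑ e ∈ E k, ∑ w ∈ ring e.1.2 (jl k e), rowEnergy U f w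
    set Θ := ∑ e ∈ E k, f e.1.1 e.1.2 ^ 2
    have hΘ : 0 ≤ Θ := Finset.sum_nonneg fun _ _ => sq_nonneg _
    rw [div_le_iff₀ (by linarith)]
    have h5 : (1 : ℝ) ≤ (1 + N k) * (φ ^ 2 + Θ) := h2.trans (by gcongr)
    calc a k ≤ a k * ((1 + N k) * (φ ^ 2 + Θ)) := le_mul_of_one_le_right ha0 h5
      _ = (1 + N k) * (a k * φ ^ 2 + a k * Θ) := by ring
      _ ≤ (1 + N k) * (2 * S0 + 2 * S1) := by
          have : 0 ≤ 1 + N k := by linarith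
          refine mul_le_mul_of_nonneg_left ?_ this
          linarith
      _ = _ := by ring
  refine (Finset.sum_le_sum hscale).trans ?_
  rw [← Finset.sum_sigma' ks (fun k => Finset.insertNone (E k))
    (fun k o => ∑ w ∈ region j0 jl ⟨k, o⟩, rowEnergy U f w) |>.symm]
  -- Blocks around `0`, and rings around the same point, are separated because their scales differ;
  -- all other pairs are separated by goodness.
  have hdisj : ∀ p ∈ ks.sigma fun k => Finset.insertNone (E k),
      ∀ p' ∈ ks.sigma fun k => Finset.insertNone (E k), p ≠ p' →
      Disjoint (region j0 jl p) (region j0 jl p') := by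
    have hrr : ∀ k ∈ ks, ∀ k' ∈ ks, ∀ e ∈ E k, ∀ e' ∈ E k', e ≠ e' → jl k' e' ≤ jl k e →
        Disjoint (ring e.1.2 (jl k e)) (ring e'.1.2 (jl k' e')) := by
      intro k hk k' hk' e he e' he' hne hle
      exact disjoint_ring_ring hne (open_of_mem_landEdges hf he') (mem_landEdges.1 he').2.1 hle
        (hlow k hk e he) (hgl k hk e he).1
    rintro ⟨k, o⟩ hp ⟨k', o'⟩ hp' hne
    rw [Finset.mem_sigma, Finset.mem_insertNone] at hp hp'
    obtain ⟨hk, ho⟩ := hp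
    obtain ⟨hk', ho'⟩ := hp'
    simp only at hk ho hk' ho'
    match o, o' with
    | none, none =>
      refine disjoint_block_block (hne0 k hk k' hk' ?_)
      rintro rfl
      exact hne rfl
    | none, some e' =>
      have he' := ho' e' rfl
      exact disjoint_block_ring (open_of_mem_landEdges hf he') (mem_landEdges.1 he').2.1
        (hlow k' hk' e' he') (hg0 k hk)
    | some e, none =>
      have he := ho e rfl
      exact (disjoint_block_ring (open_of_mem_landEdges hf he) (mem_landEdges.1 he).2.1
        (hlow k hk e he) (hg0 k' hk')).symm
    | some e, some e' =>
      have he := ho e rfl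
      have he' := ho' e' rfl
      simp only [region]
      by_cases hee : e = e'
      · subst hee
        have hkk : k ≠ k' := by
          rintro rfl
          exact hne rfl
        rcases Nat.lt_or_gt_of_ne (hnel k hk k' hk' hkk e he he') with h | h
        · exact (disjoint_ring_same _ h).symm
        · exact disjoint_ring_same _ h
      · rcases le_total (jl k' e') (jl k e) with h | h
        · exact hrr k hk k' hk' e he e' he' hee h
        · exact (hrr k' hk' k hk e' he' e he (Ne.symm hee) h).symm
  rw [← Finset.sum_biUnion (fun p hp p' hp' h => hdisj p hp p' hp' h)]
  set W := (ks.sigma fun k => Finset.insertNone (E k)).biUnion (region j0 jl)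
  calc ∑ w ∈ W, rowEnergy U f w = ∑ w ∈ W.filter (· ∈ U), rowEnergy U f w := by
        symm
        refine Finset.sum_subset (Finset.filter_subset _ _) fun w hw hw' => ?_
        have hwU : w ∉ U := fun h => hw' (Finset.mem_filter.2 ⟨hw, h⟩)
        exact Finset.sum_eq_zero fun v _ => by rw [hf.eq_zero_left hwU]; norm_num
    _ ≤ _ := Finset.sum_le_sum_of_subset_of_nonneg (fun w hw => (Finset.mem_filter.1 hw).2)
        fun w _ _ => rowEnergy_nonneg U f w

/-! ### Almost sure properties: finite degrees and recurrence -/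

/-- Borel–Cantelli: the expected degree is finite. -/
theorem ae_finite_degree {β : ℝ} (hβ : 0 ≤ β) :
    ∀ᵐ ω ∂lrpMeasure β, ∀ u : ℤ, {v | (graph ω).Adj u v}.Finite := by
  classical
  rw [ae_all_iff]
  intro u
  set s : Edge → Set Config := fun e => {ω | ω e = true ∧ Touches e {u}} with hs
  have h1 : ∑' e, lrpMeasure β (s e) ≠ ∞ := by
    refine ne_top_of_le_ne_top (ENNReal.ofReal_ne_top (r := decay β * (4 * 1 / 1))) ?_
    rw [ENNReal.tsum_eq_iSup_sum]
    refine iSup_le fun T => ?_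
    have h2 : ∀ e, lrpMeasure β (s e) =
        if Touches e {u} then ENNReal.ofReal (edgeProb β e) else 0 := by
      intro e
      by_cases he : Touches e {u} <;> simp [hs, he, lrpMeasure_open hβ]
    simp only [h2]
    rw [← Finset.sum_filter, ← ENNReal.ofReal_sum_of_nonneg fun e _ => (edgeProb_mem hβ e).1]
    refine ENNReal.ofReal_le_ofReal (sum_edgeProb_le hβ _ ?_)
    have h3 := sum_len_touch_le (T.filter fun e => Touches e {u}) {u} 1 le_rfl fun e he =>
      ⟨(Finset.mem_filter.1 he).2, len_pos e⟩
    simpa using h3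
  filter_upwards [ae_finite_setOfPred_mem h1] with ω hω
  refine ((hω.image fun e => e.1.1).union (hω.image fun e => e.1.2)).subset ?_
  rintro v (⟨h, hv⟩ | ⟨h, hv⟩)
  · exact Or.inr ⟨_, ⟨hv, Or.inl (by simp)⟩, rfl⟩
  · exact Or.inl ⟨_, ⟨hv, Or.inr (by simp)⟩, rfl⟩

/-- The number of cut points in `[-2 Y, -Y)` crossed by an edge contained in `(-∞, 0]`. -/
noncomputable def overlap (Y : ℕ) (e : Edge) : ℕ :=
  ((Finset.Ioc (Y : ℤ) (2 * Y)).filter fun X => e.1.1 < -X ∧ -X ≤ e.1.2 ∧ e.1.2 ≤ 0).card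

theorem overlap_le (Y : ℕ) (e : Edge) : overlap Y e ≤ Y := by
  unfold overlap
  refine (Finset.card_filter_le _ _).trans ?_
  rw [Int.card_Ioc]
  omega

theorem overlap_le_len (Y : ℕ) (e : Edge) : (overlap Y e : ℤ) ≤ len e := by
  have h : (Finset.Ioc (Y : ℤ) (2 * Y)).filter (fun X => e.1.1 < -X ∧ -X ≤ e.1.2 ∧ e.1.2 ≤ 0) ⊆
      Finset.Ico (-e.1.2) (-e.1.1) := by
    intro X hX
    simp only [Finset.mem_filter, Finset.mem_Ico] at hX ⊢
    omega
  have h1 := Finset.card_le_card h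
  rw [Int.card_Ico] at h1
  have := e.2
  unfold overlap len
  omega

theorem overlap_ne_zero {Y : ℕ} {e : Edge} (h : overlap Y e ≠ 0) :
    -(2 * Y : ℤ) ≤ e.1.2 ∧ e.1.2 ≤ 0 := by
  unfold overlap at h
  obtain ⟨X, hX⟩ := Finset.card_ne_zero.1 h
  simp only [Finset.mem_filter, Finset.mem_Ioc] at hX
  omega

/-- Edges of length at most `Y` have overlap at most their length, so each contributes at most
`decay β`, and at most `3 * Y ^ 2` of them count. Longer edges have overlap at most `Y`, and their
probabilities sum to at most `6 * decay β`. -/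
theorem sum_overlap_le {β : ℝ} (hβ : 0 ≤ β) {Y : ℕ} (hY : 1 ≤ Y) (T : Finset Edge) :
    ∑ e ∈ T, edgeProb β e * (overlap Y e : ℝ) ^ 2 ≤ 9 * decay β * Y ^ 2 := by
  classical
  have hd := decay_pos β
  have hY' : (1 : ℝ) ≤ Y := by exact_mod_cast hY
  set T0 := T.filter fun e => overlap Y e ≠ 0 with hT0
  have hT : ∑ e ∈ T, edgeProb β e * (overlap Y e : ℝ) ^ 2 =
      ∑ e ∈ T0, edgeProb β e * (overlap Y e : ℝ) ^ 2 := by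
    symm
    refine Finset.sum_subset (Finset.filter_subset _ _) fun e he he' => ?_
    have : overlap Y e = 0 := by
      by_contra h
      exact he' (Finset.mem_filter.2 ⟨he, h⟩)
    simp [this]
  have hov : ∀ e ∈ T0, -(2 * Y : ℤ) ≤ e.1.2 ∧ e.1.2 ≤ 0 := fun e he =>
    overlap_ne_zero (Finset.mem_filter.1 he).2
  rw [hT, ← Finset.sum_filter_add_sum_filter_not T0 (fun e => len e ≤ Y)]
  have h1 : ∑ e ∈ T0.filter (fun e => len e ≤ Y), edgeProb β e * (overlap Y e : ℝ) ^ 2 ≤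
      decay β * (3 * Y ^ 2) := by
    have hterm : ∀ e ∈ T0.filter (fun e => len e ≤ Y),
        edgeProb β e * (overlap Y e : ℝ) ^ 2 ≤ decay β := by
      intro e _
      have hl : (0 : ℝ) < len e := by exact_mod_cast len_pos e
      have ho : (overlap Y e : ℝ) ≤ len e := by exact_mod_cast overlap_le_len Y e
      calc _ ≤ decay β / (len e : ℝ) ^ 2 * (len e : ℝ) ^ 2 := by
            have := edgeProb_le hβ e
            gcongr
        _ = _ := by field_simp
    have hcard : (T0.filter (fun e => len e ≤ Y)).card ≤
        (Finset.Icc (-(2 * Y : ℤ)) 0 ×ˢ Finset.Icc (1 : ℤ) Y).card := by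
      refine Finset.card_le_card_of_injOn (fun e => (e.1.2, len e)) ?_ ?_
      · intro e he
        simp only [Finset.coe_filter, Set.mem_ofPred_eq] at he
        have := hov e he.1
        have := len_pos e
        simp only [Finset.coe_product, Set.mem_prod, Finset.coe_Icc, Set.mem_Icc]
        omega
      · rintro ⟨⟨a, b⟩, h⟩ _ ⟨⟨a', b'⟩, h'⟩ _ hee
        simp only [len, Prod.mk.injEq] at hee
        simp only [Subtype.mk.injEq, Prod.mk.injEq]
        omega
    rw [Finset.card_product, Int.card_Icc, Int.card_Icc] at hcard
    have hcard' : (T0.filter (fun e => len e ≤ Y)).card ≤ 3 * Y ^ 2 := by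
      refine hcard.trans ?_
      have e1 : (0 + 1 - -(2 * (Y : ℤ))).toNat = 2 * Y + 1 := by omega
      have e2 : ((Y : ℤ) + 1 - 1).toNat = Y := by omega
      rw [e1, e2]
      nlinarith
    have hcard'' : ((T0.filter (fun e => len e ≤ Y)).card : ℝ) ≤ 3 * (Y : ℝ) ^ 2 := by
      exact_mod_cast hcard'
    calc _ ≤ ∑ e ∈ T0.filter (fun e => len e ≤ Y), decay β := Finset.sum_le_sum hterm
      _ = (T0.filter (fun e => len e ≤ Y)).card * decay β := by
          rw [Finset.sum_const, nsmul_eq_mul]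
      _ ≤ 3 * (Y : ℝ) ^ 2 * decay β := by gcongr
      _ = _ := by ring
  have h2 : ∑ e ∈ T0.filter (fun e => ¬ len e ≤ Y), edgeProb β e * (overlap Y e : ℝ) ^ 2 ≤
      decay β * (6 * Y ^ 2) := by
    have hs := sum_len_right_le (T0.filter fun e => ¬ len e ≤ Y) (Finset.Icc (-(2 * Y : ℤ)) 0)
      (fun _ => Y) (fun _ _ => by exact_mod_cast hY) (fun e he => by
        rw [Finset.mem_filter] at he
        have := hov e he.1
        rw [Finset.mem_Icc]
        exact ⟨this, by omega⟩)
    have hs' := sum_edgeProb_le hβ _ hs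
    rw [Finset.sum_const, Int.card_Icc, nsmul_eq_mul] at hs'
    have e1 : (0 + 1 - -(2 * (Y : ℤ))).toNat = 2 * Y + 1 := by omega
    rw [e1] at hs'
    push_cast at hs'
    calc _ ≤ ∑ e ∈ T0.filter (fun e => ¬ len e ≤ Y), edgeProb β e * (Y : ℝ) ^ 2 := by
          refine Finset.sum_le_sum fun e _ => ?_
          have h3 := (edgeProb_mem hβ e).1
          have h4 : (overlap Y e : ℝ) ≤ Y := by exact_mod_cast overlap_le Y e
          gcongr
      _ = (∑ e ∈ T0.filter (fun e => ¬ len e ≤ Y), edgeProb β e) * (Y : ℝ) ^ 2 := by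
          rw [Finset.sum_mul]
      _ ≤ (decay β * 6) * (Y : ℝ) ^ 2 := by
          gcongr
          refine hs'.trans ?_
          gcongr
          rw [mul_div_assoc', div_le_iff₀ (by linarith)]
          linarith
      _ = _ := by ring
  calc _ ≤ decay β * (3 * Y ^ 2) + decay β * (6 * Y ^ 2) := add_le_add h1 h2
    _ = _ := by ring

/-- The normalised sums have bounded expectation. By Fatou their lower limit is almost surely
finite, so one random constant works for infinitely many `Y`. -/
theorem ae_exists_overlap_le {β : ℝ} (hβ : 0 ≤ β) :
    ∀ᵐ ω ∂lrpMeasure β, ∃ C : ℝ, 0 ≤ C ∧ ∃ᶠ Y : ℕ in Filter.atTop, ∀ T : Finset Edge,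
      ∑ e ∈ T, (if ω e = true then (overlap Y e : ℝ) ^ 2 else 0) ≤ C * Y ^ 2 := by
  classical
  set Z : ℕ → Config → ℝ≥0∞ := fun Y ω => ∑' e : Edge,
    (if ω e = true then ENNReal.ofReal ((overlap (Y + 1) e : ℝ) ^ 2 / (Y + 1 : ℕ) ^ 2) else 0)
    with hZ
  have hmeas1 : ∀ (e : Edge) (c : ℝ≥0∞), Measurable fun ω : Config =>
      if ω e = true then c else 0 := fun e c =>
    Measurable.ite (measurableSet_eq_fun (by fun_prop) (by fun_prop)) measurable_const
      measurable_const
  have hmeas : ∀ Y, Measurable (Z Y) := fun Y => Measurable.tsum fun e => hmeas1 e _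
  have hint : ∀ Y, ∫⁻ ω, Z Y ω ∂lrpMeasure β ≤ ENNReal.ofReal (9 * decay β) := by
    intro Y
    simp only [hZ]
    rw [lintegral_tsum fun e => (hmeas1 e _).aemeasurable, ENNReal.tsum_eq_iSup_sum]
    refine iSup_le fun T => ?_
    have h1 : ∀ e, ∫⁻ ω : Config, (if ω e = true then
        ENNReal.ofReal ((overlap (Y + 1) e : ℝ) ^ 2 / (Y + 1 : ℕ) ^ 2) else 0) ∂lrpMeasure β =
        ENNReal.ofReal (edgeProb β e * (overlap (Y + 1) e : ℝ) ^ 2 / (Y + 1 : ℕ) ^ 2) := by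
      intro e
      have h2 : (fun ω : Config => if ω e = true then
          ENNReal.ofReal ((overlap (Y + 1) e : ℝ) ^ 2 / (Y + 1 : ℕ) ^ 2) else 0) =
          {ω : Config | ω e = true}.indicator fun _ =>
            ENNReal.ofReal ((overlap (Y + 1) e : ℝ) ^ 2 / (Y + 1 : ℕ) ^ 2) := by
        ext ω
        by_cases h : ω e = true <;> simp [h]
      rw [h2, lintegral_indicator_const (measurableSet_eq_fun (by fun_prop) (by fun_prop)),
        lrpMeasure_open hβ, ← ENNReal.ofReal_mul (by positivity)]
      congr 1
      ring
    simp only [h1]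
    rw [← ENNReal.ofReal_sum_of_nonneg fun e _ => by
      have := (edgeProb_mem hβ e).1
      positivity]
    apply ENNReal.ofReal_le_ofReal
    rw [← Finset.sum_div, div_le_iff₀ (by positivity)]
    exact sum_overlap_le hβ (by omega) T
  have hfatou : ∫⁻ ω, Filter.liminf (fun Y => Z Y ω) Filter.atTop ∂lrpMeasure β ≠ ∞ := by
    refine ne_top_of_le_ne_top (ENNReal.ofReal_ne_top (r := 9 * decay β)) ?_
    refine (lintegral_liminf_le hmeas).trans ?_
    exact Filter.liminf_le_of_le (by isBoundedDefault) fun b hb => by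
      obtain ⟨Y, hY⟩ := hb.exists
      exact hY.trans (hint Y)
  filter_upwards [ae_lt_top (Measurable.liminf hmeas) hfatou] with ω hω
  obtain ⟨C, hC1, hC2⟩ := ENNReal.lt_iff_exists_nnreal_btwn.1 hω
  refine ⟨C, C.2, ?_⟩
  have hfreq : ∃ᶠ Y in Filter.atTop, Z Y ω < C := Filter.frequently_lt_of_liminf_lt
    (by isBoundedDefault) hC1
  have hfreq' : ∃ᶠ Y in Filter.atTop, ∀ T : Finset Edge,
      ∑ e ∈ T, (if ω e = true then (overlap (Y + 1) e : ℝ) ^ 2 else 0) ≤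
        C * ((Y + 1 : ℕ) : ℝ) ^ 2 := by
    refine hfreq.mono fun Y hY T => ?_
    have h1 := (ENNReal.sum_le_tsum T).trans hY.le
    have h2 : ∑ e ∈ T, (if ω e = true then
        ENNReal.ofReal ((overlap (Y + 1) e : ℝ) ^ 2 / (Y + 1 : ℕ) ^ 2) else 0) =
        ENNReal.ofReal (∑ e ∈ T, (if ω e = true then (overlap (Y + 1) e : ℝ) ^ 2 else 0) /
          (Y + 1 : ℕ) ^ 2) := by
      rw [ENNReal.ofReal_sum_of_nonneg fun e _ => by split_ifs <;> positivity]
      refine Finset.sum_congr rfl fun e _ => ?_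
      split_ifs <;> simp
    rw [h2, ← ENNReal.ofReal_coe_nnreal] at h1
    have h3 := (ENNReal.ofReal_le_ofReal_iff C.2).1 h1
    rw [← Finset.sum_div, div_le_iff₀ (by positivity)] at h3
    exact h3
  rw [Filter.frequently_atTop] at hfreq' ⊢
  intro Y0
  obtain ⟨Y, hY, h⟩ := hfreq' Y0
  exact ⟨Y + 1, by omega, h⟩

/-! ### Reduction to finitely supported flows -/

theorem exists_bound_adj {ω : Config} (hdeg : ∀ u : ℤ, {v | (graph ω).Adj u v}.Finite)
    (A : Finset ℤ) : ∃ W : ℕ, ∀ u ∈ A, ∀ v, (graph ω).Adj u v → |v| ≤ W := by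
  have h : (⋃ u ∈ A, {v | (graph ω).Adj u v}).Finite :=
    A.finite_toSet.biUnion fun u _ => hdeg u
  refine ⟨h.toFinset.sup Int.natAbs, fun u hu v huv => ?_⟩
  have h1 : v ∈ h.toFinset := by
    rw [Set.Finite.mem_toFinset]
    simp only [Set.mem_iUnion]
    exact ⟨u, hu, huv⟩
  have h2 := Finset.le_sup (f := Int.natAbs) h1
  rw [Int.abs_eq_natAbs]
  exact_mod_cast h2

theorem netFlow_eq_sum {ω : Config} {f : ℤ → ℤ → ℝ} (hf : IsFlow (graph ω) f) {u : ℤ}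
    {V : Finset ℤ} (hV : ∀ v, (graph ω).Adj u v → v ∈ V) : netFlow f u = ∑ v ∈ V, f u v :=
  tsum_eq_sum fun v hv => hf.off_edges u v fun h => hv (hV v h)

theorem exists_tail_energy {f : ℤ → ℤ → ℝ} (hen : energy f ≠ ∞) {ε : ℝ} (hε : 0 < ε) :
    ∃ Y0 : ℕ, ∀ V P : Finset ℤ, (∀ v ∈ V, v < -Y0) → ∑ v ∈ V, ∑ u ∈ P, f v u ^ 2 ≤ ε := by
  set h : ℤ → ℝ≥0∞ := fun v => ∑' u, ENNReal.ofReal (f v u ^ 2) with hh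
  have hsum : ∑' v, h v ≠ ∞ := by
    intro htop
    apply hen
    unfold energy
    rw [show (∑' u : ℤ, ∑' v : ℤ, ENNReal.ofReal (f u v ^ 2)) = ∞ from htop]
    exact ENNReal.top_div_of_ne_top (by norm_num)
  have ht := (tendsto_order.1 (ENNReal.tendsto_tsum_compl_atTop_zero hsum)).2 (ENNReal.ofReal ε)
    (ENNReal.ofReal_pos.2 hε)
  obtain ⟨s, hs⟩ := ht.exists
  refine ⟨s.sup Int.natAbs, fun V P hV => ?_⟩
  have hVs : ∀ v ∈ V, v ∉ s := by
    intro v hv hvs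
    have h1 := Finset.le_sup (f := Int.natAbs) hvs
    have h2 := hV v hv
    omega
  rw [← ENNReal.ofReal_le_ofReal_iff hε.le,
    ENNReal.ofReal_sum_of_nonneg fun v _ => Finset.sum_nonneg fun u _ => sq_nonneg _]
  calc _ ≤ ∑ v ∈ V, h v := by
        refine Finset.sum_le_sum fun v _ => ?_
        rw [ENNReal.ofReal_sum_of_nonneg fun u _ => sq_nonneg _]
        exact ENNReal.sum_le_tsum P
    _ = ∑ v ∈ V.subtype (· ∉ s), h v := by
        rw [Finset.sum_subtype_eq_sum_filter, Finset.filter_true_of_mem hVs]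
    _ ≤ ∑' v : {x // x ∉ s}, h v := ENNReal.sum_le_tsum _
    _ ≤ _ := hs.le

/-- Recurrence: a flow of finite energy does not lose mass at `-∞`, so that all of the unit of
flow enters `(0, 2 ^ n]` from the left. -/
theorem flux_eq_one {ω : Config} (hdeg : ∀ u : ℤ, {v | (graph ω).Adj u v}.Finite)
    {C : ℝ} (hC0 : 0 ≤ C) (hC : ∃ᶠ Y : ℕ in Filter.atTop, ∀ T : Finset Edge,
      ∑ e ∈ T, (if ω e = true then (overlap Y e : ℝ) ^ 2 else 0) ≤ C * Y ^ 2)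
    {n : ℕ} {f : ℤ → ℤ → ℝ} (hf : Admissible (graph ω) n f) (hen : energy f ≠ ∞)
    {V : Finset ℤ} (hV : ∀ u ∈ Finset.Ioc (0 : ℤ) (2 ^ n), ∀ v, (graph ω).Adj u v → v ∈ V) :
    ∑ u ∈ V.filter (· ≤ 0), ∑ v ∈ Finset.Ioc (0 : ℤ) (2 ^ n), f u v = 1 := by
  classical
  obtain ⟨⟨J₁, J₂, hJ₁, hJ₂, hfl⟩, hdir⟩ := hf
  have hanti := hfl.toIsFlow.neg_swap
  have h2n : (0 : ℤ) < 2 ^ n := by positivity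
  set φ := ∑ u ∈ V.filter (· ≤ 0), ∑ v ∈ Finset.Ioc (0 : ℤ) (2 ^ n), f u v with hφ
  set X0 := max (J₁.sup Int.natAbs) (V.sup Int.natAbs) with hX0
  have hJX : ∀ u ∈ J₁, -(X0 : ℤ) ≤ u := by
    intro u hu
    have h1 := Finset.le_sup (f := Int.natAbs) hu
    have h2 := le_max_left (J₁.sup Int.natAbs) (V.sup Int.natAbs)
    omega
  have hVX : ∀ u ∈ V, -(X0 : ℤ) ≤ u := by
    intro u hu
    have h1 := Finset.le_sup (f := Int.natAbs) hu
    have h2 := le_max_right (J₁.sup Int.natAbs) (V.sup Int.natAbs)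
    omega
  -- Every cut to the left of the sources, and of the vertices of `V`, is crossed leftwards by the
  -- same amount `1 - φ`.
  have hcut : ∀ X : ℤ, X0 ≤ X → ∀ W : ℤ, (∀ u ∈ Finset.Icc (-X) 0, ∀ v, (graph ω).Adj u v →
      |v| ≤ W) → ∑ u ∈ Finset.Icc (-X) 0, ∑ v ∈ Finset.Ico (-W) (-X), f u v = 1 - φ := by
    intro X hX W hW
    have h1 : ∑ u ∈ Finset.Icc (-X) 0, netFlow f u = 1 := by
      rw [← hfl.source]
      symm
      refine Finset.sum_subset (fun u hu => ?_) fun u hu hu' => hfl.conserved u hu' fun h => ?_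
      · have h2 := hJX u hu
        have h3 := hJ₁ u hu
        rw [Finset.mem_Icc]
        omega
      · have h2 := hJ₂ u h
        rw [Finset.mem_Icc] at hu
        omega
    set D := Finset.Ico (-W) (-X) ∪ Finset.Icc (-X) 0 ∪ Finset.Ioc (0 : ℤ) (2 ^ n) with hD
    have h2 : ∀ u ∈ Finset.Icc (-X) 0, netFlow f u = ∑ v ∈ Finset.Ico (-W) (-X), f u v +
        ∑ v ∈ Finset.Icc (-X) 0, f u v + ∑ v ∈ Finset.Ioc (0 : ℤ) (2 ^ n), f u v := by
      intro u hu
      rw [← Finset.sum_union, ← Finset.sum_union]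
      · refine tsum_eq_sum fun v hv => ?_
        by_contra hne
        have hadj : (graph ω).Adj u v := by
          by_contra h
          exact hne (hfl.off_edges u v h)
        have h3 := hW u hu v hadj
        have h4 := neg_le_abs v
        have h5 := hdir u v (Finset.mem_Icc.1 hu).2
        simp only [Finset.mem_union, Finset.mem_Ico, Finset.mem_Icc, Finset.mem_Ioc] at hv
        exact hne (h5 (by omega))
      · rw [Finset.disjoint_left]
        intro v h3 h4
        simp only [Finset.mem_union, Finset.mem_Ico, Finset.mem_Icc, Finset.mem_Ioc] at h3 h4
        omega
      · rw [Finset.disjoint_left]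
        intro v h3 h4
        simp only [Finset.mem_Ico, Finset.mem_Icc] at h3 h4
        omega
    rw [Finset.sum_congr rfl h2, Finset.sum_add_distrib, Finset.sum_add_distrib,
      sum_sum_antisymm hanti, add_zero] at h1
    have h3 : ∑ u ∈ Finset.Icc (-X) 0, ∑ v ∈ Finset.Ioc (0 : ℤ) (2 ^ n), f u v = φ := by
      symm
      refine Finset.sum_subset (fun u hu => ?_) fun u hu hu' => Finset.sum_eq_zero fun v hv => ?_
      · rw [Finset.mem_filter] at hu
        have := hVX u hu.1
        rw [Finset.mem_Icc]
        omega
      · refine hfl.off_edges u v fun h => hu' (Finset.mem_filter.2 ⟨hV v hv u h.symm, ?_⟩)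
        exact (Finset.mem_Icc.1 hu).2
    linarith
  -- Average the cut identity over `X ∈ (Y, 2 Y]` and apply Cauchy–Schwarz: the energy beyond `-Y`
  -- is at most `ε`, the squared overlaps of the open edges sum to at most `C * Y ^ 2`, and `Y ^ 2`
  -- cancels.
  have hmain : ∀ ε : ℝ, 0 < ε → (1 - φ) ^ 2 ≤ ε * C := by
    intro ε hε
    obtain ⟨Y0, hY0⟩ := exists_tail_energy hen hε
    obtain ⟨Y, hY, hCY⟩ := Filter.frequently_atTop.1 hC (max (max X0 Y0) 1)
    have hYX : (X0 : ℤ) ≤ Y := by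
      have := le_max_left X0 Y0
      omega
    have hYY : Y0 ≤ Y := by
      have := le_max_right X0 Y0
      omega
    have hYpos : (1 : ℝ) ≤ Y := by
      have : 1 ≤ Y := by omega
      exact_mod_cast this
    obtain ⟨W, hW⟩ := exists_bound_adj hdeg (Finset.Icc (-(2 * Y : ℤ)) 0)
    set c : ℤ → ℤ → ℕ := fun v u =>
      ((Finset.Ioc (Y : ℤ) (2 * Y)).filter fun X => v < -X ∧ -X ≤ u ∧ u ≤ 0).card with hc
    set P := Finset.Icc (-(W : ℤ)) 0 ×ˢ Finset.Icc (-(2 * Y : ℤ)) 0 with hP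
    have hsum : (Y : ℝ) * (1 - φ) = ∑ p ∈ P, f p.2 p.1 * c p.1 p.2 := by
      have h1 : (Y : ℝ) * (1 - φ) = ∑ X ∈ Finset.Ioc (Y : ℤ) (2 * Y), (1 - φ) := by
        rw [Finset.sum_const, Int.card_Ioc, nsmul_eq_mul, show (2 * (Y : ℤ) - Y).toNat = Y by omega]
      have h2 : ∀ X ∈ Finset.Ioc (Y : ℤ) (2 * Y), 1 - φ =
          ∑ p ∈ P, if p.1 < -X ∧ -X ≤ p.2 ∧ p.2 ≤ 0 then f p.2 p.1 else 0 := by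
        intro X hX
        rw [Finset.mem_Ioc] at hX
        rw [← hcut X (by omega) W (fun u hu v huv => hW u (by
          rw [Finset.mem_Icc] at hu ⊢
          omega) v huv), Finset.sum_comm, ← Finset.sum_product', ← Finset.sum_filter]
        refine Finset.sum_subset (fun p hp => ?_) fun p hp hp' => ?_
        · simp only [hP, Finset.mem_product, Finset.mem_filter, Finset.mem_Ico,
            Finset.mem_Icc] at hp ⊢
          omega
        · simp only [hP, Finset.mem_product, Finset.mem_filter, Finset.mem_Ico,
            Finset.mem_Icc] at hp hp'
          omega
      rw [h1, Finset.sum_congr rfl h2, Finset.sum_comm]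
      refine Finset.sum_congr rfl fun p _ => ?_
      rw [← Finset.sum_filter, Finset.sum_const, nsmul_eq_mul, mul_comm]
    -- The truncation is free: an edge crossing a cut at `-X` with `X > Y` starts to the left of
    -- `-Y`.
    set f1 : ℤ × ℤ → ℝ := fun p => if p.1 < -(Y : ℤ) then f p.2 p.1 else 0 with hf1
    set g : ℤ × ℤ → ℝ := fun p => if f p.2 p.1 = 0 then 0 else c p.1 p.2 with hg
    have hfg : ∀ p ∈ P, f p.2 p.1 * c p.1 p.2 = f1 p * g p := by
      intro p _
      simp only [hf1, hg]
      by_cases h1 : f p.2 p.1 = 0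
      · simp [h1]
      · rw [if_neg h1]
        split_ifs with h2
        · rfl
        · have : c p.1 p.2 = 0 := by
            rw [hc, Finset.card_eq_zero, Finset.filter_eq_empty_iff]
            intro X hX
            rw [Finset.mem_Ioc] at hX
            omega
          simp [this]
    have hf1sum : ∑ p ∈ P, f1 p ^ 2 ≤ ε := by
      have h1 := hY0 ((Finset.Icc (-(W : ℤ)) 0).filter (· < -(Y : ℤ)))
        (Finset.Icc (-(2 * Y : ℤ)) 0) (fun v hv => by
          rw [Finset.mem_filter] at hv
          omega)
      refine le_of_eq_of_le ?_ h1
      rw [hP, Finset.sum_product, Finset.sum_filter]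
      refine Finset.sum_congr rfl fun v _ => ?_
      simp only [hf1]
      split_ifs with h2
      · exact Finset.sum_congr rfl fun u _ => by rw [hanti u v, neg_sq]
      · simp
    have hgsum : ∑ p ∈ P, g p ^ 2 ≤ C * Y ^ 2 := by
      refine le_trans ?_ (hCY (P.subtype fun p => p.1 < p.2))
      have h1 : ∑ p ∈ P, g p ^ 2 = ∑ p ∈ P.filter (fun p => p.1 < p.2), g p ^ 2 := by
        symm
        refine Finset.sum_subset (Finset.filter_subset _ _) fun p hp hp' => ?_
        have h2 : c p.1 p.2 = 0 := by
          rw [hc, Finset.card_eq_zero, Finset.filter_eq_empty_iff]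
          intro X hX h3
          exact hp' (Finset.mem_filter.2 ⟨hp, by omega⟩)
        simp [hg, h2]
      rw [h1, ← Finset.sum_subtype_eq_sum_filter]
      refine Finset.sum_le_sum fun e _ => ?_
      simp only [hg]
      by_cases h2 : f e.1.2 e.1.1 = 0
      · rw [if_pos h2, zero_pow two_ne_zero]
        split_ifs <;> positivity
      · rw [if_neg h2]
        have hadj : (graph ω).Adj e.1.2 e.1.1 := by
          by_contra h
          exact h2 (hfl.off_edges _ _ h)
        have hopen : ω e = true := by
          have := e.2
          rcases hadj with ⟨h3, h4⟩ | ⟨h3, h4⟩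
          · omega
          · exact h4
        rw [if_pos hopen]
        rfl
    have hcs := Finset.sum_mul_sq_le_sq_mul_sq P f1 g
    rw [← Finset.sum_congr rfl hfg, ← hsum] at hcs
    have h3 : ((Y : ℝ) * (1 - φ)) ^ 2 ≤ ε * (C * Y ^ 2) := hcs.trans (by
      have h4 : 0 ≤ ∑ p ∈ P, g p ^ 2 := Finset.sum_nonneg fun _ _ => sq_nonneg _
      exact mul_le_mul hf1sum hgsum h4 hε.le)
    have h5 : (0 : ℝ) < (Y : ℝ) ^ 2 := by positivity
    have h6 : (Y : ℝ) ^ 2 * (1 - φ) ^ 2 ≤ (Y : ℝ) ^ 2 * (ε * C) := by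
      rw [← mul_pow]
      linarith
    exact le_of_mul_le_mul_left h6 h5
  have hzero : (1 - φ) ^ 2 ≤ 0 := by
    refine le_of_forall_pos_le_add fun δ hδ => ?_
    have h1 := hmain (δ / (C + 1)) (by positivity)
    refine h1.trans ?_
    rw [zero_add, div_mul_eq_mul_div, div_le_iff₀ (by positivity)]
    nlinarith
  have := pow_eq_zero_iff (two_ne_zero) |>.1 (le_antisymm hzero (sq_nonneg _))
  linarith

/-- Restriction of an admissible flow to the edges touching `(0, 2 ^ n]`. -/
theorem exists_finFlow {ω : Config} (hdeg : ∀ u : ℤ, {v | (graph ω).Adj u v}.Finite)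
    {C : ℝ} (hC0 : 0 ≤ C) (hC : ∃ᶠ Y : ℕ in Filter.atTop, ∀ T : Finset Edge,
      ∑ e ∈ T, (if ω e = true then (overlap Y e : ℝ) ^ 2 else 0) ≤ C * Y ^ 2)
    {n : ℕ} {f : ℤ → ℤ → ℝ} (hf : Admissible (graph ω) n f) (hen : energy f ≠ ∞) :
    ∃ (U : Finset ℤ) (g : ℤ → ℤ → ℝ), IsFinFlow ω U g ∧
      (∀ u, 0 < u → u ≤ 2 ^ n → ∑ v ∈ U, g u v = 0) ∧
      ∑ u ∈ U.filter (· ≤ 0), ∑ v ∈ U, g u v = 1 ∧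
      (∀ u v, u ≤ 0 → 2 ^ n < v → g u v = 0) ∧
      ENNReal.ofReal ((∑ u ∈ U, rowEnergy U g u) / 2) ≤ energy f := by
  classical
  obtain ⟨W, hW⟩ := exists_bound_adj hdeg (Finset.Ioc (0 : ℤ) (2 ^ n))
  set A := Finset.Ioc (0 : ℤ) (2 ^ n) with hA
  set U := Finset.Icc (-(W : ℤ)) W ∪ A with hU
  have hVU : ∀ u ∈ A, ∀ v, (graph ω).Adj u v → v ∈ U := by
    intro u hu v huv
    refine Finset.mem_union_left _ (Finset.mem_Icc.2 ?_)
    exact abs_le.1 (hW u hu v huv)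
  have hflux := flux_eq_one hdeg hC0 hC hf hen hVU
  obtain ⟨⟨J₁, J₂, hJ₁, hJ₂, hfl⟩, hdir⟩ := hf
  have hanti := hfl.toIsFlow.neg_swap
  have hadj : ∀ u v, f u v ≠ 0 → (graph ω).Adj u v := fun u v h => by
    by_contra h'
    exact h (hfl.off_edges u v h')
  -- Conservation is needed only inside `A`, and finite degrees make this part of the flow finitely
  -- supported.
  set g : ℤ → ℤ → ℝ := fun u v => if u ∈ A ∨ v ∈ A then f u v else 0 with hg
  have hgf : ∀ u v, g u v ≠ 0 → (u ∈ A ∨ v ∈ A) ∧ f u v ≠ 0 := by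
    intro u v h
    simp only [hg] at h
    split_ifs at h with h1
    · exact ⟨h1, h⟩
    · exact absurd rfl h
  have hfin : IsFinFlow ω U g := by
    refine ⟨fun u v => ?_, fun u v h => hadj u v (hgf u v h).2, fun u v h => ?_⟩
    · simp only [hg]
      by_cases h : u ∈ A ∨ v ∈ A
      · rw [if_pos h, if_pos h.symm, hanti]
      · rw [if_neg h, if_neg fun h' => h h'.symm, neg_zero]
    · obtain ⟨h1 | h1, h2⟩ := hgf u v h
      · exact Finset.mem_union_right _ h1
      · exact hVU v h1 u (hadj u v h2).symm
  refine ⟨U, g, hfin, ?_, ?_, ?_, ?_⟩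
  · intro u hu hu'
    have huA : u ∈ A := Finset.mem_Ioc.2 ⟨hu, hu'⟩
    rw [← hfl.conserved u (fun h => by have := hJ₁ u h; omega)
      (fun h => by have := hJ₂ u h; omega),
      netFlow_eq_sum hfl.toIsFlow (hVU u huA)]
    refine Finset.sum_congr rfl fun v _ => ?_
    simp only [hg]
    rw [if_pos (Or.inl huA)]
  · rw [← hflux]
    refine Finset.sum_congr rfl fun u hu => ?_
    have huA : u ∉ A := by
      rw [Finset.mem_filter] at hu
      rw [hA, Finset.mem_Ioc]
      omega
    symm
    refine Finset.sum_subset_zero_on_sdiff Finset.subset_union_right (fun v hv => ?_)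
      fun v hv => ?_
    · rw [Finset.mem_sdiff] at hv
      simp only [hg]
      rw [if_neg fun h => h.elim huA hv.2]
    · simp only [hg]
      rw [if_pos (Or.inr hv)]
  · intro u v hu hv
    simp only [hg]
    rw [hdir u v hu hv, ite_self]
  · unfold energy
    rw [ENNReal.ofReal_div_of_pos (by norm_num), ENNReal.ofReal_ofNat]
    refine ENNReal.div_le_div_right ?_ 2
    rw [ENNReal.ofReal_sum_of_nonneg fun u _ => rowEnergy_nonneg U g u]
    refine (Finset.sum_le_sum fun u _ => ?_).trans (ENNReal.sum_le_tsum U)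
    rw [rowEnergy, ENNReal.ofReal_sum_of_nonneg fun v _ => sq_nonneg _]
    refine (Finset.sum_le_sum fun v _ => ?_).trans (ENNReal.sum_le_tsum U)
    apply ENNReal.ofReal_le_ofReal
    simp only [hg]
    split_ifs
    · exact le_rfl
    · simpa using sq_nonneg _

/-! ### The exceptional events -/

/-- None of the scales `j + t * i`, `i < m`, is good. -/
def noGood (β α : ℝ) (v : ℤ) (X : Set Edge) (j t m : ℕ) : Set Config :=
  {ω | ∀ i < m, ¬ Good β α v X (j + t * i) ω}

/-- Some open edge from `(-∞, 0]` to `(a, b]` satisfies `F`. -/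
def badLanding (a b : ℤ) (F : Edge → Set Config) : Set Config :=
  ⋃ e : Edge, {ω | Landing a b e ∧ ω e = true ∧ ω ∈ F e}

/-- There are at least `x` open edges from `(-∞, 0]` to `(a, b]`. -/
def manyLandings (a b : ℤ) (x : ℝ) : Set Config :=
  {ω | ∃ T : Finset Edge, (∀ e ∈ T, Landing a b e ∧ ω e = true) ∧ x ≤ T.card}

/-- First moment: the expected number of landings is at most `decay β * x`, and each is bad with
conditional probability at most `η`. -/
theorem measure_badLanding_le {β : ℝ} (hβ : 0 ≤ β) {a b : ℤ} (ha : 0 ≤ a) (F : Edge → Set Config)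
    {x : ℝ} (hx : ∑ y ∈ Finset.Ioc a b, 2 / (y : ℝ) ≤ x) {η : ℝ≥0∞}
    (hF : ∀ e, Landing a b e → lrpMeasure β ({ω | ω e = true} ∩ F e) ≤
      lrpMeasure β {ω | ω e = true} * η) :
    lrpMeasure β (badLanding a b F) ≤ ENNReal.ofReal (decay β * x) * η := by
  classical
  refine (measure_iUnion_le _).trans ?_
  have h1 : ∀ e, lrpMeasure β {ω | Landing a b e ∧ ω e = true ∧ ω ∈ F e} ≤
      (if Landing a b e then ENNReal.ofReal (edgeProb β e) else 0) * η := by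
    intro e
    by_cases he : Landing a b e
    · rw [if_pos he, ← lrpMeasure_open hβ]
      refine le_trans (measure_mono fun ω hω => ?_) (hF e he)
      exact hω.2
    · simp [he]
  refine (ENNReal.tsum_le_tsum h1).trans ?_
  rw [ENNReal.tsum_mul_right]
  gcongr
  rw [ENNReal.tsum_eq_iSup_sum]
  refine iSup_le fun T => ?_
  rw [← Finset.sum_filter, ← ENNReal.ofReal_sum_of_nonneg fun e _ => (edgeProb_mem hβ e).1]
  apply ENNReal.ofReal_le_ofReal
  refine (sum_landing_le hβ ha _ fun e he => (Finset.mem_filter.1 he).2).trans ?_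
  have := decay_pos β
  gcongr

theorem measure_manyLandings_le {β : ℝ} (hβ : 0 ≤ β) {a b : ℤ} (ha : 0 ≤ a)
    {x : ℝ} (hx : ∑ y ∈ Finset.Ioc a b, 2 / (y : ℝ) ≤ x) (z : ℝ) :
    lrpMeasure β (manyLandings a b z) ≤ ENNReal.ofReal (Real.exp (2 * decay β * x - z)) := by
  classical
  have hd := decay_pos β
  have h1 : ∀ T : Finset Edge, ∑ e ∈ T, edgeProb β e *
      (Real.exp (if Landing a b e then (1 : ℝ) else 0) - 1) ≤ 2 * decay β * x := by
    intro T
    have h2 := sum_landing_le hβ ha (T.filter fun e => Landing a b e)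
      fun e he => (Finset.mem_filter.1 he).2
    have h3 : ∑ e ∈ T, edgeProb β e * (Real.exp (if Landing a b e then (1 : ℝ) else 0) - 1) =
        (∑ e ∈ T.filter (fun e => Landing a b e), edgeProb β e) * (Real.exp 1 - 1) := by
      rw [Finset.sum_filter, Finset.sum_mul]
      refine Finset.sum_congr rfl fun e _ => ?_
      split_ifs <;> simp
    have h4 : Real.exp 1 - 1 ≤ 2 := by
      have := Real.exp_one_lt_d9
      linarith
    have h5 : 0 ≤ ∑ e ∈ T.filter (fun e => Landing a b e), edgeProb β e :=
      Finset.sum_nonneg fun e _ => (edgeProb_mem hβ e).1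
    rw [h3]
    calc _ ≤ (∑ e ∈ T.filter (fun e => Landing a b e), edgeProb β e) * 2 := by gcongr
      _ ≤ (decay β * x) * 2 := by
          gcongr
          exact h2.trans (by gcongr)
      _ = _ := by ring
  refine le_trans (measure_mono ?_) (chernoff hβ
    (w := fun e => if Landing a b e then (1 : ℝ) else 0) (fun e => by split_ifs <;> norm_num)
    h1 z)
  rintro ω ⟨T, hT, hz⟩
  refine ⟨T, hz.trans (le_of_eq ?_)⟩
  rw [Finset.sum_congr rfl fun e he => by rw [if_pos (hT e he).2, if_pos (hT e he).1]]
  simp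

/-- Off the exceptional events, the resistance is at least the sum of the contributions of the
scales. -/
theorem sum_le_resistance {β α : ℝ} {ω : Config}
    (hdeg : ∀ u : ℤ, {v | (graph ω).Adj u v}.Finite)
    {C : ℝ} (hC0 : 0 ≤ C) (hC : ∃ᶠ Y : ℕ in Filter.atTop, ∀ T : Finset Edge,
      ∑ e ∈ T, (if ω e = true then (overlap Y e : ℝ) ^ 2 else 0) ≤ C * Y ^ 2)
    {n t K : ℕ} {p m : ℕ → ℕ} {q N : ℕ → ℝ}
    (hp : ∀ k ∈ Finset.Icc 2 K, p k + 4 + 2 * (t * m k) ≤ p (k - 1))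
    (hanti : ∀ k k', 1 ≤ k → k ≤ k' → k' ≤ K → p k' ≤ p k) (hpn : p 1 + 2 ≤ n)
    (hq0 : ∀ k ∈ Finset.Icc 2 K, 0 ≤ q k)
    (hq : ∀ k ∈ Finset.Icc 2 K, ∀ j, p k < j → j ≤ p (k - 1) → q k ≤ quantile β α j)
    (h2 : ω ∉ badLanding (2 ^ n - 2 ^ (p 1 + 1)) (2 ^ n) fun _ => Set.univ)
    (h3 : ∀ k ∈ Finset.Icc 2 K, ω ∉ manyLandings (2 ^ p k) (2 ^ n) (N k))
    (h4 : ∀ k ∈ Finset.Icc 2 K, ω ∉ noGood β α 0 ∅ (p k + 4 + t * m k) t (m k))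
    (h5 : ∀ k ∈ Finset.Icc 2 K, ω ∉ badLanding (2 ^ (p k + 3 + t * m k)) (2 ^ n)
      fun e => noGood β α e.1.2 {e} (p k + 3) t (m k)) :
    ENNReal.ofReal (∑ k ∈ Finset.Icc 2 K, q k / (4 * (1 + N k))) ≤ resistance n ω := by
  classical
  refine le_iInf₂ fun f hf => ?_
  by_cases hen : energy f = ∞
  · rw [hen]
    exact le_top
  obtain ⟨U, g, hg, hcons, hflux, hdir, hgen⟩ := exists_finFlow hdeg hC0 hC hf hen
  refine le_trans (ENNReal.ofReal_le_ofReal ?_) hgen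
  -- The upper half of the window serves `0`, the lower half the landing points. Hence `jl` stays
  -- below `j0`, and scales taken from different windows are different.
  have hexists0 : ∀ k, ∃ j, k ∈ Finset.Icc 2 K → Good β α 0 ∅ j ω ∧
      p k + 4 + t * m k ≤ j ∧ j ≤ p (k - 1) := by
    intro k
    by_cases hk : k ∈ Finset.Icc 2 K
    · have h := h4 k hk
      simp only [noGood, Set.mem_ofPred_eq, not_forall, not_not] at h
      obtain ⟨i, hi, hgood⟩ := h
      refine ⟨_, fun _ => ⟨hgood, by omega, ?_⟩⟩
      have := hp k hk
      have : t * i ≤ t * m k := by gcongr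
      omega
    · exact ⟨0, fun h => absurd h hk⟩
  choose j0 hj0 using hexists0
  have hland : ∀ k ∈ Finset.Icc 2 K, ∀ e ∈ landEdges U g (j0 k + 3),
      Landing (2 ^ (p k + 3 + t * m k)) (2 ^ n) e ∧ ω e = true := by
    intro k hk e he
    have hopen := open_of_mem_landEdges hg he
    rw [mem_landEdges] at he
    refine ⟨⟨he.2.1, ?_, ?_⟩, hopen⟩
    · have h6 : (2 : ℤ) ^ (p k + 3 + t * m k) ≤ 2 ^ (j0 k + 3) := by
        have := (hj0 k hk).2.1
        exact pow_le_pow_right₀ (by norm_num) (by omega)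
      omega
    · by_contra! h
      exact he.2.2.2 (hdir _ _ he.2.1 h)
  have hexistsl : ∀ k e, ∃ j, k ∈ Finset.Icc 2 K → e ∈ landEdges U g (j0 k + 3) →
      Good β α e.1.2 {e} j ω ∧ p k + 3 ≤ j ∧ j ≤ p k + 3 + t * m k := by
    intro k e
    by_cases hk : k ∈ Finset.Icc 2 K ∧ e ∈ landEdges U g (j0 k + 3)
    · have h := h5 k hk.1
      have h6 := hland k hk.1 e hk.2
      simp only [badLanding, Set.mem_iUnion, not_exists, Set.mem_ofPred_eq, not_and] at h
      have h7 := h e h6.1 h6.2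
      simp only [noGood, Set.mem_ofPred_eq, not_forall, not_not] at h7
      obtain ⟨i, hi, hgood⟩ := h7
      have : t * i ≤ t * m k := by gcongr
      exact ⟨_, fun _ _ => ⟨hgood, by omega, by omega⟩⟩
    · exact ⟨0, fun h h' => absurd ⟨h, h'⟩ hk⟩
  choose jl hjl using hexistsl
  have hsep : ∀ k ∈ Finset.Icc 2 K, ∀ k' ∈ Finset.Icc 2 K, k ≠ k' → ∀ j j', p k < j →
      j ≤ p (k - 1) → p k' < j' → j' ≤ p (k' - 1) → j ≠ j' := by
    intro k hk k' hk' hne j j' h6 h7 h8 h9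
    rw [Finset.mem_Icc] at hk hk'
    rcases Nat.lt_or_gt_of_ne hne with h | h
    · have := hanti k (k' - 1) (by omega) (by omega) (by omega)
      omega
    · have := hanti k' (k - 1) (by omega) (by omega) (by omega)
      omega
  have hp1 : ∀ k ∈ Finset.Icc 2 K, p (k - 1) ≤ p 1 := by
    intro k hk
    rw [Finset.mem_Icc] at hk
    exact hanti 1 (k - 1) le_rfl (by omega) (by omega)
  have hmain := sum_le_sum_rowEnergy (β := β) (α := α) hg hcons hflux (ks := Finset.Icc 2 K)
    (j0 := j0) (jl := jl) (a := q) (N := N)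
    (fun k hk => by
      have := (hj0 k hk).2.2
      have := hp1 k hk
      omega)
    (fun k hk => (hj0 k hk).1)
    (fun k hk e he => by
      obtain ⟨h6, h7, h8⟩ := hjl k e hk he
      have h9 := hj0 k hk
      refine ⟨h6, by omega, ?_⟩
      obtain ⟨hL, ho⟩ := hland k hk e he
      simp only [badLanding, Set.mem_iUnion, not_exists, Set.mem_ofPred_eq, not_and,
        Set.mem_univ, not_true_eq_false] at h2
      -- No edge lands close to the right end, so the ring stays inside `(0, 2 ^ n]`, where the flow
      -- is conserved.
      have h10 : ¬ (2 ^ n - 2 ^ (p 1 + 1) < e.1.2) := fun h => h2 e ⟨hL.1, h, hL.2.2⟩ ho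
      have h11 : (2 : ℤ) ^ (jl k e + 1) ≤ 2 ^ (p 1 + 1) := by
        have := hp k hk
        have := hp1 k hk
        exact pow_le_pow_right₀ (by norm_num) (by omega)
      omega)
    (fun k hk k' hk' hne => by
      have h6 := hj0 k hk
      have h7 := hj0 k' hk'
      exact hsep k hk k' hk' hne _ _ (by omega) h6.2.2 (by omega) h7.2.2)
    (fun k hk k' hk' hne e he he' => by
      have h6 := hjl k e hk he
      have h7 := hjl k' e hk' he'
      have := hp k hk
      have := hp k' hk'
      exact hsep k hk k' hk' hne _ _ (by omega) (by omega) (by omega) (by omega))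
    (fun k hk => by
      have h6 := hj0 k hk
      refine ⟨hq0 k hk, hq k hk _ (by omega) h6.2.2, fun e he => ?_⟩
      have h7 := hjl k e hk he
      have := hp k hk
      exact hq k hk _ (by omega) (by omega))
    (fun k hk => by
      by_contra! h
      refine h3 k hk ⟨landEdges U g (j0 k + 3), fun e he => ?_, h.le⟩
      obtain ⟨hL, ho⟩ := hland k hk e he
      refine ⟨⟨hL.1, ?_, hL.2.2⟩, ho⟩
      have h6 : (2 : ℤ) ^ p k ≤ 2 ^ (p k + 3 + t * m k) :=
        pow_le_pow_right₀ (by norm_num) (by omega)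
      exact lt_of_le_of_lt h6 hL.2.1)
  -- Rows count every edge inside `U` twice, which turns the `2` into a `4`.
  have h6 : ∑ k ∈ Finset.Icc 2 K, q k / (4 * (1 + N k)) =
      (∑ k ∈ Finset.Icc 2 K, q k / (2 * (1 + N k))) / 2 := by
    rw [Finset.sum_div]
    refine Finset.sum_congr rfl fun k _ => ?_
    rw [div_div]
    congr 1
    ring
  rw [h6]
  linarith

/-! ### The scales -/

theorem d_succ (L M : ℝ) (k : ℕ) :
    d L M (k + 1) = d L M k + M + L * Real.log (M + d L M k) := rfl

theorem mul_le_d {L M : ℝ} (hL : 0 ≤ L) (hM : 1 ≤ M) (k : ℕ) : k * M ≤ d L M k := by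
  induction k with
  | zero => simp [d]
  | succ k ih =>
    have h0 : 0 ≤ (k : ℝ) * M := by positivity
    have h1 : 0 ≤ L * Real.log (M + d L M k) :=
      mul_nonneg hL (Real.log_nonneg (by linarith))
    rw [d_succ]
    push_cast
    linarith

theorem d_mono {L M : ℝ} (hL : 0 ≤ L) (hM : 1 ≤ M) : Monotone (d L M) := by
  refine monotone_nat_of_le_succ fun k => ?_
  have h2 := mul_le_d hL hM k
  have h0 : 0 ≤ (k : ℝ) * M := by positivity
  have h1 : 0 ≤ L * Real.log (M + d L M k) :=
    mul_nonneg hL (Real.log_nonneg (by linarith))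
  rw [d_succ]
  linarith

theorem b_nonneg_of_le_K {L M : ℝ} (hL : 0 ≤ L) (hM : 1 ≤ M) {n k : ℕ} (hk : k ≤ K L M n) :
    0 ≤ b L M n k := by
  have hne : {k : ℕ | 0 ≤ b L M n k}.Nonempty := ⟨0, by simp [b, d]⟩
  have hbdd : BddAbove {k : ℕ | 0 ≤ b L M n k} := by
    refine ⟨n, fun k hk => ?_⟩
    simp only [Set.mem_ofPred_eq, b] at hk
    have h1 := mul_le_d hL hM k
    have h2 : (k : ℝ) ≤ k * M := le_mul_of_one_le_right (by positivity) hM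
    have : (k : ℝ) ≤ n := by linarith
    exact_mod_cast this
  have h1 : 0 ≤ b L M n (K L M n) := Nat.sSup_mem hne hbdd
  have h2 := d_mono hL hM hk
  unfold b at h1 ⊢
  linarith

theorem minQuantile_nonneg (β α L M : ℝ) (n k : ℕ) : 0 ≤ minQuantile β α L M n k := by
  refine Real.sInf_nonneg ?_
  rintro _ ⟨j, -, rfl⟩
  exact quantile_nonneg β α j

theorem minQuantile_le {β α L M : ℝ} {n k j : ℕ} (h1 : b L M n k < j)
    (h2 : (j : ℝ) ≤ b L M n (k - 1)) : minQuantile β α L M n k ≤ quantile β α j := by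
  refine csInf_le ⟨0, ?_⟩ ⟨j, ⟨h1, h2⟩, rfl⟩
  rintro _ ⟨j, -, rfl⟩
  exact quantile_nonneg β α j

/-- The number of scales used around a point. -/
noncomputable def scaleCount (L M : ℝ) (t k : ℕ) : ℕ :=
  ⌊(d L M k - d L M (k - 1) - 5) / (2 * t)⌋₊

/-- A window has to hold two runs of `scaleCount` scales with spacing `t`, plus the offset `4`. The
`5` in `scaleCount` covers the offset and the rounding of `b`; `5 + 2 * t ≤ M` pays for it and for
the floor, so the logarithmic term is fully available. -/
theorem scaleCount_spec {L M : ℝ} {n t k : ℕ} (hL : 0 ≤ L) (ht : 5 ≤ t) (hM : 5 + 2 * t ≤ M)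
    (hk : 1 ≤ k) (hb : 0 ≤ b L M n k) :
    ⌊b L M n k⌋₊ + 4 + 2 * (t * scaleCount L M t k) ≤ ⌊b L M n (k - 1)⌋₊ ∧
    L * Real.log (M + d L M (k - 1)) ≤ 2 * t * scaleCount L M t k := by
  obtain ⟨k, rfl⟩ := Nat.exists_eq_add_of_le' hk
  rw [Nat.add_sub_cancel]
  unfold scaleCount
  rw [Nat.add_sub_cancel]
  have ht' : (5 : ℝ) ≤ t := by exact_mod_cast ht
  have hM1 : 1 ≤ M := by linarith
  have h1 := mul_le_d hL hM1 k
  have h0 : 0 ≤ (k : ℝ) * M := by positivity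
  have hlog : 0 ≤ L * Real.log (M + d L M k) :=
    mul_nonneg hL (Real.log_nonneg (by linarith))
  set Δ := d L M (k + 1) - d L M k with hΔ
  have hΔ' : Δ = M + L * Real.log (M + d L M k) := by
    rw [hΔ, d_succ]
    ring
  have hpos : 0 ≤ (Δ - 5) / (2 * t) := div_nonneg (by linarith) (by positivity)
  have h2 := Nat.floor_le hpos
  have h3 := Nat.lt_floor_add_one ((Δ - 5) / (2 * t))
  set m := ⌊(Δ - 5) / (2 * t)⌋₊
  rw [le_div_iff₀ (by positivity)] at h2
  rw [div_lt_iff₀ (by positivity)] at h3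
  refine ⟨?_, by nlinarith⟩
  have hb' : b L M n k = b L M n (k + 1) + Δ := by
    unfold b
    rw [hΔ]
    ring
  have h4 := Nat.floor_le hb
  have h5 := Nat.lt_floor_add_one (b L M n k)
  have h6 : ((⌊b L M n (k + 1)⌋₊ + 4 + 2 * (t * m) : ℕ) : ℝ) <
      ((⌊b L M n k⌋₊ + 1 : ℕ) : ℝ) := by
    push_cast
    linarith
  have h7 : ⌊b L M n (k + 1)⌋₊ + 4 + 2 * (t * m) < ⌊b L M n k⌋₊ + 1 := by exact_mod_cast h6
  omega

/-- The exceptional event at the scale `k`. -/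
def badScale (β α L M : ℝ) (n t k : ℕ) : Set Config :=
  manyLandings (2 ^ ⌊b L M n k⌋₊) (2 ^ n) (10 * decay β * d L M k) ∪
  (noGood β α 0 ∅ (⌊b L M n k⌋₊ + 4 + t * scaleCount L M t k) t (scaleCount L M t k) ∪
  badLanding (2 ^ (⌊b L M n k⌋₊ + 3 + t * scaleCount L M t k)) (2 ^ n)
    fun e => noGood β α e.1.2 {e} (⌊b L M n k⌋₊ + 3) t (scaleCount L M t k))

/-- With `x = M + d (k - 1) ≥ k * M`, each of the three exceptional events has probability `O(1 / x
^ 2)`. -/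
theorem measure_badScale_le {β α κ M : ℝ} {n t k : ℕ} (hβ : 0 ≤ β) (hκ : 0 < κ) (ht : 5 ≤ t)
    (H : ∀ (v : ℤ) (X : Set Edge) (j m : ℕ), 3 ≤ j →
      ∀ (B : Set Config) (S : Finset Edge), DependsOn (· ∈ B) (S : Set Edge) →
        (∀ e ∈ S, e ∈ X ∧ 2 ^ (j + t * m) < 4 * len e) →
        lrpMeasure β (B ∩ {ω | ∀ i < m, ¬ Good β α v X (j + t * i) ω}) ≤
          lrpMeasure β B * ENNReal.ofReal (2 * Real.exp (-(κ * m))))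
    (hM : 5 + 2 * t ≤ M) (hk : 1 ≤ k) (hb : 0 ≤ b (8 * t / κ) M n k) :
    lrpMeasure β (badScale β α (8 * t / κ) M n t k) ≤
      ENNReal.ofReal ((3 + 8 * decay β * (1 + 8 * t / κ)) / (k * M) ^ 2) := by
  set L : ℝ := 8 * t / κ with hL
  have ht' : (5 : ℝ) ≤ t := by exact_mod_cast ht
  have hL0 : 0 ≤ L := by positivity
  have hM1 : 1 ≤ M := by linarith
  have hD := one_le_decay β
  obtain ⟨hp, hm⟩ := scaleCount_spec (n := n) hL0 ht hM hk hb
  obtain ⟨k, rfl⟩ := Nat.exists_eq_add_of_le' hk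
  rw [Nat.add_sub_cancel] at hp hm
  unfold badScale
  set p := ⌊b L M n (k + 1)⌋₊ with hpdef
  set m := scaleCount L M t (k + 1)
  have hdk := mul_le_d hL0 hM1 k
  have hk0 : 0 ≤ (k : ℝ) * M := by positivity
  set x := M + d L M k with hx
  have hxk : ((k + 1 : ℕ) : ℝ) * M ≤ x := by
    push_cast
    linarith
  have hx1 : 1 ≤ x := by linarith
  have hlogx : Real.log x ≤ x := (Real.log_le_sub_one_of_pos (by linarith)).trans (by linarith)
  have hlog0 : 0 ≤ Real.log x := Real.log_nonneg hx1
  have hd : d L M (k + 1) = x + L * Real.log x := by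
    rw [d_succ, ← hx]
    linarith
  have hdx : x ≤ d L M (k + 1) := by
    rw [hd]
    have := mul_nonneg hL0 hlog0
    linarith
  have hdx' : d L M (k + 1) ≤ (1 + L) * x := by
    rw [hd]
    nlinarith
  have hpn : p ≤ n := by
    refine Nat.floor_le_of_le ?_
    unfold b
    linarith
  have hnp : (n : ℝ) - p ≤ 2 * d L M (k + 1) := by
    have h1 := Nat.lt_floor_add_one (b L M n (k + 1))
    rw [← hpdef] at h1
    unfold b at h1
    linarith
  have hsn : p + 3 + t * m ≤ n := by
    have h1 : ⌊b L M n k⌋₊ ≤ n := by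
      refine Nat.floor_le_of_le ?_
      unfold b
      linarith
    omega
  -- The value `L = 8 * t / κ` is tuned so that `2 * t * m ≥ L * log x` becomes `κ * m ≥ 4 * log x`.
  have hexp : Real.exp (-(κ * m)) ≤ 1 / x ^ 4 := by
    have h1 : 4 * Real.log x ≤ κ * m := by
      have h2 : L * Real.log x = 2 * t / κ * (4 * Real.log x) := by
        rw [hL]
        ring
      have h3 : 2 * t * (m : ℝ) = 2 * t / κ * (κ * m) := by field_simp
      rw [h2, h3] at hm
      exact le_of_mul_le_mul_left hm (by positivity)
    calc Real.exp (-(κ * m)) ≤ Real.exp (-(4 * Real.log x)) :=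
          Real.exp_le_exp.2 (neg_le_neg h1)
      _ = 1 / x ^ 4 := by
          rw [Real.exp_neg, one_div]
          congr 1
          have := Real.exp_nat_mul (Real.log x) 4
          push_cast at this
          rw [this, Real.exp_log (by linarith)]
  have hx4 : 1 / x ^ 4 ≤ 1 / x ^ 2 :=
    one_div_le_one_div_of_le (by positivity) (pow_le_pow_right₀ hx1 (by norm_num))
  have hA : lrpMeasure β (manyLandings (2 ^ p) (2 ^ n) (10 * decay β * d L M (k + 1))) ≤
      ENNReal.ofReal (1 / x ^ 2) := by
    refine (measure_manyLandings_le hβ (by positivity) (sum_Ioc_two_pow_inv_le hpn) _).trans ?_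
    apply ENNReal.ofReal_le_ofReal
    -- The exponential moment costs at most `8 * decay β * d`, so the threshold `10 * decay β * d`
    -- leaves `2 * decay β * d ≥ 2 * x`.
    have h1 : 2 * decay β * (2 * ((n : ℝ) - p)) - 10 * decay β * d L M (k + 1) ≤ -(2 * x) := by
      have h2 : decay β * ((n : ℝ) - p) ≤ decay β * (2 * d L M (k + 1)) := by gcongr
      have h3 : 1 * x ≤ decay β * d L M (k + 1) := by gcongr
      linarith
    calc _ ≤ Real.exp (-(2 * x)) := Real.exp_le_exp.2 h1
      _ = 1 / Real.exp x ^ 2 := by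
          rw [Real.exp_neg, one_div, ← Real.exp_nat_mul]
          norm_num
      _ ≤ 1 / x ^ 2 := by
          have h4 := Real.add_one_le_exp x
          apply one_div_le_one_div_of_le (by positivity)
          gcongr
          linarith
  have hB : lrpMeasure β (noGood β α 0 ∅ (p + 4 + t * m) t m) ≤ ENNReal.ofReal (2 / x ^ 2) := by
    have h1 := H 0 ∅ (p + 4 + t * m) m (by omega) Set.univ ∅ (fun _ _ _ => rfl) (by simp)
    rw [Set.univ_inter, measure_univ, one_mul] at h1
    refine h1.trans (ENNReal.ofReal_le_ofReal ?_)
    calc 2 * Real.exp (-(κ * m)) ≤ 2 * (1 / x ^ 2) := by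
          gcongr
          exact hexp.trans hx4
      _ = _ := by ring
  have hC : lrpMeasure β (badLanding (2 ^ (p + 3 + t * m)) (2 ^ n)
      fun e => noGood β α e.1.2 {e} (p + 3) t m) ≤
      ENNReal.ofReal (8 * decay β * (1 + L) / x ^ 2) := by
    refine (measure_badLanding_le hβ (by positivity) _ (sum_Ioc_two_pow_inv_le hsn)
      (η := ENNReal.ofReal (2 * Real.exp (-(κ * m)))) fun e he => ?_).trans ?_
    · refine H e.1.2 {e} (p + 3) m (by omega) {ω | ω e = true} {e} ?_ ?_
      · intro ω ω' h
        have h1 : ω e = ω' e := h e (by simp)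
        simp only [Set.mem_ofPred_eq, h1]
      · intro e' he'
        rw [Finset.mem_singleton] at he'
        subst he'
        refine ⟨rfl, ?_⟩
        have h1 := he.1
        have h2 := he.2.1
        have h3 : (0 : ℤ) < 2 ^ (p + 3 + t * m) := by positivity
        unfold len
        omega
    · have hnp' : (n : ℝ) - (p + 3 + t * m : ℕ) ≤ 2 * ((1 + L) * x) := by
        push_cast
        have : (0 : ℝ) ≤ t * m := by positivity
        linarith
      have hn0 : 0 ≤ (n : ℝ) - (p + 3 + t * m : ℕ) := sub_nonneg.2 (by exact_mod_cast hsn)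
      rw [← ENNReal.ofReal_mul (by positivity)]
      apply ENNReal.ofReal_le_ofReal
      -- The number of landings has expectation `O(x)`; the factor `1 / x ^ 4` absorbs it with room
      -- to spare.
      calc _ ≤ decay β * (2 * (2 * ((1 + L) * x))) * (2 * (1 / x ^ 4)) := by gcongr
        _ = 8 * decay β * (1 + L) / x ^ 3 := by field_simp; ring
        _ ≤ _ := by
            gcongr
            norm_num
  refine (measure_union_le _ _).trans ((add_le_add hA ((measure_union_le _ _).trans
    (add_le_add hB hC))).trans ?_)
  rw [← ENNReal.ofReal_add (by positivity) (by positivity),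
    ← ENNReal.ofReal_add (by positivity) (by positivity)]
  apply ENNReal.ofReal_le_ofReal
  calc _ = (3 + 8 * decay β * (1 + L)) / x ^ 2 := by ring
    _ ≤ _ := by gcongr

theorem two_pow_ge (s : ℕ) : (s : ℝ) ≤ 2 ^ s := by
  exact_mod_cast Nat.lt_two_pow_self.le

/-- An interval of length `2 ^ (p + 1)` at distance of order `2 ^ n` receives `O(2 ^ (p - n))`
landings on average, and `2 ^ s ≥ s` turns this into `O(1 / M)`. The gap of at least `M` between `p`
and `n` is supplied by the first window, which is why the sum starts at `k = 2`. -/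
theorem measure_landing_end_le {β M : ℝ} {n p : ℕ} (hβ : 0 ≤ β) (hM : 0 < M) (hp : p + 2 ≤ n)
    (hpM : M ≤ (n : ℝ) - p) :
    lrpMeasure β (badLanding (2 ^ n - 2 ^ (p + 1)) (2 ^ n) fun _ => Set.univ) ≤
      ENNReal.ofReal (8 * decay β / M) := by
  have hd := decay_pos β
  obtain ⟨s, rfl⟩ := Nat.exists_eq_add_of_le hp
  have hP : (0 : ℤ) < 2 ^ p := by positivity
  have hS : (1 : ℤ) ≤ 2 ^ s := one_le_pow₀ (by norm_num)
  have hn : (2 : ℤ) ^ (p + 2 + s) = 4 * (2 ^ p * 2 ^ s) := by ring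
  have hPS : (2 : ℤ) ^ p ≤ 2 ^ p * 2 ^ s := le_mul_of_one_le_right hP.le hS
  have ha : (0 : ℤ) < 2 ^ (p + 2 + s) - 2 ^ (p + 1) := by
    rw [hn, pow_succ]
    omega
  have h1 := sum_Ioc_inv_le ha (b := 2 ^ (p + 2 + s)) (by
    have : (0 : ℤ) < 2 ^ (p + 1) := by positivity
    omega)
  have h2 := measure_badLanding_le hβ ha.le (fun _ => Set.univ) h1 (η := 1) (fun e _ => by simp)
  rw [mul_one] at h2
  refine h2.trans (ENNReal.ofReal_le_ofReal ?_)
  have hS' : M ≤ 2 * 2 ^ (s + 1) := by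
    have h3 := two_pow_ge (s + 2)
    push_cast at hpM h3
    have h4 : (2 : ℝ) ^ (s + 2) = 2 * 2 ^ (s + 1) := by ring
    linarith
  have hP' : (0 : ℝ) < 2 ^ p := by positivity
  have hS1 : (1 : ℝ) ≤ 2 ^ s := one_le_pow₀ (by norm_num)
  push_cast
  have e1 : (2 : ℝ) ^ (p + 2 + s) - (2 ^ (p + 2 + s) - 2 ^ (p + 1)) = 2 * 2 ^ p := by ring
  have e2 : (2 : ℝ) ^ (p + 2 + s) - 2 ^ (p + 1) = 2 ^ p * (4 * 2 ^ s - 2) := by ring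
  have e3 : 2 * (2 * (2 : ℝ) ^ p) / (2 ^ p * (4 * 2 ^ s - 2)) = 4 / (4 * 2 ^ s - 2) := by
    field_simp
    norm_num
  have e4 : (2 : ℝ) ^ (s + 1) = 2 * 2 ^ s := by ring
  rw [e4] at hS'
  have e5 : 2 * (2 * (2 : ℝ) ^ p) / (2 ^ p * (4 * 2 ^ s - 2)) ≤ 8 / M := by
    rw [e3, div_le_div_iff₀ (by linarith) hM]
    linarith
  rw [e1, e2]
  refine le_trans (le_of_eq ?_) ((mul_le_mul_of_nonneg_left e5 hd.le).trans (le_of_eq (by ring)))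
  ring

theorem sum_inv_sq_Icc_le (K : ℕ) : ∑ k ∈ Finset.Icc 2 K, ((k : ℝ) ^ 2)⁻¹ ≤ 1 := by
  have h1 : Finset.Icc 2 K = Finset.Ioo 1 (K + 1) := by
    ext k
    simp only [Finset.mem_Icc, Finset.mem_Ioo]
    omega
  rw [h1]
  refine (sum_Ioo_inv_sq_le (α := ℝ) 1 (K + 1)).trans ?_
  norm_num

end LRP

/-! ### Choice of the constants and union bound over the windows. -/

theorem proposition3p9 (β : ℝ) (hβ : 0 < β) :
    ∃ c : ℝ, 0 < c ∧ ∃ L : ℝ, 0 < L ∧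
      ∀ α : ℝ, 0 < α → α ≤ 1 / 2 →
        ∃ M' : ℝ, 0 < M' ∧ ∃ n₀ : ℕ, 0 < n₀ ∧
          ∀ M : ℝ, M' ≤ M → ∀ n : ℕ, n₀ < n →
            c * ∑ k ∈ Finset.Icc 2 (LRP.K L M n),
              LRP.minQuantile β α L M n k / LRP.d L M k ≤ LRP.quantile β α n := by
  open LRP in
  obtain ⟨κ, hκ, t, ht, H⟩ := exists_no_good_scale_le hβ.le
  have hD := decay_pos β
  have hD1 := one_le_decay β
  have ht' : (5 : ℝ) ≤ t := by exact_mod_cast ht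
  set L : ℝ := 8 * t / κ with hL
  have hL0 : 0 < L := by positivity
  -- `44 = 4 * (1 + 10)`: the core bound has denominator `4 * (1 + 10 * decay β * d k)`, and `decay
  -- β * d k ≥ 1`.
  refine ⟨1 / (44 * decay β), by positivity, L, hL0, fun α hα hα' => ?_⟩
  set G : ℝ := 3 + 8 * decay β * (1 + L) with hG
  have hG0 : 0 < G := by positivity
  -- The first term keeps the bad scales below `α / 2`, the second does the same for the landings
  -- near `2 ^ n`, and the third makes the windows long enough for `scaleCount_spec`.
  refine ⟨2 * G / α + 16 * decay β / α + (5 + 2 * t), by positivity, 1, one_pos,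
    fun M hM n _ => ?_⟩
  have h2G : 0 < 2 * G / α := by positivity
  have h16 : 0 < 16 * decay β / α := by positivity
  have hMt : 5 + 2 * t ≤ M := by linarith
  have hM1 : 1 ≤ M := by linarith
  set Kn := K L M n with hKn
  by_cases hK2 : Kn < 2
  · rw [Finset.Icc_eq_empty (by omega), Finset.sum_empty, mul_zero]
    exact quantile_nonneg β α n
  have hbn : ∀ k, k ≤ Kn → 0 ≤ b L M n k := fun k hk => b_nonneg_of_le_K hL0.le hM1 hk
  set p : ℕ → ℕ := fun k => ⌊b L M n k⌋₊ with hp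
  have hanti : ∀ k k', 1 ≤ k → k ≤ k' → k' ≤ Kn → p k' ≤ p k := by
    intro k k' _ hkk _
    apply Nat.floor_mono
    have := d_mono hL0.le hM1 hkk
    unfold b
    linarith
  have hd1 : M ≤ d L M 1 := by simpa using mul_le_d hL0.le hM1 1
  have hp1 : (p 1 : ℝ) ≤ n - M := by
    have h1 : (p 1 : ℝ) ≤ b L M n 1 := Nat.floor_le (hbn 1 (by omega))
    unfold b at h1
    linarith
  have hpn : p 1 + 2 ≤ n := by
    have : (p 1 : ℝ) + 2 ≤ n := by linarith
    exact_mod_cast this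
  have hdpos : ∀ k ∈ Finset.Icc 2 Kn, 1 ≤ d L M k := by
    intro k hk
    rw [Finset.mem_Icc] at hk
    have := d_mono hL0.le hM1 (by omega : 1 ≤ k)
    linarith
  set Null : Set Config := {ω | ¬ ((∀ u : ℤ, {v | (graph ω).Adj u v}.Finite) ∧
    ∃ C : ℝ, 0 ≤ C ∧ ∃ᶠ Y : ℕ in Filter.atTop, ∀ T : Finset Edge,
      ∑ e ∈ T, (if ω e = true then (overlap Y e : ℝ) ^ 2 else 0) ≤ C * Y ^ 2)} with hNull
  have hNull0 : lrpMeasure β Null = 0 :=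
    ae_iff.1 ((ae_finite_degree hβ.le).and (ae_exists_overlap_le hβ.le))
  set End : Set Config := badLanding (2 ^ n - 2 ^ (p 1 + 1)) (2 ^ n) fun _ => Set.univ with hEnd
  -- One exceptional set serves all flows at once, so the lower bound passes to the infimum defining
  -- the resistance.
  set Bad : Set Config := Null ∪ (End ∪ ⋃ k ∈ Finset.Icc 2 Kn, badScale β α L M n t k) with hBad
  have hBadM : lrpMeasure β Bad ≤ ENNReal.ofReal α := by
    have hEndM : lrpMeasure β End ≤ ENNReal.ofReal (α / 2) := by
      refine (measure_landing_end_le hβ.le (M := M) (by linarith) hpn (by linarith)).trans ?_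
      apply ENNReal.ofReal_le_ofReal
      have h1 : 16 * decay β / α ≤ M := by linarith
      rw [div_le_iff₀ hα] at h1
      rw [div_le_iff₀ (by linarith)]
      linarith
    have hScale : lrpMeasure β (⋃ k ∈ Finset.Icc 2 Kn, badScale β α L M n t k) ≤
        ENNReal.ofReal (α / 2) := by
      refine (measure_biUnion_finset_le _ _).trans ?_
      have h1 : ∀ k ∈ Finset.Icc 2 Kn, lrpMeasure β (badScale β α L M n t k) ≤
          ENNReal.ofReal (G / M * ((k : ℝ) ^ 2)⁻¹) := by
        intro k hk
        rw [Finset.mem_Icc] at hk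
        refine (measure_badScale_le hβ.le hκ ht (H α hα hα') hMt (by omega)
          (hbn k hk.2)).trans ?_
        apply ENNReal.ofReal_le_ofReal
        have hk0 : (0 : ℝ) < k := by
          have : 0 < k := by omega
          exact_mod_cast this
        calc G / (k * M) ^ 2 = G / M ^ 2 * ((k : ℝ) ^ 2)⁻¹ := by
              rw [mul_pow]
              field_simp
          _ ≤ _ := by
              gcongr
              exact le_self_pow₀ hM1 two_ne_zero
      refine (Finset.sum_le_sum h1).trans ?_
      rw [← ENNReal.ofReal_sum_of_nonneg fun k _ => by positivity]
      apply ENNReal.ofReal_le_ofReal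
      rw [← Finset.mul_sum]
      have h2 : 2 * G / α ≤ M := by linarith
      rw [div_le_iff₀ hα] at h2
      calc _ ≤ G / M * 1 := by
            gcongr
            exact sum_inv_sq_Icc_le Kn
        _ ≤ α / 2 := by
            rw [mul_one, div_le_iff₀ (by linarith)]
            linarith
    refine (measure_union_le _ _).trans ?_
    rw [hNull0, zero_add]
    refine (measure_union_le _ _).trans ((add_le_add hEndM hScale).trans ?_)
    rw [← ENNReal.ofReal_add (by positivity) (by positivity), add_halves]
  refine le_quantile hβ.le hα.le (by linarith) ?_ hBadM fun ω hω => ?_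
  · refine mul_nonneg (by positivity) (Finset.sum_nonneg fun k hk => ?_)
    have := hdpos k hk
    exact div_nonneg (minQuantile_nonneg _ _ _ _ _ _) (by linarith)
  simp only [hBad, Set.mem_union, Set.mem_iUnion, not_or, not_exists] at hω
  obtain ⟨hω1, hω2, hω3⟩ := hω
  rw [hNull, Set.mem_ofPred_eq, not_not] at hω1
  obtain ⟨hdeg, C, hC0, hC⟩ := hω1
  simp only [badScale, Set.mem_union, not_or] at hω3
  have hmain := sum_le_resistance (β := β) (α := α) hdeg hC0 hC (n := n) (t := t) (K := Kn)
    (p := p) (m := scaleCount L M t) (q := minQuantile β α L M n)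
    (N := fun k => 10 * decay β * d L M k)
    (fun k hk => by
      rw [Finset.mem_Icc] at hk
      exact (scaleCount_spec hL0.le ht hMt (by omega) (hbn k hk.2)).1)
    hanti hpn (fun k _ => minQuantile_nonneg _ _ _ _ _ _)
    (fun k hk j hj hj' => by
      rw [Finset.mem_Icc] at hk
      exact minQuantile_le ((Nat.floor_lt (hbn k hk.2)).1 hj)
        ((Nat.le_floor_iff (hbn (k - 1) (by omega))).1 hj'))
    hω2 (fun k hk => (hω3 k hk).1) (fun k hk => (hω3 k hk).2.1) (fun k hk => (hω3 k hk).2.2)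
  refine le_trans (ENNReal.ofReal_le_ofReal ?_) hmain
  rw [Finset.mul_sum]
  refine Finset.sum_le_sum fun k hk => ?_
  have h1 := hdpos k hk
  have h2 := minQuantile_nonneg β α L M n k
  have h3 : 4 * (1 + 10 * decay β * d L M k) ≤ 44 * decay β * d L M k := by
    have : 1 * 1 ≤ decay β * d L M k := by gcongr
    linarith
  calc 1 / (44 * decay β) * (minQuantile β α L M n k / d L M k) =
        minQuantile β α L M n k / (44 * decay β * d L M k) := by
        rw [div_mul_div_comm, one_mul]
    _ ≤ _ := by
        apply div_le_div_of_nonneg_left h2 _ h3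
        have : 0 < decay β * d L M k := by positivity
        linarith
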